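/- **Proposition 3.5.** Let $N\ge 1$, let $\Omega\subset\mathbb{R}^N$ be a nonempty bounded convex open set, and let $f,\psi,u$ be real functions that are smooth on $\overline\Omega$ (up to the boundary), with $f>0$ on $\overline\Omega$. Let $\varepsilon>0$ and $$ g=(1+\varepsilon u)f,\qquad \varphi(x)=\tfrac12|x|^2+\varepsilon\psi(x), $$ and suppose that $g\ge 0$ on $\Omega$ and that $d\mu=f\,dx$ and $d\nu=g\,dx$ are probability measures on $\Omega$. Suppose that $\partial_n\psi=0$ on $\partial\Omega$, and that $\nabla\varphi$ maps $\Omega$ into $\Omega$ and $$ f(x)=g(\nabla\varphi(x))\,\det D^2\varphi(x)\qquad\text{for all }x\in\Omega . $$ Let $\lambda_1(L)$ be the smallest positive eigenvalue of $L=-\Delta-\nabla(\log f)\cdot\nabla$ on $\Omega$ with Neumann boundary condition, in the weak sense: $\lambda$ is an eigenvalue if there is $0\neq v\in H^1(\Omega)$ with $\int_\Omega\nabla v\cdot\nabla w\,d\mu=\lambda\int_\Omega v\,w\,d\mu$ for all $w\in C^1(\overline\Omega)$. Let $$ W_2(\mu,\nu)^2=\inf_\pi\int_{\Omega\times\Omega}|x-y|^2\,d\pi(x,y),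 $$ where $\pi$ runs over the probability measures on $\Omega\times\Omega$ with marginals $\mu$ and $\nu$, and let $$ \|u\|_{\dot H^{-1}(d\mu)}=\sup\Big\{\int_\Omega u\,w\,d\mu\;:\;w\in C^1(\overline\Omega),\ \int_\Omega|\nabla w|^2\,d\mu=1\Big\}. $$ Then $\|u\|_{\dot H^{-1}(d\mu)}$ is finite, and $$ \big|W_2(\mu,\nu)-\varepsilon\,\|u\|_{\dot H^{-1}(d\mu)}\big|\le C\,\varepsilon^2 , $$ where $C$ depends only on $N$ and on upper bounds on $\Omega$ for $$ |\nabla f|,\ |H_f|,\ |\nabla\psi|,\ |H_\psi|,\ |u|,\ |\nabla u|,\quad\text{and for } |\Omega|\text{ and }\lambda_1(L)^{-1}. $$ Here $H_h$ is the Hessian of $h$, $|H_h|$ its operator norm, and $|\Omega|$ the Lebesgue measure of $\Omega$. -/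

import Mathlib

open MeasureTheory
open scoped ContDiff

noncomputable section

namespace W2Lin

/-- Euclidean space `ℝᴺ`. -/
abbrev E (N : ℕ) : Type := EuclideanSpace ℝ (Fin N)

variable {N : ℕ}

/-- The Hessian of `h` at `x`, as the linear map `D(∇h)(x)`; its norm is the operator norm. -/
def hess (h : E N → ℝ) (x : E N) : E N →L[ℝ] E N :=
  fderiv ℝ (gradient h) x

/-- The measure on `Ω` with density `h` with respect to Lebesgue measure (extended by zero to
`ℝᴺ`). -/
def densityMeasure (Ω : Set (E N)) (h : E N → ℝ) : Measure (E N) :=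
  (volume.restrict Ω).withDensity (fun x => ENNReal.ofReal (h x))

/-- Transference plans: measures on the product whose marginals are `μ` and `ν`. If `μ` and `ν`
are probability measures carried by `Ω`, such a plan is a probability measure carried by
`Ω × Ω`. -/
def transferencePlans (μ ν : Measure (E N)) : Set (Measure (E N × E N)) :=
  {π | π.map Prod.fst = μ ∧ π.map Prod.snd = ν}

/-- The transport cost `∫ |x - y|² dπ(x,y)`. -/
def transportCost (π : Measure (E N × E N)) : ENNReal :=
  ∫⁻ p, ENNReal.ofReal (‖p.1 - p.2‖ ^ 2) ∂π

/-- The quadratic Wasserstein distance. It is finite for measures carried by a bounded set. -/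
def W2 (μ ν : Measure (E N)) : ℝ :=
  Real.sqrt (⨅ π ∈ transferencePlans μ ν, transportCost π).toReal

/-- The homogeneous Sobolev norm `(∫ |∇φ|² dμ)^(1/2)`, where `μ` is carried by an open set on
which `φ` is differentiable. -/
def hOneNorm (μ : Measure (E N)) (φ : E N → ℝ) : ℝ :=
  Real.sqrt (∫ x, ‖gradient φ x‖ ^ 2 ∂μ)

/-- The numbers `∫ u φ dμ`, where `φ` is continuously differentiable up to the boundary of `Ω` and
has homogeneous Sobolev norm one; here `μ` has density `f` on `Ω`. -/
def hMinusOnePairings (Ω : Set (E N)) (f u : E N → ℝ) : Set ℝ :=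
  {r | ∃ φ : E N → ℝ, ContDiffOn ℝ 1 φ (closure Ω) ∧
    hOneNorm (densityMeasure Ω f) φ = 1 ∧ r = ∫ x, u x * φ x ∂(densityMeasure Ω f)}

/-- The dual norm of `u`, for the measure with density `f` on `Ω`. -/
def hMinusOneNorm (Ω : Set (E N)) (f u : E N → ℝ) : ℝ :=
  sSup (hMinusOnePairings Ω f u)

/-- `F` is the weak gradient of `v` on `Ω`. -/
def HasWeakGradient (Ω : Set (E N)) (v : E N → ℝ) (F : E N → E N) : Prop :=
  ∀ η : E N → ℝ, ContDiff ℝ ∞ η → HasCompactSupport η → tsupport η ⊆ Ω →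
    ∫ x in Ω, v x • gradient η x = - ∫ x in Ω, η x • F x

/-- `l` is an eigenvalue of `L = -Δ - ∇(log f) · ∇` on `Ω` with Neumann boundary condition, in the
usual weak sense: there is an eigenfunction `v ≠ 0` in the Sobolev space `H¹(Ω)`, with weak
gradient `F`, such that `∫ ∇v · ∇w dμ = l ∫ v w dμ` for all `w ∈ C¹(closure Ω)`, where `dμ = f dx`.
For `v` smooth up to the boundary this says `L v = l v` in `Ω` and `∂ₙv = 0` on the boundary, since
`∫ w (L v) dμ = ∫ ∇v · ∇w dμ - ∫_{∂Ω} w (∂ₙv) f ds`. -/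
def IsNeumannEigenvalue (Ω : Set (E N)) (f : E N → ℝ) (l : ℝ) : Prop :=
  ∃ (v : E N → ℝ) (F : E N → E N),
    MemLp v 2 (volume.restrict Ω) ∧ MemLp F 2 (volume.restrict Ω) ∧ HasWeakGradient Ω v F ∧
    ¬ (v =ᵐ[volume.restrict Ω] 0) ∧
    ∀ w : E N → ℝ, ContDiffOn ℝ 1 w (closure Ω) →
      ∫ x, inner ℝ (F x) (gradient w x) ∂(densityMeasure Ω f)
        = l * ∫ x, v x * w x ∂(densityMeasure Ω f)

/-- `l` is the smallest positive Neumann eigenvalue `λ₁(L)` of `L = -Δ - ∇(log f) · ∇` on `Ω`. -/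
def IsLambdaOne (Ω : Set (E N)) (f : E N → ℝ) (l : ℝ) : Prop :=
  IsLeast {t : ℝ | 0 < t ∧ IsNeumannEigenvalue Ω f t} l

/-- `n` is an exterior unit normal of the convex set `Ω` at the boundary point `x`. -/
def IsExteriorUnitNormal (Ω : Set (E N)) (x n : E N) : Prop :=
  ‖n‖ = 1 ∧ ∀ y ∈ Ω, inner ℝ n (y - x) ≤ 0

/-- `∂ₙψ = 0` on the boundary of the convex set `Ω`, for `ψ ∈ C¹(closure Ω)`. At an edge or a
corner, where there are several exterior unit normals, the condition for all of them follows by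
continuity from the one at nearby boundary points with a single normal. -/
def NeumannBoundary (Ω : Set (E N)) (ψ : E N → ℝ) : Prop :=
  ∀ x ∈ frontier Ω, ∀ n : E N, IsExteriorUnitNormal Ω x n →
    inner ℝ n (gradientWithin ψ (closure Ω) x) = 0

/-- The function `φ(x) = |x|² / 2 + ε ψ(x)`. -/
def potential (ε : ℝ) (ψ : E N → ℝ) : E N → ℝ :=
  fun x => ‖x‖ ^ 2 / 2 + ε * ψ x

/-- The density `g = (1 + ε u) f`. -/
def perturbed (ε : ℝ) (f u : E N → ℝ) : E N → ℝ :=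
  fun x => (1 + ε * u x) * f x

/-- The function `φ` satisfies `f(x) = g(∇φ(x)) det D²φ(x)` in `Ω`. As `f` and `g` live on `Ω`, this
includes `∇φ(x) ∈ Ω`. -/
def SolvesMongeAmpere (Ω : Set (E N)) (f g φ : E N → ℝ) : Prop :=
  ∀ x ∈ Ω, gradient φ x ∈ Ω ∧ f x = g (gradient φ x) * (hess φ x).det

end W2Lin

end

/-! Write T(x) = ∇φ(x) = x + ε∇ψ(x), T_t(x) = x + tε∇ψ(x), and let P be the L²(μ) norm of ∇ψ
(`hOneNorm`).

For small ε the map T is injective with Jacobian 1 + O(ε), and the Monge-Ampère equation says that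
it pushes μ to ν (`SmallTransport.map_shift`). As T is the gradient of a convex function,
Kantorovich duality gives the exact value W₂ = εP (`SmallTransport.W2_eq`). It remains to show that
P and the dual norm of u differ by O(ε).

Both directions start from ε∫ u h dμ = ∫ (h∘T - h) dμ. With h = ψ, Taylor's formula bounds the dual
norm from below by P - M²ε (`SmallTransport.hOneNorm_le_hMinusOneNorm`). For the upper bound, let
∫|∇w|² dμ = 1, write the increment of w as the integral over t of ε∇w(T_t)·∇ψ, and apply Young's
inequality and the change of variables T_t. This costs the ratio of f(x) to f(T_t x) det DT_t(x),
and the constant may not depend on a lower bound for f. At t = 1 the ratio is controlled by the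
Monge-Ampère equation; for t < 1 the Hessian bound along the segment gives f(T_t x) ≥ (1 - O(ε))
f(x) - O(ε²), which suffices where f is large compared with ε². Hence h = χ(f) w is used, with χ a
cutoff at level κ = 8M³ε² (`SmallTransport.integral_mul_le`). The errors live where f = O(ε²), a set
of μ-mass O(ε²) since |Ω| ≤ M; and w is bounded in L²(μ) by the Poincaré inequality with constant
1/λ₁, after subtraction of its mean, which is harmless as u has mean zero.

That Poincaré inequality (`IsLambdaOne.mul_integral_sq_le`) needs an argument because λ₁ is defined
through eigenfunctions: a mean-zero function with Rayleigh quotient below λ₁ would, by minimization,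
produce a smaller positive eigenvalue. Compactness comes from Rellich's theorem, proved by
Poincaré's inequality on the cells of a fine grid.

For ε above a threshold depending on N and M, both terms are O(1 + ε), hence O(ε²): the dual norm is
bounded through λ₁, and W₂ by the cost of the product plan, the variance of μ being at most N/λ₁. -/

namespace W2Lin

/-! ### Minimization of an abstract Rayleigh quotient -/

open Filter Topology in
/-- A pair of linear maps `J`, `G` into Hilbert spaces, such that bounded sequences for the graph
norm have `J`-Cauchy subsequences: the Rayleigh quotient `‖G w‖² / ‖J w‖²` attains its infimum in
the closure of the graph, and the minimizer solves the Euler-Lagrange equation. -/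
theorem exists_rayleigh_minimizer {V H K : Type*} [AddCommGroup V] [Module ℝ V]
    [NormedAddCommGroup H] [InnerProductSpace ℝ H] [CompleteSpace H]
    [NormedAddCommGroup K] [InnerProductSpace ℝ K] [CompleteSpace K]
    (J : V →ₗ[ℝ] H) (G : V →ₗ[ℝ] K)
    (hc : ∀ (w : ℕ → V) (B : ℝ), (∀ n, ‖J (w n)‖ ≤ B ∧ ‖G (w n)‖ ≤ B) →
      ∃ φ : ℕ → ℕ, StrictMono φ ∧ CauchySeq (fun n => J (w (φ n))))
    {lam : ℝ} {w₀ : V} (h₀ : ‖G w₀‖ ^ 2 < lam * ‖J w₀‖ ^ 2) :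
    ∃ (t : ℝ) (v : H) (F : K), 0 ≤ t ∧ t < lam ∧ ‖v‖ = 1 ∧ ‖F‖ ^ 2 = t ∧
      (∃ w : ℕ → V, Tendsto (fun n => J (w n)) atTop (𝓝 v) ∧
        Tendsto (fun n => G (w n)) atTop (𝓝 F)) ∧
      ∀ w, inner ℝ F (G w) = t * inner ℝ v (J w) := by
  have hJ0 : 0 < ‖J w₀‖ := by
    rcases (norm_nonneg (J w₀)).eq_or_lt with h | h
    · rw [← h] at h₀; nlinarith [sq_nonneg ‖G w₀‖]
    · exact h
  set S : Set ℝ := {r | ∃ w : V, ‖J w‖ = 1 ∧ r = ‖G w‖ ^ 2} with hS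
  have hSb : BddBelow S := ⟨0, by rintro r ⟨w, -, rfl⟩; positivity⟩
  have hmem : ∀ w : V, J w ≠ 0 → ‖G w‖ ^ 2 / ‖J w‖ ^ 2 ∈ S := by
    intro w hw
    have hpos : 0 < ‖J w‖ := norm_pos_iff.2 hw
    refine ⟨(‖J w‖)⁻¹ • w, ?_, ?_⟩
    · rw [map_smul, norm_smul, norm_inv, norm_norm]; field_simp
    · rw [map_smul, norm_smul, norm_inv, norm_norm]; field_simp
  have hSn : S.Nonempty := ⟨_, hmem w₀ (norm_pos_iff.1 hJ0)⟩
  set t := sInf S with ht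
  have ht0 : 0 ≤ t := Real.sInf_nonneg (by rintro r ⟨w, -, rfl⟩; positivity)
  have htl : t < lam := by
    refine (csInf_le hSb (hmem w₀ (norm_pos_iff.1 hJ0))).trans_lt ?_
    rw [div_lt_iff₀ (by positivity)]; exact h₀
  have hray : ∀ w : V, t * ‖J w‖ ^ 2 ≤ ‖G w‖ ^ 2 := by
    intro w
    by_cases hw : J w = 0
    · rw [hw]; simp
    · have := csInf_le hSb (hmem w hw)
      have hpos : 0 < ‖J w‖ := norm_pos_iff.2 hw
      rwa [le_div_iff₀ (by positivity)] at this
  obtain ⟨r, -, hrt, hrS⟩ := exists_seq_tendsto_sInf hSn hSb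
  choose w hw1 hw2 using hrS
  have hrt' : Tendsto (fun n => ‖G (w n)‖ ^ 2) atTop (𝓝 t) := by
    simpa only [← hw2] using hrt
  obtain ⟨B, hB⟩ := hrt'.bddAbove_range
  obtain ⟨φ, hφ, hJc⟩ := hc w (max 1 (B + 1)) (fun n => by
    refine ⟨(hw1 n).le.trans (le_max_left _ _), le_trans ?_ (le_max_right _ _)⟩
    have : ‖G (w n)‖ ^ 2 ≤ B := hB ⟨n, rfl⟩
    nlinarith [norm_nonneg (G (w n))])
  have hGt : Tendsto (fun n => ‖G (w (φ n))‖ ^ 2) atTop (𝓝 t) := hrt'.comp hφ.tendsto_atTop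
  -- The parallelogram identity for `G` minus `t` times the one for `J`, with the Rayleigh
  -- inequality applied to the sum. It makes a minimizing sequence that is Cauchy under `J` Cauchy
  -- under `G`.
  have hkey : ∀ m n, ‖G (w (φ m)) - G (w (φ n))‖ ^ 2 ≤
      2 * (‖G (w (φ m))‖ ^ 2 - t) + 2 * (‖G (w (φ n))‖ ^ 2 - t)
        + t * ‖J (w (φ m)) - J (w (φ n))‖ ^ 2 := by
    intro m n
    have h1 := parallelogram_law_with_norm ℝ (G (w (φ m))) (G (w (φ n)))
    have h2 := parallelogram_law_with_norm ℝ (J (w (φ m))) (J (w (φ n)))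
    have h3 := hray (w (φ m) + w (φ n))
    rw [map_add, map_add] at h3
    rw [hw1, hw1] at h2
    have h4 : ‖J (w (φ m)) + J (w (φ n))‖ ^ 2 = 4 - ‖J (w (φ m)) - J (w (φ n))‖ ^ 2 := by
      nlinarith
    rw [h4] at h3
    nlinarith
  have hGc : CauchySeq (fun n => G (w (φ n))) := by
    rw [Metric.cauchySeq_iff] at hJc ⊢
    intro η hη
    have hη2 : 0 < η ^ 2 / 8 := by positivity
    -- The denominator `t + 1` in place of `t` covers the case `t = 0`.
    obtain ⟨N₁, hN₁⟩ := hJc (η / (2 * (t + 1))) (by positivity)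
    obtain ⟨N₂, hN₂⟩ := (hGt.eventually (gt_mem_nhds (show t < t + η ^ 2 / 8 by linarith))).exists_forall_of_atTop
    refine ⟨max N₁ N₂, fun m hm n hn => ?_⟩
    have a1 := hN₁ m (le_trans (le_max_left _ _) hm) n (le_trans (le_max_left _ _) hn)
    have a2 := hN₂ m (le_trans (le_max_right _ _) hm)
    have a3 := hN₂ n (le_trans (le_max_right _ _) hn)
    rw [dist_eq_norm] at a1 ⊢
    have a4 := hkey m n
    have a5 : t * ‖J (w (φ m)) - J (w (φ n))‖ ^ 2 ≤ η ^ 2 / 4 := by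
      have : ‖J (w (φ m)) - J (w (φ n))‖ ^ 2 ≤ (η / (2 * (t + 1))) ^ 2 := by gcongr
      calc t * ‖J (w (φ m)) - J (w (φ n))‖ ^ 2 ≤ t * (η / (2 * (t + 1))) ^ 2 := by gcongr
        _ = η ^ 2 / 4 * (t / (t + 1) ^ 2) := by field_simp; ring
        _ ≤ η ^ 2 / 4 * 1 := by
          gcongr
          rw [div_le_one (by positivity)]; nlinarith
        _ = _ := by ring
    refine lt_of_pow_lt_pow_left₀ 2 hη.le ?_
    nlinarith
  obtain ⟨v, hv⟩ := cauchySeq_tendsto_of_complete hJc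
  obtain ⟨F, hF⟩ := cauchySeq_tendsto_of_complete hGc
  have hv1 : ‖v‖ = 1 := by
    refine tendsto_nhds_unique hv.norm ?_
    simp only [hw1]; exact tendsto_const_nhds
  have hF1 : ‖F‖ ^ 2 = t := tendsto_nhds_unique (hF.norm.pow 2) hGt
  refine ⟨t, v, F, ht0, htl, hv1, hF1, ⟨fun n => w (φ n), hv, hF⟩, fun x => ?_⟩
  have hvar : ∀ s : ℝ, t * ‖v + s • J x‖ ^ 2 ≤ ‖F + s • G x‖ ^ 2 := by
    intro s
    refine le_of_tendsto_of_tendsto' (((hv.add_const (s • J x)).norm.pow 2).const_mul t)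
      ((hF.add_const (s • G x)).norm.pow 2) (fun n => ?_)
    have := hray (w (φ n) + s • x)
    simpa only [map_add, map_smul] using this
  -- The constant term vanishes because the limit attains the infimum. A quadratic in `s` that is
  -- nonnegative everywhere and vanishes at 0 has no linear term: this is the Euler-Lagrange
  -- equation.
  have hq : ∀ s : ℝ, 0 ≤ (‖G x‖ ^ 2 - t * ‖J x‖ ^ 2) * (s * s)
      + (2 * (inner ℝ F (G x) - t * inner ℝ v (J x))) * s + 0 := by
    intro s
    have := hvar s
    rw [norm_add_sq_real, norm_add_sq_real, inner_smul_right, inner_smul_right, norm_smul,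
      norm_smul, hv1, hF1, mul_pow, mul_pow, Real.norm_eq_abs, sq_abs] at this
    nlinarith
  have hd := discrim_le_zero hq
  simp only [discrim, mul_zero, sub_zero] at hd
  have : 2 * (inner ℝ F (G x) - t * inner ℝ v (J x)) = 0 := by
    have := le_antisymm hd (sq_nonneg _)
    exact pow_eq_zero_iff (two_ne_zero) |>.1 this
  linarith

end W2Lin

/-! ### Bounded C¹ functions, and Poincaré's inequality as a double integral -/

namespace W2Lin

/-- `w` is continuously differentiable on `Ω`, and bounded there together with its gradient. -/
structure IsBoundedC1 {N : ℕ} (Ω : Set (E N)) (w : E N → ℝ) : Prop where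
  diff : ∀ x ∈ Ω, DifferentiableAt ℝ w x
  cont : ContinuousOn (gradient w) Ω
  bdd : ∃ B, ∀ x ∈ Ω, |w x| ≤ B ∧ ‖gradient w x‖ ≤ B

variable {N : ℕ} {Ω : Set (E N)} {w : E N → ℝ}

theorem norm_gradient (w : E N → ℝ) (x : E N) : ‖gradient w x‖ = ‖fderiv ℝ w x‖ :=
  (InnerProductSpace.toDual ℝ (E N)).symm.norm_map _

theorem measurable_gradient (w : E N → ℝ) : Measurable (gradient w) :=
  (InnerProductSpace.toDual ℝ (E N)).symm.continuous.measurable.comp (measurable_fderiv ℝ w)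

theorem uniqueDiffOn_closure (ho : IsOpen Ω) (hn : Ω.Nonempty) (hc : Convex ℝ Ω) :
    UniqueDiffOn ℝ (closure Ω) :=
  uniqueDiffOn_convex hc.closure (hn.mono (ho.subset_interior_iff.2 subset_closure))

theorem mem_nhds_closure (ho : IsOpen Ω) {x : E N} (hx : x ∈ Ω) : closure Ω ∈ nhds x :=
  Filter.mem_of_superset (ho.mem_nhds hx) subset_closure

/-- At points of `Ω` the derivative within the closure is the ordinary one, and it is continuous on
a compact set. The resulting bounds serve integrability only; they never enter the final constant.
-/
theorem isBoundedC1_of_contDiffOn (ho : IsOpen Ω) (hn : Ω.Nonempty) (hc : Convex ℝ Ω)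
    (hb : Bornology.IsBounded Ω) (hw : ContDiffOn ℝ 1 w (closure Ω)) : IsBoundedC1 Ω w := by
  have hcomp : IsCompact (closure Ω) := hb.isCompact_closure
  have hfd : ∀ x ∈ Ω, fderivWithin ℝ w (closure Ω) x = fderiv ℝ w x := fun x hx =>
    fderivWithin_of_mem_nhds (mem_nhds_closure ho hx)
  have hcont := hw.continuousOn_fderivWithin (uniqueDiffOn_closure ho hn hc) le_rfl
  refine ⟨fun x hx => ?_, ?_, ?_⟩
  · exact (hw.differentiableOn one_ne_zero x (subset_closure hx)).differentiableAt
      (mem_nhds_closure ho hx)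
  · exact (InnerProductSpace.toDual ℝ (E N)).symm.continuous.comp_continuousOn
      ((hcont.mono subset_closure).congr fun x hx => (hfd x hx).symm)
  · obtain ⟨B₁, h₁⟩ := hcomp.exists_bound_of_continuousOn hw.continuousOn
    obtain ⟨B₂, h₂⟩ := hcomp.exists_bound_of_continuousOn hcont
    refine ⟨max B₁ B₂, fun x hx => ⟨(h₁ x (subset_closure hx)).trans (le_max_left _ _), ?_⟩⟩
    rw [norm_gradient, ← hfd x hx]
    exact (h₂ x (subset_closure hx)).trans (le_max_right _ _)

namespace IsBoundedC1

theorem continuousOn (h : IsBoundedC1 Ω w) : ContinuousOn w Ω :=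
  fun x hx => (h.diff x hx).continuousAt.continuousWithinAt

theorem sub {w' : E N → ℝ} (h : IsBoundedC1 Ω w) (h' : IsBoundedC1 Ω w') :
    IsBoundedC1 Ω (fun x => w x - w' x) := by
  have hg : ∀ x ∈ Ω, gradient (fun x => w x - w' x) x = gradient w x - gradient w' x := by
    intro x hx
    simp only [gradient]
    rw [fderiv_fun_sub (h.diff x hx) (h'.diff x hx), map_sub]
  refine ⟨fun x hx => (h.diff x hx).sub (h'.diff x hx), (h.cont.sub h'.cont).congr hg, ?_⟩
  obtain ⟨B, hB⟩ := h.bdd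
  obtain ⟨B', hB'⟩ := h'.bdd
  refine ⟨B + B', fun x hx => ⟨(abs_sub _ _).trans (add_le_add (hB x hx).1 (hB' x hx).1), ?_⟩⟩
  rw [hg x hx]
  exact (norm_sub_le _ _).trans (add_le_add (hB x hx).2 (hB' x hx).2)

theorem hasDerivAt_segment (h : IsBoundedC1 Ω w) {x p : E N} {t : ℝ} (ht : x + t • p ∈ Ω) :
    HasDerivAt (fun s : ℝ => w (x + s • p)) (inner ℝ (gradient w (x + t • p)) p) t := by
  have h1 : HasDerivAt (fun s : ℝ => x + s • p) p t := by
    simpa using ((hasDerivAt_id t).smul_const p).const_add x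
  have h2 := (h.diff _ ht).hasFDerivAt.comp_hasDerivAt t h1
  rwa [← inner_gradient_left] at h2

theorem continuousOn_segment (h : IsBoundedC1 Ω w) {x p : E N}
    (hseg : ∀ t ∈ Set.Icc (0 : ℝ) 1, x + t • p ∈ Ω) :
    ContinuousOn (fun t : ℝ => gradient w (x + t • p)) (Set.Icc 0 1) :=
  h.cont.comp (by fun_prop) hseg

theorem sub_eq_integral (h : IsBoundedC1 Ω w) {x p : E N}
    (hseg : ∀ t ∈ Set.Icc (0 : ℝ) 1, x + t • p ∈ Ω) :
    w (x + p) - w x = ∫ t in (0 : ℝ)..1, inner ℝ (gradient w (x + t • p)) p := by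
  rw [intervalIntegral.integral_eq_sub_of_hasDerivAt (f := fun s : ℝ => w (x + s • p))]
  · simp
  · intro t ht
    rw [Set.uIcc_of_le zero_le_one] at ht
    exact h.hasDerivAt_segment (hseg t ht)
  · apply ContinuousOn.intervalIntegrable
    rw [Set.uIcc_of_le zero_le_one]
    exact (h.continuousOn_segment hseg).inner continuousOn_const

/-- The increment of `w` along a segment, estimated in the mean square. -/
theorem enorm_sub_sq_le (h : IsBoundedC1 Ω w) {x p : E N}
    (hseg : ∀ t ∈ Set.Icc (0 : ℝ) 1, x + t • p ∈ Ω) :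
    ENNReal.ofReal ((w (x + p) - w x) ^ 2) ≤ ENNReal.ofReal (‖p‖ ^ 2) *
      ∫⁻ t in Set.Icc (0 : ℝ) 1, ENNReal.ofReal (‖gradient w (x + t • p)‖ ^ 2) := by
  have hc := h.continuousOn_segment hseg
  set H : ℝ → ℝ := fun t => inner ℝ (gradient w (x + t • p)) p with hH
  have hcH : ContinuousOn H (Set.Icc 0 1) := hc.inner continuousOn_const
  have hiH : IntervalIntegrable H volume 0 1 := by
    apply ContinuousOn.intervalIntegrable; rwa [Set.uIcc_of_le zero_le_one]
  have hiH2 : IntervalIntegrable (fun t => H t ^ 2) volume 0 1 := by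
    apply ContinuousOn.intervalIntegrable; rw [Set.uIcc_of_le zero_le_one]; exact hcH.pow 2
  have hiG : IntegrableOn (fun t => ‖gradient w (x + t • p)‖ ^ 2) (Set.Icc (0 : ℝ) 1) volume :=
    ContinuousOn.integrableOn_Icc (hc.norm.pow 2)
  have hiG' : IntervalIntegrable (fun t => ‖gradient w (x + t • p)‖ ^ 2 * ‖p‖ ^ 2) volume 0 1 := by
    apply ContinuousOn.intervalIntegrable; rw [Set.uIcc_of_le zero_le_one]
    exact (hc.norm.pow 2).mul continuousOn_const
  set c := ∫ t in (0 : ℝ)..1, H t with hcdef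
  -- Jensen's inequality, read off from the nonnegativity of the variance of `H` on the unit
  -- interval.
  have h1 : c ^ 2 ≤ ∫ t in (0 : ℝ)..1, H t ^ 2 := by
    have h0 : 0 ≤ ∫ t in (0 : ℝ)..1, (H t - c) ^ 2 :=
      intervalIntegral.integral_nonneg zero_le_one fun t _ => sq_nonneg _
    have h2 : ∫ t in (0 : ℝ)..1, (H t - c) ^ 2
        = (∫ t in (0 : ℝ)..1, H t ^ 2) - 2 * c * c + c ^ 2 := by
      have : ∀ t, (H t - c) ^ 2 = H t ^ 2 - (2 * c) * H t + c ^ 2 := fun t => by ring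
      simp only [this]
      rw [intervalIntegral.integral_add (hiH2.sub (hiH.const_mul _)) (by simp),
        intervalIntegral.integral_sub hiH2 (hiH.const_mul _),
        intervalIntegral.integral_const_mul]
      simp [hcdef]
    nlinarith
  have h2 : ∫ t in (0 : ℝ)..1, H t ^ 2 ≤
      ∫ t in (0 : ℝ)..1, ‖gradient w (x + t • p)‖ ^ 2 * ‖p‖ ^ 2 := by
    refine intervalIntegral.integral_mono_on zero_le_one hiH2 hiG' fun t _ => ?_
    rw [← mul_pow, ← sq_abs]
    exact pow_le_pow_left₀ (abs_nonneg _) (abs_real_inner_le_norm _ _) 2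
  rw [h.sub_eq_integral hseg, ← ofReal_integral_eq_lintegral_ofReal hiG
    (Filter.Eventually.of_forall fun t => by positivity), ← ENNReal.ofReal_mul (by positivity)]
  refine ENNReal.ofReal_le_ofReal ((h1.trans h2).trans (le_of_eq ?_))
  rw [intervalIntegral.integral_mul_const, intervalIntegral.integral_of_le zero_le_one,
    ← integral_Icc_eq_integral_Ioc, mul_comm]

end IsBoundedC1

theorem lintegral_comp_affine (G : E N → ENNReal) (c : E N) {t : ℝ} (ht : 0 < t) :
    ∫⁻ y, G (c + t • y) = ENNReal.ofReal ((t ^ N)⁻¹) * ∫⁻ z, G z := by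
  have h1 : ∫⁻ y, G (c + t • y) = ∫⁻ z, G (c + z) ∂(Measure.map (fun y => t • y) volume) :=
    (lintegral_map_equiv (fun z => G (c + z))
      (Homeomorph.smulOfNeZero t ht.ne').toMeasurableEquiv).symm
  rw [h1]
  have h2 := Measure.map_addHaar_smul (volume : Measure (E N)) ht.ne'
  have h3 : Measure.map (fun y : E N => t • y) volume = Measure.map (t • ·) volume := rfl
  rw [h3, h2, lintegral_smul_measure, lintegral_add_left_eq_self]
  simp [abs_of_pos ht]

/-- Poincaré's inequality on a convex set, for double integrals. -/
theorem lintegral_lintegral_sub_sq_le (hw : IsBoundedC1 Ω w) {K : Set (E N)} (hK : Convex ℝ K)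
    (hKm : MeasurableSet K) (hKΩ : K ⊆ Ω) {d : ℝ} (hd : ∀ x ∈ K, ∀ y ∈ K, ‖y - x‖ ^ 2 ≤ d) :
    ∫⁻ x in K, ∫⁻ y in K, ENNReal.ofReal ((w y - w x) ^ 2) ≤
      ENNReal.ofReal (2 ^ (N + 1) * d) * volume K *
        ∫⁻ x in K, ENNReal.ofReal (‖gradient w x‖ ^ 2) := by
  set G : E N → ENNReal := K.indicator fun z => ENNReal.ofReal (‖gradient w z‖ ^ 2) with hG
  have hGm : Measurable G := by
    refine Measurable.indicator ?_ hKm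
    have := measurable_gradient w
    fun_prop
  set I := ∫⁻ z, G z with hI
  have hI' : I = ∫⁻ x in K, ENNReal.ofReal (‖gradient w x‖ ^ 2) := lintegral_indicator hKm _
  have hpow : ∀ t : ℝ, 1 / 2 ≤ t → ENNReal.ofReal ((t ^ N)⁻¹) ≤ ENNReal.ofReal (2 ^ N) := by
    intro t ht
    refine ENNReal.ofReal_le_ofReal ?_
    have : (0 : ℝ) < 1 / 2 := by norm_num
    calc (t ^ N)⁻¹ ≤ ((1 / 2 : ℝ) ^ N)⁻¹ := by gcongr
      _ = 2 ^ N := by simp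
  have hlate : ∀ t : ℝ, 1 / 2 ≤ t → ∀ x : E N,
      ∫⁻ y in K, G (x + t • (y - x)) ≤ ENNReal.ofReal (2 ^ N) * I := by
    intro t ht x
    calc ∫⁻ y in K, G (x + t • (y - x)) ≤ ∫⁻ y, G (x + t • (y - x)) :=
          setLIntegral_le_lintegral _ _
      _ = ∫⁻ y, G ((x - t • x) + t • y) := by
          congr 1; ext y; congr 1; rw [smul_sub]; abel
      _ ≤ _ := by
          rw [lintegral_comp_affine G _ (by linarith)]
          exact mul_le_mul_left (hpow t ht) _
  -- One of `t` and `1 - t` is at least 1/2. The point of the segment is substituted for the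
  -- endpoint with that coefficient, so that the Jacobian factor is at most `2 ^ N`; this avoids the
  -- singularity at the other end.
  have hslice : ∀ t : ℝ, ∫⁻ x in K, ∫⁻ y in K, G (x + t • (y - x)) ≤
      ENNReal.ofReal (2 ^ N) * I * volume K := by
    intro t
    rcases le_total (1 / 2) t with ht | ht
    · refine (lintegral_mono fun x => hlate t ht x).trans ?_
      simp
    · rw [lintegral_lintegral_swap (by
        apply Measurable.aemeasurable; apply hGm.comp; fun_prop)]
      refine (lintegral_mono (g := fun _ => ENNReal.ofReal (2 ^ N) * I) fun y => ?_).trans ?_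
      · have := hlate (1 - t) (by linarith) y
        refine le_trans (le_of_eq ?_) this
        congr 1; ext x; congr 1
        module
      · simp
  have hpt : ∀ x ∈ K, ∀ y ∈ K, ENNReal.ofReal ((w y - w x) ^ 2) ≤
      ENNReal.ofReal d * ∫⁻ t in Set.Icc (0 : ℝ) 1, G (x + t • (y - x)) := by
    intro x hx y hy
    have hseg : ∀ t ∈ Set.Icc (0 : ℝ) 1, x + t • (y - x) ∈ K := fun t ht =>
      hK.add_smul_sub_mem hx hy ht
    have := hw.enorm_sub_sq_le (x := x) (p := y - x) fun t ht => hKΩ (hseg t ht)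
    rw [add_sub_cancel] at this
    refine this.trans ?_
    refine mul_le_mul' (ENNReal.ofReal_le_ofReal (hd x hx y hy)) ?_
    · refine le_of_eq (setLIntegral_congr_fun measurableSet_Icc fun t ht => ?_)
      simp only [hG]; rw [Set.indicator_of_mem (hseg t ht)]
  calc ∫⁻ x in K, ∫⁻ y in K, ENNReal.ofReal ((w y - w x) ^ 2)
      ≤ ∫⁻ x in K, ∫⁻ y in K, ENNReal.ofReal d *
          ∫⁻ t in Set.Icc (0 : ℝ) 1, G (x + t • (y - x)) :=
        setLIntegral_mono' hKm fun x hx => setLIntegral_mono' hKm fun y hy => hpt x hx y hy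
    _ = ENNReal.ofReal d * ∫⁻ x in K, ∫⁻ y in K,
          ∫⁻ t in Set.Icc (0 : ℝ) 1, G (x + t • (y - x)) := by
        simp only [lintegral_const_mul' _ _ ENNReal.ofReal_ne_top]
    _ = ENNReal.ofReal d * ∫⁻ x in K, ∫⁻ t in Set.Icc (0 : ℝ) 1,
          ∫⁻ y in K, G (x + t • (y - x)) := by
        congr 1
        refine lintegral_congr fun x => ?_
        rw [lintegral_lintegral_swap]
        apply Measurable.aemeasurable; apply hGm.comp; fun_prop
    _ = ENNReal.ofReal d * ∫⁻ t in Set.Icc (0 : ℝ) 1, ∫⁻ x in K,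
          ∫⁻ y in K, G (x + t • (y - x)) := by
        congr 1
        rw [lintegral_lintegral_swap]
        apply Measurable.aemeasurable
        have hq : Measurable fun q : (E N × ℝ) × E N => G (q.1.1 + q.1.2 • (q.2 - q.1.1)) :=
          hGm.comp (by fun_prop)
        exact hq.lintegral_prod_right' (ν := volume.restrict K)
    _ ≤ ENNReal.ofReal d * ∫⁻ t in Set.Icc (0 : ℝ) 1, ENNReal.ofReal (2 ^ N) * I * volume K := by
        gcongr with t; exact hslice t
    _ = ENNReal.ofReal d * (ENNReal.ofReal (2 ^ N) * I * volume K) := by simp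
    -- The spare factor 2 is cancelled later, when the double integral is expanded as `2 * V` times
    -- the variance.
    _ ≤ ENNReal.ofReal (2 ^ (N + 1) * d) * volume K * I := by
        rw [ENNReal.ofReal_mul (by positivity), pow_succ]
        have : ENNReal.ofReal (2 ^ N) ≤ ENNReal.ofReal (2 ^ N * 2) :=
          ENNReal.ofReal_le_ofReal (by linarith [pow_pos (two_pos (α := ℝ)) N])
        calc _ = ENNReal.ofReal (2 ^ N) * ENNReal.ofReal d * volume K * I := by ring
          _ ≤ _ := by gcongr
    _ = _ := by rw [hI']

end W2Lin

/-! ### Poincaré's inequality on a grid and Rellich's theorem -/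

namespace W2Lin

variable {N : ℕ} {Ω : Set (E N)} {w : E N → ℝ}

theorem integrable_of_continuousOn {F : Type*} [NormedAddCommGroup F] (ho : IsOpen Ω)
    {μ : Measure (E N)} [IsFiniteMeasure μ] (hμ : μ ≪ volume.restrict Ω) {h : E N → F}
    (hc : ContinuousOn h Ω) {B : ℝ} (hB : ∀ x ∈ Ω, ‖h x‖ ≤ B) : Integrable h μ := by
  exact Integrable.of_bound ((hc.aestronglyMeasurable ho.measurableSet).mono_ac hμ) B
    (hμ.ae_le ((ae_restrict_iff' ho.measurableSet).2 (.of_forall hB)))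

theorem restrict_absolutelyContinuous {K : Set (E N)} (hK : K ⊆ Ω) :
    volume.restrict K ≪ volume.restrict Ω :=
  (Measure.restrict_mono hK le_rfl).absolutelyContinuous

theorem volume_lt_top_of_isBounded (hb : Bornology.IsBounded Ω) : volume Ω < ⊤ :=
  (measure_mono subset_closure).trans_lt hb.isCompact_closure.measure_lt_top

namespace IsBoundedC1

theorem integrable (h : IsBoundedC1 Ω w) (ho : IsOpen Ω) {μ : Measure (E N)} [IsFiniteMeasure μ]
    (hμ : μ ≪ volume.restrict Ω) : Integrable w μ := by
  obtain ⟨B, hB⟩ := h.bdd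
  exact integrable_of_continuousOn ho hμ h.continuousOn fun x hx => (hB x hx).1

theorem integrable_sq (h : IsBoundedC1 Ω w) (ho : IsOpen Ω) {μ : Measure (E N)}
    [IsFiniteMeasure μ] (hμ : μ ≪ volume.restrict Ω) : Integrable (fun x => w x ^ 2) μ := by
  obtain ⟨B, hB⟩ := h.bdd
  refine integrable_of_continuousOn ho hμ (h.continuousOn.pow 2) (B := B ^ 2) fun x hx => ?_
  rw [Real.norm_eq_abs, abs_pow]
  exact pow_le_pow_left₀ (abs_nonneg _) (hB x hx).1 2

theorem integrable_gradient_sq (h : IsBoundedC1 Ω w) (ho : IsOpen Ω) {μ : Measure (E N)}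
    [IsFiniteMeasure μ] (hμ : μ ≪ volume.restrict Ω) :
    Integrable (fun x => ‖gradient w x‖ ^ 2) μ := by
  obtain ⟨B, hB⟩ := h.bdd
  refine integrable_of_continuousOn ho hμ (h.cont.norm.pow 2) (B := B ^ 2) fun x hx => ?_
  rw [Real.norm_eq_abs, abs_pow, abs_norm]
  exact pow_le_pow_left₀ (norm_nonneg _) (hB x hx).2 2

end IsBoundedC1

/-- Poincaré's inequality on a convex set. -/
theorem setIntegral_sq_le (ho : IsOpen Ω) (hw : IsBoundedC1 Ω w) {K : Set (E N)}
    (hK : Convex ℝ K) (hKm : MeasurableSet K) (hKΩ : K ⊆ Ω) (hfin : volume Ω < ⊤) {d : ℝ}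
    (hd0 : 0 ≤ d) (hd : ∀ x ∈ K, ∀ y ∈ K, ‖y - x‖ ^ 2 ≤ d) :
    ∫ x in K, w x ^ 2 ≤ (volume.real K)⁻¹ * (∫ x in K, w x) ^ 2
      + 2 ^ N * d * ∫ x in K, ‖gradient w x‖ ^ 2 := by
  have hKfin : volume K < ⊤ := (measure_mono hKΩ).trans_lt hfin
  have : IsFiniteMeasure (volume.restrict K) := ⟨by simpa using hKfin⟩
  have hac := restrict_absolutelyContinuous hKΩ
  have hi1 := hw.integrable ho hac
  have hi2 := hw.integrable_sq ho hac
  have hi3 := hw.integrable_gradient_sq ho hac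
  set V := volume.real K with hV
  rcases (measureReal_nonneg : 0 ≤ volume.real K).eq_or_lt with h0 | h0
  · have : volume.restrict K = 0 := by
      rw [Measure.restrict_eq_zero]
      exact ((measureReal_eq_zero_iff hKfin.ne).1 h0.symm)
    simp [this]
  have hinner : ∀ x, ∫ y in K, (w y - w x) ^ 2
      = (∫ y in K, w y ^ 2) - 2 * w x * (∫ y in K, w y) + w x ^ 2 * V := by
    intro x
    have : ∀ y, (w y - w x) ^ 2 = w y ^ 2 - (2 * w x) * w y + w x ^ 2 := fun y => by ring
    have hi6 : Integrable (fun y => w y ^ 2 - (2 * w x) * w y) (volume.restrict K) :=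
      hi2.sub (hi1.const_mul _)
    simp only [this]
    rw [integral_add hi6 (integrable_const _), integral_sub hi2 (hi1.const_mul _), integral_const_mul, integral_const]
    simp [hV, mul_comm]
  have hi4 : ∀ x, Integrable (fun y => (w y - w x) ^ 2) (volume.restrict K) := by
    intro x
    have : ∀ y, (w y - w x) ^ 2 = w y ^ 2 - (2 * w x) * w y + w x ^ 2 := fun y => by ring
    simp only [this]
    exact (hi2.sub (hi1.const_mul _)).add (integrable_const _)
  have hi7 : Integrable (fun x => (∫ y in K, w y ^ 2) - 2 * w x * (∫ y in K, w y))
      (volume.restrict K) := (integrable_const _).sub ((hi1.const_mul 2).mul_const _)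
  have hi5 : Integrable (fun x => (∫ y in K, w y ^ 2) - 2 * w x * (∫ y in K, w y) + w x ^ 2 * V)
      (volume.restrict K) :=
    hi7.add (hi2.mul_const _)
  have hdouble : ∫⁻ x in K, ∫⁻ y in K, ENNReal.ofReal ((w y - w x) ^ 2)
      = ENNReal.ofReal (2 * V * (∫ y in K, w y ^ 2) - 2 * (∫ y in K, w y) ^ 2) := by
    have h1 : ∀ x, ∫⁻ y in K, ENNReal.ofReal ((w y - w x) ^ 2)
        = ENNReal.ofReal (∫ y in K, (w y - w x) ^ 2) := fun x =>
      (ofReal_integral_eq_lintegral_ofReal (hi4 x) (.of_forall fun y => sq_nonneg _)).symm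
    have h2 : ∀ x, 0 ≤ ∫ y in K, (w y - w x) ^ 2 := fun x => integral_nonneg fun y => sq_nonneg _
    simp only [h1, hinner] at h2 ⊢
    rw [← ofReal_integral_eq_lintegral_ofReal hi5 (.of_forall h2)]
    congr 1
    rw [integral_add hi7 (hi2.mul_const _),
      integral_sub (integrable_const _) ((hi1.const_mul 2).mul_const _), integral_const,
      integral_mul_const, integral_mul_const, integral_const_mul]
    simp only [MeasurableSet.univ, measureReal_restrict_apply, Set.univ_inter, smul_eq_mul, ← hV]
    ring
  have hmain := lintegral_lintegral_sub_sq_le hw hK hKm hKΩ hd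
  rw [hdouble, ← ofReal_integral_eq_lintegral_ofReal hi3 (.of_forall fun x => sq_nonneg _),
    ← ENNReal.ofReal_toReal hKfin.ne, ← ENNReal.ofReal_mul (by positivity),
    ← ENNReal.ofReal_mul (by positivity), ENNReal.ofReal_le_ofReal_iff
      (by have : 0 ≤ ∫ x in K, ‖gradient w x‖ ^ 2 := integral_nonneg fun x => sq_nonneg _
          positivity)] at hmain
  change _ ≤ _ * V * _ at hmain
  rw [← sub_le_iff_le_add', ← mul_le_mul_iff_right₀ (show 0 < 2 * V by positivity)]
  calc 2 * V * ((∫ x in K, w x ^ 2) - (V)⁻¹ * (∫ x in K, w x) ^ 2)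
      = 2 * V * (∫ y in K, w y ^ 2) - 2 * (∫ y in K, w y) ^ 2 := by
        field_simp [show V ≠ 0 from h0.ne']
    _ ≤ _ := hmain
    _ = _ := by ring

/-- The half-open cube of side `δ` with corner `δ z`. -/
def cube (δ : ℝ) (z : Fin N → ℤ) : Set (E N) := {x | ∀ i, ⌊x i / δ⌋ = z i}

theorem mem_cube_iff {δ : ℝ} (hδ : 0 < δ) {z : Fin N → ℤ} {x : E N} :
    x ∈ cube δ z ↔ ∀ i, z i * δ ≤ x i ∧ x i < (z i + 1) * δ := by
  refine forall_congr' fun i => ?_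
  rw [Int.floor_eq_iff, le_div_iff₀ hδ, div_lt_iff₀ hδ]

theorem measurableSet_cube (δ : ℝ) (z : Fin N → ℤ) : MeasurableSet (cube δ z) := by
  have : cube δ z = ⋂ i, {x : E N | ⌊x i / δ⌋ = z i} := by ext; simp [cube]
  rw [this]
  refine MeasurableSet.iInter fun i => ?_
  have : Measurable fun x : E N => ⌊x i / δ⌋ := Int.measurable_floor.comp (by fun_prop)
  exact this (measurableSet_singleton (z i))

theorem convex_cube {δ : ℝ} (hδ : 0 < δ) (z : Fin N → ℤ) : Convex ℝ (cube δ z) := by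
  intro x hx y hy a b ha hb hab
  rw [mem_cube_iff hδ] at hx hy ⊢
  intro i
  have h : ∀ s : Set ℝ, Convex ℝ s → x i ∈ s → y i ∈ s → (a • x + b • y) i ∈ s :=
    fun s hs h1 h2 => by simpa using hs h1 h2 ha hb hab
  exact h _ (convex_Ico (z i * δ) ((z i + 1) * δ)) (hx i) (hy i)

theorem norm_sub_sq_le_of_mem_cube {δ : ℝ} (hδ : 0 < δ) {z : Fin N → ℤ} {x y : E N}
    (hx : x ∈ cube δ z) (hy : y ∈ cube δ z) : ‖y - x‖ ^ 2 ≤ N * δ ^ 2 := by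
  rw [mem_cube_iff hδ] at hx hy
  rw [EuclideanSpace.norm_sq_eq]
  calc ∑ i, ‖(y - x) i‖ ^ 2 ≤ ∑ _i : Fin N, δ ^ 2 := by
        refine Finset.sum_le_sum fun i _ => ?_
        rw [Real.norm_eq_abs]
        refine pow_le_pow_left₀ (abs_nonneg _) ?_ 2
        have := hx i; have := hy i
        rw [PiLp.sub_apply, abs_le]; constructor <;> nlinarith
    _ = _ := by simp

theorem exists_finset_cubes (hb : Bornology.IsBounded Ω) {δ : ℝ} (hδ : 0 < δ) :
    ∃ Z : Finset (Fin N → ℤ), Ω ⊆ ⋃ z ∈ Z, cube δ z := by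
  obtain ⟨R, hR⟩ := hb.exists_norm_le
  refine ⟨Fintype.piFinset fun _ => Finset.Icc ⌊-R / δ⌋ ⌊R / δ⌋, fun x hx => ?_⟩
  simp only [Set.mem_iUnion]
  refine ⟨fun i => ⌊x i / δ⌋, ?_, fun i => rfl⟩
  rw [Fintype.mem_piFinset]
  intro i
  have h1 : ‖x i‖ ≤ R := (PiLp.norm_apply_le x i).trans (hR x hx)
  rw [Real.norm_eq_abs, abs_le] at h1
  rw [Finset.mem_Icc]
  constructor <;> apply Int.floor_le_floor <;> gcongr
  · exact h1.1
  · exact h1.2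

theorem setIntegral_eq_sum_cubes {h : E N → ℝ} (ho : IsOpen Ω) (hi : IntegrableOn h Ω) {δ : ℝ}
    {Z : Finset (Fin N → ℤ)} (hZ : Ω ⊆ ⋃ z ∈ Z, cube δ z) :
    ∫ x in Ω, h x = ∑ z ∈ Z, ∫ x in Ω ∩ cube δ z, h x := by
  rw [← integral_biUnion_finset]
  · congr 2
    rw [← Set.inter_iUnion₂, Set.inter_eq_left.2 hZ]
  · exact fun z _ => ho.measurableSet.inter (measurableSet_cube δ z)
  · intro z _ z' _ hne
    refine Set.disjoint_left.2 fun x hx hx' => hne (funext fun i => ?_)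
    rw [← hx.2 i, hx'.2 i]
  · exact fun z _ => hi.mono_set Set.inter_subset_left

/-- Poincaré's inequality on a fine grid: up to a small multiple of the energy, the `L²` norm is
controlled by finitely many cell averages. -/
theorem setIntegral_sq_le_sum_cubes (ho : IsOpen Ω) (hc : Convex ℝ Ω) (hb : Bornology.IsBounded Ω)
    (hw : IsBoundedC1 Ω w) {δ : ℝ} (hδ : 0 < δ) {Z : Finset (Fin N → ℤ)}
    (hZ : Ω ⊆ ⋃ z ∈ Z, cube δ z) :
    ∫ x in Ω, w x ^ 2 ≤
      ∑ z ∈ Z, (volume.real (Ω ∩ cube δ z))⁻¹ * (∫ x in Ω ∩ cube δ z, w x) ^ 2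
      + 2 ^ N * (N * δ ^ 2) * ∫ x in Ω, ‖gradient w x‖ ^ 2 := by
  have hfin := volume_lt_top_of_isBounded hb
  have : IsFiniteMeasure (volume.restrict Ω) := ⟨by simpa using hfin⟩
  rw [setIntegral_eq_sum_cubes ho (hw.integrable_sq ho .rfl) hZ,
    setIntegral_eq_sum_cubes ho (hw.integrable_gradient_sq ho .rfl) hZ, Finset.mul_sum,
    ← Finset.sum_add_distrib]
  refine Finset.sum_le_sum fun z _ => ?_
  exact setIntegral_sq_le ho hw (hc.inter (convex_cube hδ z))
    (ho.measurableSet.inter (measurableSet_cube δ z)) Set.inter_subset_left hfin (by positivity)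
    fun x hx y hy => norm_sub_sq_le_of_mem_cube hδ hx.2 hy.2

open Filter Topology in
/-- Rellich's theorem on a bounded convex domain. -/
theorem exists_subseq_integral_sq_lt (ho : IsOpen Ω) (hc : Convex ℝ Ω)
    (hb : Bornology.IsBounded Ω) {w : ℕ → E N → ℝ} (hw : ∀ n, IsBoundedC1 Ω (w n)) {B : ℝ}
    (hB : ∀ n, ∫ x in Ω, w n x ^ 2 ≤ B) (hB' : ∀ n, ∫ x in Ω, ‖gradient (w n) x‖ ^ 2 ≤ B) :
    ∃ φ : ℕ → ℕ, StrictMono φ ∧ ∀ η > 0, ∃ n₀, ∀ m ≥ n₀, ∀ n ≥ n₀,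
      ∫ x in Ω, (w (φ m) x - w (φ n) x) ^ 2 < η := by
  have hfin := volume_lt_top_of_isBounded hb
  have : IsFiniteMeasure (volume.restrict Ω) := ⟨by simpa using hfin⟩
  set R : ℝ := B + volume.real Ω with hR
  -- The integrals over all cells of all grids of mesh `1 / (k + 1)`. These are countably many
  -- bounded sequences, so that a single subsequence makes all of them converge.
  set a : ℕ → (ℕ × (Fin N → ℤ)) → ℝ := fun n q =>
    ∫ x in Ω ∩ cube (1 / ((q.1 : ℝ) + 1)) q.2, w n x with ha
  have haR : ∀ n, a n ∈ Set.pi Set.univ (fun _ => Set.Icc (-R) R) := by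
    intro n q _
    simp only [ha, Set.mem_Icc, ← abs_le, ← Real.norm_eq_abs]
    set K := Ω ∩ cube (1 / ((q.1 : ℝ) + 1)) q.2
    calc ‖∫ x in K, w n x‖ ≤ ∫ x in K, ‖w n x‖ := norm_integral_le_integral_norm _
      _ ≤ ∫ x in Ω, ‖w n x‖ :=
          setIntegral_mono_set ((hw n).integrable ho .rfl).norm
            (.of_forall fun x => norm_nonneg _) Set.inter_subset_left.eventuallyLE
      _ ≤ ∫ x in Ω, (w n x ^ 2 + 1) := by
          refine integral_mono ((hw n).integrable ho .rfl).norm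
            (((hw n).integrable_sq ho .rfl).add (integrable_const _)) fun x => ?_
          simp only [Real.norm_eq_abs]
          rw [← sq_abs]
          nlinarith [sq_nonneg (|w n x| - 1), abs_nonneg (w n x)]
      _ ≤ R := by
          rw [integral_add ((hw n).integrable_sq ho .rfl) (integrable_const _)]
          simp only [integral_const, MeasurableSet.univ, measureReal_restrict_apply,
            Set.univ_inter, smul_eq_mul, mul_one, hR]
          linarith [hB n]
  obtain ⟨b, -, φ, hφ, hlim⟩ :=
    (isCompact_univ_pi fun _ : ℕ × (Fin N → ℤ) => isCompact_Icc (a := -R) (b := R)).tendsto_subseq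
      haR
  refine ⟨φ, hφ, fun η hη => ?_⟩
  have hB0 : 0 ≤ B := (integral_nonneg fun x => sq_nonneg _).trans (hB 0)
  -- The energy of a difference is at most `4 * B`. The mesh is so fine that this contributes less
  -- than `η / 2`; the finitely many cell integrals take the other half.
  obtain ⟨k, hk⟩ : ∃ k : ℕ, 2 ^ N * (N * (1 / ((k : ℝ) + 1)) ^ 2) * (4 * B) < η / 2 := by
    have h1 : Tendsto (fun k : ℕ => 2 ^ N * (N * (1 / ((k : ℝ) + 1)) ^ 2) * (4 * B)) atTop
        (𝓝 (2 ^ N * (N * 0 ^ 2) * (4 * B))) :=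
      (((tendsto_one_div_add_atTop_nhds_zero_nat.pow 2).const_mul _).const_mul _).mul_const _
    have h2 : (2 : ℝ) ^ N * (N * 0 ^ 2) * (4 * B) < η / 2 := by
      simp only [ne_eq, OfNat.ofNat_ne_zero, not_false_eq_true, zero_pow, mul_zero, zero_mul]
      linarith
    exact (h1.eventually (gt_mem_nhds h2)).exists
  set δ : ℝ := 1 / ((k : ℝ) + 1) with hδ
  have hδ0 : 0 < δ := by positivity
  obtain ⟨Z, hZ⟩ := exists_finset_cubes hb hδ0
  have hsum : Tendsto (fun p : ℕ × ℕ => ∑ z ∈ Z, (volume.real (Ω ∩ cube δ z))⁻¹ *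
      (a (φ p.1) (k, z) - a (φ p.2) (k, z)) ^ 2) (atTop ×ˢ atTop)
      (𝓝 (∑ z ∈ Z, (volume.real (Ω ∩ cube δ z))⁻¹ * (b (k, z) - b (k, z)) ^ 2)) := by
    refine tendsto_finsetSum _ fun z _ => ?_
    have hz : Tendsto (fun n => a (φ n) (k, z)) atTop (𝓝 (b (k, z))) :=
      ((continuous_apply (k, z)).tendsto b).comp hlim
    exact (((hz.comp tendsto_fst).sub (hz.comp tendsto_snd)).pow 2).const_mul _
  simp only [sub_self, ne_eq, OfNat.ofNat_ne_zero, not_false_eq_true, zero_pow, mul_zero,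
    Finset.sum_const_zero] at hsum
  rw [prod_atTop_atTop_eq] at hsum
  obtain ⟨⟨n₁, n₂⟩, hn⟩ := (hsum.eventually (gt_mem_nhds (half_pos hη))).exists_forall_of_atTop
  refine ⟨max n₁ n₂, fun m hm n hn' => ?_⟩
  have h1 := hn (m, n) ⟨(le_max_left _ _).trans hm, (le_max_right _ _).trans hn'⟩
  have hwm := hw (φ m)
  have hwn := hw (φ n)
  have h2 := setIntegral_sq_le_sum_cubes ho hc hb (hwm.sub hwn) hδ0 hZ
  have h3 : ∫ x in Ω, ‖gradient (fun y => w (φ m) y - w (φ n) y) x‖ ^ 2 ≤ 4 * B := by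
    calc _ ≤ ∫ x in Ω, (2 * ‖gradient (w (φ m)) x‖ ^ 2 + 2 * ‖gradient (w (φ n)) x‖ ^ 2) := by
          refine setIntegral_mono_on ((hwm.sub hwn).integrable_gradient_sq ho .rfl)
            (((hwm.integrable_gradient_sq ho .rfl).const_mul 2).add
              ((hwn.integrable_gradient_sq ho .rfl).const_mul 2)) ho.measurableSet fun x hx => ?_
          have hg : gradient (fun y => w (φ m) y - w (φ n) y) x
              = gradient (w (φ m)) x - gradient (w (φ n)) x := by
            simp only [gradient]
            rw [fderiv_fun_sub (hwm.diff x hx) (hwn.diff x hx), map_sub]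
          rw [hg]
          have h4 := norm_sub_le (gradient (w (φ m)) x) (gradient (w (φ n)) x)
          have h5 := norm_nonneg (gradient (w (φ m)) x - gradient (w (φ n)) x)
          nlinarith [sq_nonneg (‖gradient (w (φ m)) x‖ - ‖gradient (w (φ n)) x‖)]
      _ = 2 * (∫ x in Ω, ‖gradient (w (φ m)) x‖ ^ 2)
          + 2 * ∫ x in Ω, ‖gradient (w (φ n)) x‖ ^ 2 := by
          rw [integral_add ((hwm.integrable_gradient_sq ho .rfl).const_mul 2)
              ((hwn.integrable_gradient_sq ho .rfl).const_mul 2), integral_const_mul,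
              integral_const_mul]
      _ ≤ 4 * B := by linarith [hB' (φ m), hB' (φ n)]
  have h6 : ∀ z, ∫ x in Ω ∩ cube δ z, (w (φ m) x - w (φ n) x)
      = a (φ m) (k, z) - a (φ n) (k, z) := fun z => by
    have : IsFiniteMeasure (volume.restrict (Ω ∩ cube δ z)) :=
      ⟨by simpa using (measure_mono Set.inter_subset_left).trans_lt hfin⟩
    exact integral_sub (hwm.integrable ho (restrict_absolutelyContinuous Set.inter_subset_left))
        (hwn.integrable ho (restrict_absolutelyContinuous Set.inter_subset_left))
  simp only [h6] at h2
  have h7 : 2 ^ N * (N * δ ^ 2) * ∫ x in Ω, ‖gradient (fun y => w (φ m) y - w (φ n) y) x‖ ^ 2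
      ≤ 2 ^ N * (N * δ ^ 2) * (4 * B) := by gcongr
  simp only at h1
  linarith

end W2Lin

/-! ### The weighted measure, integration by parts, and a qualitative Poincaré inequality -/

namespace W2Lin

variable {N : ℕ} {Ω : Set (E N)} {w f : E N → ℝ}

theorem densityMeasure_absolutelyContinuous (Ω : Set (E N)) (f : E N → ℝ) :
    densityMeasure Ω f ≪ volume.restrict Ω :=
  withDensity_absolutelyContinuous _ _

theorem ae_densityMeasure_mem (ho : IsOpen Ω) (f : E N → ℝ) :
    ∀ᵐ x ∂(densityMeasure Ω f), x ∈ Ω :=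
  (densityMeasure_absolutelyContinuous Ω f).ae_le (ae_restrict_mem ho.measurableSet)

theorem integral_densityMeasure {F : Type*} [NormedAddCommGroup F] [NormedSpace ℝ F]
    (ho : IsOpen Ω) (hf : ContinuousOn f Ω) (hf0 : ∀ x ∈ Ω, 0 ≤ f x) (h : E N → F) :
    ∫ x, h x ∂(densityMeasure Ω f) = ∫ x in Ω, f x • h x := by
  rw [densityMeasure, integral_withDensity_eq_integral_toReal_smul₀
    (hf.aemeasurable ho.measurableSet).ennreal_ofReal (by simp)]
  refine setIntegral_congr_fun ho.measurableSet fun x hx => ?_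
  simp only [ENNReal.toReal_ofReal (hf0 x hx)]

/-- Passes from L²(μ) back to Lebesgue measure. The lower bound `m` is used for existence and
compactness only, where the size of constants is irrelevant. -/
theorem restrict_le_smul_densityMeasure (ho : IsOpen Ω) {m : ℝ} (hm : 0 < m) (hfm : ∀ x ∈ Ω, m ≤ f x) :
    volume.restrict Ω ≤ ENNReal.ofReal m⁻¹ • densityMeasure Ω f := by
  rw [densityMeasure, ← withDensity_smul' _ _ ENNReal.ofReal_ne_top]
  nth_rewrite 1 [← withDensity_one (μ := volume.restrict Ω)]
  refine withDensity_mono ((ae_restrict_iff' ho.measurableSet).2 (.of_forall fun x hx => ?_))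
  rw [Pi.one_apply, Pi.smul_apply, smul_eq_mul, ← ENNReal.ofReal_mul (by positivity),
    ← ENNReal.ofReal_one]
  refine ENNReal.ofReal_le_ofReal ?_
  rw [inv_mul_eq_div, one_le_div hm]; exact hfm x hx

theorem integral_densityMeasure_le (ho : IsOpen Ω) (hf : ContinuousOn f Ω)
    (hf0 : ∀ x ∈ Ω, 0 ≤ f x) {B : ℝ} (hfB : ∀ x ∈ Ω, f x ≤ B) {h : E N → ℝ} (h0 : ∀ x, 0 ≤ h x)
    (hi : IntegrableOn h Ω) :
    ∫ x, h x ∂(densityMeasure Ω f) ≤ B * ∫ x in Ω, h x := by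
  rw [integral_densityMeasure ho hf hf0, ← integral_const_mul]
  refine integral_mono_of_nonneg ?_ (hi.const_mul B) ?_ <;>
    refine (ae_restrict_iff' ho.measurableSet).2 (.of_forall fun x hx => ?_)
  · exact mul_nonneg (hf0 x hx) (h0 x)
  · exact mul_le_mul_of_nonneg_right (hfB x hx) (h0 x)

theorem mul_integral_le_integral_densityMeasure (ho : IsOpen Ω) {m : ℝ} (hm : 0 < m) (hfm : ∀ x ∈ Ω, m ≤ f x) {h : E N → ℝ} (h0 : ∀ x, 0 ≤ h x)
    (hi : Integrable h (densityMeasure Ω f)) :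
    m * ∫ x in Ω, h x ≤ ∫ x, h x ∂(densityMeasure Ω f) := by
  have := integral_mono_measure (restrict_le_smul_densityMeasure ho hm hfm)
    (.of_forall h0) (hi.smul_measure ENNReal.ofReal_ne_top)
  rw [integral_smul_measure, ENNReal.toReal_ofReal (by positivity), smul_eq_mul,
    le_inv_mul_iff₀ hm] at this
  exact this

namespace IsBoundedC1

theorem memLp (h : IsBoundedC1 Ω w) (ho : IsOpen Ω) {μ : Measure (E N)} [IsFiniteMeasure μ]
    (hμ : μ ≪ volume.restrict Ω) : MemLp w 2 μ := by
  rw [memLp_two_iff_integrable_sq (h.integrable ho hμ).aestronglyMeasurable]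
  exact h.integrable_sq ho hμ

theorem memLp_gradient (h : IsBoundedC1 Ω w) (ho : IsOpen Ω) {μ : Measure (E N)}
    [IsFiniteMeasure μ] (hμ : μ ≪ volume.restrict Ω) : MemLp (gradient w) 2 μ := by
  rw [memLp_two_iff_integrable_sq_norm (measurable_gradient w).aestronglyMeasurable]
  exact h.integrable_gradient_sq ho hμ

/-- Integration by parts against a test function. -/
theorem setIntegral_mul_gradient (h : IsBoundedC1 Ω w) (ho : IsOpen Ω)
    {η : E N → ℝ} (hη : ContDiff ℝ ∞ η) (hηc : HasCompactSupport η) (hηs : tsupport η ⊆ Ω)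
    (hfin : volume Ω < ⊤) (e : E N) :
    ∫ x in Ω, w x * inner ℝ (gradient η x) e = - ∫ x in Ω, inner ℝ (gradient w x) e * η x := by
  have : IsFiniteMeasure (volume.restrict Ω) := ⟨by simpa using hfin⟩
  have hfd : Continuous (fderiv ℝ η) := hη.continuous_fderiv (by simp)
  obtain ⟨B, hB⟩ := h.bdd
  obtain ⟨B₁, hB₁⟩ := hηc.exists_bound_of_continuous hη.continuous
  obtain ⟨B₂, hB₂⟩ := (hηc.fderiv (𝕜 := ℝ)).exists_bound_of_continuous hfd
  have hs : Function.support η ⊆ Ω := subset_closure.trans hηs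
  have hs' : Function.support (fun x => fderiv ℝ η x e) ⊆ Ω := by
    refine fun x hx => hηs (support_fderiv_subset ℝ (f := η) fun h0 => hx ?_)
    simp [h0]
  -- Nothing is known about `w` off `Ω`; every product below carries a factor `η` or `∇η` supported
  -- in `Ω`, and so may be integrated over the whole space.
  have key : ∀ F : E N → ℝ, Function.support F ⊆ Ω → ContinuousOn F Ω →
      (∃ C, ∀ x ∈ Ω, ‖F x‖ ≤ C) → Integrable F := by
    rintro F hF hFc ⟨C, hC⟩
    rw [← integrableOn_iff_integrable_of_support_subset hF]
    exact integrable_of_continuousOn ho .rfl hFc hC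
  have hB0 : ∀ x ∈ Ω, 0 ≤ B := fun x hx => (abs_nonneg _).trans (hB x hx).1
  have i1 : Integrable (fun x => fderiv ℝ w x e * η x) := by
    refine key _ (fun x hx => hs (right_ne_zero_of_mul hx)) ?_
      ⟨B * ‖e‖ * B₁, fun x hx => ?_⟩
    · simp only [← inner_gradient_left]
      exact (h.cont.inner continuousOn_const).mul hη.continuous.continuousOn
    · rw [norm_mul]
      have := hB0 x hx
      refine mul_le_mul ?_ (hB₁ x) (norm_nonneg _) (by positivity)
      refine ((fderiv ℝ w x).le_opNorm e).trans ?_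
      rw [← norm_gradient]
      gcongr; exact (hB x hx).2
  have i2 : Integrable (fun x => w x * fderiv ℝ η x e) := by
    refine key _ (fun x hx => hs' (right_ne_zero_of_mul hx)) ?_
      ⟨B * (B₂ * ‖e‖), fun x hx => ?_⟩
    · exact h.continuousOn.mul (hfd.clm_apply continuous_const).continuousOn
    · rw [norm_mul]
      exact mul_le_mul (hB x hx).1 ((fderiv ℝ η x).le_of_opNorm_le (hB₂ x) e) (norm_nonneg _)
        (hB0 x hx)
  have i3 : Integrable (fun x => w x * η x) := by
    refine key _ (fun x hx => hs (right_ne_zero_of_mul hx)) ?_ ⟨B * B₁, fun x hx => ?_⟩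
    · exact h.continuousOn.mul hη.continuous.continuousOn
    · rw [norm_mul]
      exact mul_le_mul (hB x hx).1 (hB₁ x) (norm_nonneg _) (hB0 x hx)
  have hmain := integral_mul_fderiv_eq_neg_fderiv_mul_of_integrable i1 i2 i3
    (fun x hx => h.diff x (hηs hx)) (fun x _ => (hη.differentiable (by simp)) x)
  simp only [inner_gradient_left]
  rw [setIntegral_eq_integral_of_forall_compl_eq_zero, hmain,
    setIntegral_eq_integral_of_forall_compl_eq_zero]
  · intro x hx
    rw [Function.notMem_support.1 fun h' => hx (hs h'), mul_zero]
  · intro x hx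
    rw [show fderiv ℝ η x e = 0 from Function.notMem_support.1 fun h' => hx (hs' h'), mul_zero]

end IsBoundedC1

/-- The continuously differentiable functions on `closure Ω` with mean zero. -/
def meanZeroC1 (Ω : Set (E N)) (μ : Measure (E N)) (hint : ∀ w : E N → ℝ,
    ContDiffOn ℝ 1 w (closure Ω) → Integrable w μ) : Submodule ℝ (E N → ℝ) where
  carrier := {w | ContDiffOn ℝ 1 w (closure Ω) ∧ ∫ x, w x ∂μ = 0}
  add_mem' := by
    rintro a b ⟨ha, ha'⟩ ⟨hb, hb'⟩
    refine ⟨ha.add hb, ?_⟩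
    simp only [Pi.add_apply]
    rw [integral_add (hint a ha) (hint b hb), ha', hb', add_zero]
  zero_mem' := ⟨contDiffOn_const, by simp⟩
  smul_mem' := by
    rintro c a ⟨ha, ha'⟩
    refine ⟨ha.const_smul c, ?_⟩
    simp only [Pi.smul_apply, smul_eq_mul]
    rw [integral_const_mul, ha', mul_zero]

theorem norm_toLp_sq {F : Type*} [NormedAddCommGroup F] [InnerProductSpace ℝ F]
    {μ : Measure (E N)} {h : E N → F} (hh : MemLp h 2 μ) :
    ‖hh.toLp h‖ ^ 2 = ∫ x, ‖h x‖ ^ 2 ∂μ := by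
  rw [← real_inner_self_eq_norm_sq, L2.inner_def]
  refine integral_congr_ae ?_
  filter_upwards [hh.coeFn_toLp] with x hx
  rw [hx, real_inner_self_eq_norm_sq]

theorem exists_bounds_of_continuousOn_closure (hn : Ω.Nonempty) (hb : Bornology.IsBounded Ω)
    (hf : ContinuousOn f (closure Ω)) (hpos : ∀ x ∈ closure Ω, 0 < f x) :
    ∃ m B : ℝ, 0 < m ∧ 0 < B ∧ ∀ x ∈ Ω, m ≤ f x ∧ f x ≤ B := by
  obtain ⟨a, ha, hmin⟩ := hb.isCompact_closure.exists_isMinOn hn.closure hf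
  obtain ⟨b, hb, hmax⟩ := hb.isCompact_closure.exists_isMaxOn hn.closure hf
  exact ⟨f a, f b, hpos a ha, hpos b hb, fun x hx =>
    ⟨hmin (subset_closure hx), hmax (subset_closure hx)⟩⟩

/-- A Poincaré inequality with a constant depending on the data. -/
theorem exists_integral_sq_le (ho : IsOpen Ω) (hn : Ω.Nonempty) (hc : Convex ℝ Ω)
    (hb : Bornology.IsBounded Ω) (hf : ContinuousOn f (closure Ω))
    (hpos : ∀ x ∈ closure Ω, 0 < f x) [IsProbabilityMeasure (densityMeasure Ω f)] :
    ∃ C : ℝ, ∀ w : E N → ℝ, IsBoundedC1 Ω w → ∫ x, w x ∂(densityMeasure Ω f) = 0 →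
      ∫ x, w x ^ 2 ∂(densityMeasure Ω f) ≤ C * ∫ x, ‖gradient w x‖ ^ 2 ∂(densityMeasure Ω f) := by
  obtain ⟨m, B, hm, hB, hmB⟩ := exists_bounds_of_continuousOn_closure hn hb hf hpos
  obtain ⟨R, hR⟩ := hb.exists_norm_le
  have hfin := volume_lt_top_of_isBounded hb
  have : IsFiniteMeasure (volume.restrict Ω) := ⟨by simpa using hfin⟩
  have hac := densityMeasure_absolutelyContinuous Ω f
  have hV : 0 < volume.real Ω := by
    rw [measureReal_def]
    exact ENNReal.toReal_pos (ho.measure_pos volume hn).ne' hfin.ne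
  refine ⟨B * (2 ^ N * (2 * R) ^ 2) * m⁻¹, fun w hw hw0 => ?_⟩
  set c := (volume.real Ω)⁻¹ * ∫ x in Ω, w x with hcdef
  have hconst : IsBoundedC1 Ω (fun _ : E N => c) :=
    isBoundedC1_of_contDiffOn ho hn hc hb contDiffOn_const
  have hwc := hw.sub hconst
  have h1 : ∫ x in Ω, (w x - c) = 0 := by
    rw [integral_sub (hw.integrable ho .rfl) (integrable_const _), integral_const]
    simp only [MeasurableSet.univ, measureReal_restrict_apply, Set.univ_inter, smul_eq_mul, hcdef]
    field_simp; ring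
  have hg : ∀ x, gradient (fun y => w y - c) x = gradient w x := by
    intro x; simp only [gradient, fderiv_sub_const]
  have h2 := setIntegral_sq_le ho hwc hc ho.measurableSet subset_rfl hfin
    (d := (2 * R) ^ 2) (by positivity) (fun x hx y hy => by
      refine pow_le_pow_left₀ (norm_nonneg _) ((norm_sub_le _ _).trans ?_) 2
      linarith [hR x hx, hR y hy])
  simp only [h1, hg] at h2
  -- Here `c` is the Lebesgue mean, while `w` has `μ`-mean zero, and subtracting a constant from
  -- such a function can only increase its L²(μ) norm.
  have h3 : ∫ x, w x ^ 2 ∂(densityMeasure Ω f) ≤ ∫ x, (w x - c) ^ 2 ∂(densityMeasure Ω f) := by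
    have i : Integrable (fun x => w x ^ 2 - 2 * c * w x) (densityMeasure Ω f) :=
      (hw.integrable_sq ho hac).sub ((hw.integrable ho hac).const_mul _)
    have : ∀ x, (w x - c) ^ 2 = w x ^ 2 - 2 * c * w x + c ^ 2 := fun x => by ring
    simp only [this]
    rw [integral_add i (integrable_const _), integral_sub (hw.integrable_sq ho hac)
      ((hw.integrable ho hac).const_mul _), integral_const_mul, hw0]
    simp [sq_nonneg]
  have h4 := integral_densityMeasure_le ho (hf.mono subset_closure)
    (fun x hx => hm.le.trans (hmB x hx).1) (fun x hx => (hmB x hx).2)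
    (fun x => sq_nonneg (w x - c)) (hwc.integrable_sq ho .rfl)
  have h5 := mul_integral_le_integral_densityMeasure ho hm
    (fun x hx => (hmB x hx).1) (fun x => sq_nonneg ‖gradient w x‖)
    (hw.integrable_gradient_sq ho hac)
  calc _ ≤ B * ∫ x in Ω, (w x - c) ^ 2 := h3.trans h4
    _ ≤ B * (2 ^ N * (2 * R) ^ 2 * ∫ x in Ω, ‖gradient w x‖ ^ 2) := by
        gcongr; linarith
    _ ≤ B * (2 ^ N * (2 * R) ^ 2 * (m⁻¹ * ∫ x, ‖gradient w x‖ ^ 2 ∂(densityMeasure Ω f))) := by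
        gcongr
        rw [le_inv_mul_iff₀ hm]; exact h5
    _ = _ := by ring

end W2Lin

/-! ### The first Neumann eigenvalue as the Poincaré constant -/

namespace W2Lin

variable {N : ℕ} {Ω : Set (E N)} {f : E N → ℝ}

open Filter Topology in
/-- Limits of continuously differentiable functions in the graph norm have weak gradients. -/
theorem hasWeakGradient_of_tendsto (ho : IsOpen Ω) (hfin : volume Ω < ⊤)
    (hf : ContinuousOn f Ω) {m : ℝ} (hm : 0 < m) (hfm : ∀ x ∈ Ω, m ≤ f x)
    [IsFiniteMeasure (densityMeasure Ω f)] {w : ℕ → E N → ℝ} (hw : ∀ n, IsBoundedC1 Ω (w n))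
    (h1 : ∀ n, MemLp (w n) 2 (densityMeasure Ω f))
    (h2 : ∀ n, MemLp (gradient (w n)) 2 (densityMeasure Ω f))
    {v : Lp ℝ 2 (densityMeasure Ω f)} {F : Lp (E N) 2 (densityMeasure Ω f)}
    (hv : Tendsto (fun n => (h1 n).toLp (w n)) atTop (𝓝 v))
    (hF : Tendsto (fun n => (h2 n).toLp (gradient (w n))) atTop (𝓝 F))
    (hv2 : MemLp v 2 (volume.restrict Ω)) (hF2 : MemLp F 2 (volume.restrict Ω)) :
    HasWeakGradient Ω v F := by
  intro η hη hηc hηs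
  have : IsFiniteMeasure (volume.restrict Ω) := ⟨by simpa using hfin⟩
  have hf0 : ∀ x ∈ Ω, 0 ≤ f x := fun x hx => hm.le.trans (hfm x hx)
  have hac := densityMeasure_absolutelyContinuous Ω f
  have hgc : Continuous (gradient η) :=
    (InnerProductSpace.toDual ℝ (E N)).symm.continuous.comp (hη.continuous_fderiv (by simp))
  obtain ⟨B₁, hB₁⟩ := hηc.exists_bound_of_continuous hη.continuous
  obtain ⟨B₂, hB₂⟩ := (hηc.fderiv (𝕜 := ℝ)).exists_bound_of_continuous
    (hη.continuous_fderiv (by simp))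
  have hB₂' : ∀ x, ‖gradient η x‖ ≤ B₂ := fun x => (norm_gradient η x).trans_le (hB₂ x)
  have hfinv : ContinuousOn (fun x => (f x)⁻¹) Ω :=
    hf.inv₀ fun x hx => (hm.trans_le (hfm x hx)).ne'
  have hinvb : ∀ x ∈ Ω, |(f x)⁻¹| ≤ m⁻¹ := by
    intro x hx
    rw [abs_of_nonneg (inv_nonneg.2 (hf0 x hx))]
    exact inv_anti₀ hm (hfm x hx)
  have hv1 : Integrable v (volume.restrict Ω) := hv2.integrable (by norm_num)
  have hF1 : Integrable F (volume.restrict Ω) := hF2.integrable (by norm_num)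
  have hi1 : Integrable (fun x => v x • gradient η x) (volume.restrict Ω) :=
    hv1.smul_bdd B₂ hgc.aestronglyMeasurable (.of_forall hB₂')
  have hi2 : Integrable (fun x => η x • F x) (volume.restrict Ω) :=
    hF1.bdd_smul B₁ hη.continuous.aestronglyMeasurable (.of_forall hB₁)
  refine ext_inner_right ℝ fun e => ?_
  rw [inner_neg_left, ← real_inner_comm, ← integral_inner hi1, ← real_inner_comm,
    ← integral_inner hi2]
  -- Division by `f` turns the Lebesgue pairings in the definition of the weak gradient into L²(μ)
  -- inner products with the fixed elements `hA.toLp`, `hD.toLp`, which pass to the limit.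
  have hA : MemLp (fun x => (f x)⁻¹ * inner ℝ (gradient η x) e) 2 (densityMeasure Ω f) := by
    refine MemLp.of_bound (ContinuousOn.aestronglyMeasurable (hfinv.mul
      (hgc.inner continuous_const).continuousOn) ho.measurableSet |>.mono_ac hac) (m⁻¹ * (B₂ * ‖e‖))
      (hac.ae_le ((ae_restrict_iff' ho.measurableSet).2 (.of_forall fun x hx => ?_)))
    rw [norm_mul]
    refine mul_le_mul (hinvb x hx) ?_ (norm_nonneg _) (by positivity)
    refine (norm_inner_le_norm _ _).trans ?_
    gcongr; exact hB₂' x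
  have hD : MemLp (fun x => ((f x)⁻¹ * η x) • e) 2 (densityMeasure Ω f) := by
    refine MemLp.of_bound (ContinuousOn.aestronglyMeasurable ((hfinv.mul
      hη.continuous.continuousOn).smul continuousOn_const) ho.measurableSet |>.mono_ac hac)
      (m⁻¹ * B₁ * ‖e‖)
      (hac.ae_le ((ae_restrict_iff' ho.measurableSet).2 (.of_forall fun x hx => ?_)))
    rw [norm_smul, norm_mul]
    gcongr
    · exact hinvb x hx
    · exact hB₁ x
  have e1 : ∀ u : Lp ℝ 2 (densityMeasure Ω f),
      inner ℝ (hA.toLp _) u = ∫ x in Ω, inner ℝ e (u x • gradient η x) := by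
    intro u
    rw [L2.inner_def]
    have : ∫ x, inner ℝ (hA.toLp _ x) (u x) ∂(densityMeasure Ω f)
        = ∫ x, u x * ((f x)⁻¹ * inner ℝ (gradient η x) e) ∂(densityMeasure Ω f) := by
      refine integral_congr_ae ?_
      filter_upwards [hA.coeFn_toLp] with x hx
      rw [hx]; rfl
    rw [this, integral_densityMeasure ho hf hf0]
    refine setIntegral_congr_fun ho.measurableSet fun x hx => ?_
    have : f x ≠ 0 := (hm.trans_le (hfm x hx)).ne'
    simp only [inner_smul_right, smul_eq_mul, real_inner_comm]
    field_simp
  have e2 : ∀ u : Lp (E N) 2 (densityMeasure Ω f),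
      inner ℝ (hD.toLp _) u = ∫ x in Ω, inner ℝ e (η x • u x) := by
    intro u
    rw [L2.inner_def]
    have : ∫ x, inner ℝ (hD.toLp _ x) (u x) ∂(densityMeasure Ω f)
        = ∫ x, (f x)⁻¹ * η x * inner ℝ e (u x) ∂(densityMeasure Ω f) := by
      refine integral_congr_ae ?_
      filter_upwards [hD.coeFn_toLp] with x hx
      rw [hx, real_inner_smul_left]
    rw [this, integral_densityMeasure ho hf hf0]
    refine setIntegral_congr_fun ho.measurableSet fun x hx => ?_
    have : f x ≠ 0 := (hm.trans_le (hfm x hx)).ne'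
    simp only [inner_smul_right, smul_eq_mul]
    field_simp
  rw [← e1, ← e2]
  have l1 : Tendsto (fun n => inner ℝ (hA.toLp _) ((h1 n).toLp (w n))) atTop
      (𝓝 (inner ℝ (hA.toLp _) v)) := tendsto_const_nhds.inner hv
  have l2 : Tendsto (fun n => -inner ℝ (hD.toLp _) ((h2 n).toLp (gradient (w n)))) atTop
      (𝓝 (-inner ℝ (hD.toLp _) F)) := (tendsto_const_nhds.inner hF).neg
  refine tendsto_nhds_unique l1 (l2.congr fun n => ?_)
  rw [e1, e2]
  have ae1 : (h1 n).toLp (w n) =ᵐ[volume.restrict Ω] w n :=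
    (h1 n).coeFn_toLp.filter_mono
      ((restrict_le_smul_densityMeasure ho hm hfm).absolutelyContinuous.trans
        (Measure.smul_absolutelyContinuous)).ae_le
  have ae2 : (h2 n).toLp (gradient (w n)) =ᵐ[volume.restrict Ω] gradient (w n) :=
    (h2 n).coeFn_toLp.filter_mono
      ((restrict_le_smul_densityMeasure ho hm hfm).absolutelyContinuous.trans
        (Measure.smul_absolutelyContinuous)).ae_le
  have r1 : ∫ x in Ω, inner ℝ e ((h1 n).toLp (w n) x • gradient η x)
      = ∫ x in Ω, w n x * inner ℝ (gradient η x) e := by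
    refine integral_congr_ae ?_
    filter_upwards [ae1] with x hx
    rw [hx, inner_smul_right, real_inner_comm]
  have r2 : ∫ x in Ω, inner ℝ e (η x • (h2 n).toLp (gradient (w n)) x)
      = ∫ x in Ω, inner ℝ (gradient (w n) x) e * η x := by
    refine integral_congr_ae ?_
    filter_upwards [ae2] with x hx
    rw [hx, inner_smul_right, real_inner_comm, mul_comm]
  rw [r1, r2, (hw n).setIntegral_mul_gradient ho hη hηc hηs hfin]

open Filter Topology in
/-- If the Rayleigh quotient of some function of mean zero is less than `lam`, then there is a
positive Neumann eigenvalue less than `lam`. -/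
theorem exists_isNeumannEigenvalue (ho : IsOpen Ω) (hn : Ω.Nonempty) (hc : Convex ℝ Ω)
    (hb : Bornology.IsBounded Ω) (hf : ContinuousOn f (closure Ω))
    (hpos : ∀ x ∈ closure Ω, 0 < f x) [IsProbabilityMeasure (densityMeasure Ω f)]
    {lam : ℝ} {w₀ : E N → ℝ} (hw₀ : ContDiffOn ℝ 1 w₀ (closure Ω))
    (hmean : ∫ x, w₀ x ∂(densityMeasure Ω f) = 0)
    (hlt : ∫ x, ‖gradient w₀ x‖ ^ 2 ∂(densityMeasure Ω f)
      < lam * ∫ x, w₀ x ^ 2 ∂(densityMeasure Ω f)) :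
    ∃ t, 0 < t ∧ t < lam ∧ IsNeumannEigenvalue Ω f t := by
  set μ := densityMeasure Ω f with hμ
  obtain ⟨m, B, hm, hB, hmB⟩ := exists_bounds_of_continuousOn_closure hn hb hf hpos
  have hfm : ∀ x ∈ Ω, m ≤ f x := fun x hx => (hmB x hx).1
  have hfΩ := hf.mono subset_closure
  have hf0 : ∀ x ∈ Ω, 0 ≤ f x := fun x hx => hm.le.trans (hfm x hx)
  have hfin := volume_lt_top_of_isBounded hb
  have : IsFiniteMeasure (volume.restrict Ω) := ⟨by simpa using hfin⟩
  have hac : μ ≪ volume.restrict Ω := densityMeasure_absolutelyContinuous Ω f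
  have hle : volume.restrict Ω ≤ ENNReal.ofReal m⁻¹ • μ := restrict_le_smul_densityMeasure ho hm hfm
  have hC1 : ∀ w : E N → ℝ, ContDiffOn ℝ 1 w (closure Ω) → IsBoundedC1 Ω w := fun w hw =>
    isBoundedC1_of_contDiffOn ho hn hc hb hw
  set V := meanZeroC1 Ω μ fun w hw => (hC1 w hw).integrable ho hac with hV
  have hVC : ∀ w : V, IsBoundedC1 Ω w.1 := fun w => hC1 _ w.2.1
  have hJm : ∀ w : V, MemLp w.1 2 μ := fun w => (hVC w).memLp ho hac
  have hGm : ∀ w : V, MemLp (gradient w.1) 2 μ := fun w => (hVC w).memLp_gradient ho hac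
  have hΩ := ae_densityMeasure_mem ho f
  -- The inclusion and the gradient into L²(μ). The gradient is linear only at points of
  -- differentiability, that is, almost everywhere.
  let J : V →ₗ[ℝ] Lp ℝ 2 μ :=
    { toFun := fun w => (hJm w).toLp w.1
      map_add' := fun a b => MemLp.toLp_add (hJm a) (hJm b)
      map_smul' := fun c a => MemLp.toLp_const_smul c (hJm a) }
  let G : V →ₗ[ℝ] Lp (E N) 2 μ :=
    { toFun := fun w => (hGm w).toLp (gradient w.1)
      map_add' := fun a b => by
        rw [← MemLp.toLp_add]
        refine MemLp.toLp_congr _ _ ?_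
        filter_upwards [hΩ] with x hx
        simp only [gradient, Pi.add_apply, Submodule.coe_add]
        rw [fderiv_add ((hVC a).diff x hx) ((hVC b).diff x hx), map_add]
      map_smul' := fun c a => by
        rw [RingHom.id_apply, ← MemLp.toLp_const_smul]
        refine MemLp.toLp_congr _ _ ?_
        filter_upwards [hΩ] with x hx
        simp only [gradient, Pi.smul_apply, Submodule.coe_smul]
        rw [fderiv_const_smul ((hVC a).diff x hx), map_smul] }
  have hJn : ∀ w : V, ‖J w‖ ^ 2 = ∫ x, w.1 x ^ 2 ∂μ := fun w => by
    refine (norm_toLp_sq (hJm w)).trans ?_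
    simp only [Real.norm_eq_abs, sq_abs]
  have hGn : ∀ w : V, ‖G w‖ ^ 2 = ∫ x, ‖gradient w.1 x‖ ^ 2 ∂μ := fun w => norm_toLp_sq (hGm w)
  have hcomp : ∀ (w : ℕ → V) (B : ℝ), (∀ n, ‖J (w n)‖ ≤ B ∧ ‖G (w n)‖ ≤ B) →
      ∃ φ : ℕ → ℕ, StrictMono φ ∧ CauchySeq (fun n => J (w (φ n))) := by
    intro w B' hB'
    obtain ⟨φ, hφ, hlim⟩ := exists_subseq_integral_sq_lt ho hc hb (fun n => hVC (w n))
      (B := m⁻¹ * B' ^ 2) (fun n => by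
        rw [le_inv_mul_iff₀ hm]
        refine (mul_integral_le_integral_densityMeasure ho hm hfm (fun x => sq_nonneg _)
          ((hVC (w n)).integrable_sq ho hac)).trans ?_
        rw [← hμ, ← hJn]
        exact pow_le_pow_left₀ (norm_nonneg _) (hB' n).1 2) (fun n => by
        rw [le_inv_mul_iff₀ hm]
        refine (mul_integral_le_integral_densityMeasure ho hm hfm (fun x => sq_nonneg _)
          ((hVC (w n)).integrable_gradient_sq ho hac)).trans ?_
        rw [← hμ, ← hGn]
        exact pow_le_pow_left₀ (norm_nonneg _) (hB' n).2 2)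
    refine ⟨φ, hφ, Metric.cauchySeq_iff.2 fun η hη => ?_⟩
    obtain ⟨n₀, hn₀⟩ := hlim (η ^ 2 / B) (by positivity)
    refine ⟨n₀, fun p hp q hq => ?_⟩
    rw [dist_eq_norm, ← map_sub]
    refine lt_of_pow_lt_pow_left₀ 2 hη.le ?_
    rw [hJn]
    have h3 := hn₀ p hp q hq
    have h4 := integral_densityMeasure_le ho hfΩ hf0 (fun x hx => (hmB x hx).2)
      (fun x => sq_nonneg ((w (φ p)).1 x - (w (φ q)).1 x))
      (((hVC (w (φ p))).sub (hVC (w (φ q)))).integrable_sq ho .rfl)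
    rw [lt_div_iff₀ hB] at h3
    refine lt_of_le_of_lt h4 ?_
    linarith
  have h₀ : ‖G ⟨w₀, hw₀, hmean⟩‖ ^ 2 < lam * ‖J ⟨w₀, hw₀, hmean⟩‖ ^ 2 := by
    rw [hGn, hJn]; exact hlt
  obtain ⟨t, v, F, ht0, htl, hv1, hFt, ⟨w, hwv, hwF⟩, hEL⟩ :=
    exists_rayleigh_minimizer J G hcomp h₀
  have hvm : MemLp v 2 (volume.restrict Ω) :=
    (Lp.memLp v).of_measure_le_smul ENNReal.ofReal_ne_top hle
  have hFm : MemLp F 2 (volume.restrict Ω) :=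
    (Lp.memLp F).of_measure_le_smul ENNReal.ofReal_ne_top hle
  -- If `t = 0`, the limit gradient is zero, and the qualitative Poincaré inequality, passed to the
  -- limit, contradicts `‖v‖ = 1`.
  have htpos : 0 < t := by
    refine ht0.lt_of_ne fun h => ?_
    obtain ⟨C, hC⟩ := exists_integral_sq_le ho hn hc hb hf hpos
    have h5 : ‖v‖ ^ 2 ≤ C * ‖F‖ ^ 2 := by
      refine le_of_tendsto_of_tendsto' (hwv.norm.pow 2) ((hwF.norm.pow 2).const_mul C) fun n => ?_
      rw [hJn, hGn]
      exact hC _ (hVC (w n)) (w n).2.2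
    rw [hFt, hv1, ← h] at h5
    norm_num at h5
  -- The Euler-Lagrange equation is known for mean-zero test functions only. As `v` itself has mean
  -- zero, adding a constant to the test function changes neither side.
  have hvmean : ∫ x, v x ∂μ = 0 := by
    have hone : MemLp (fun _ : E N => (1 : ℝ)) 2 μ := memLp_const 1
    have hin : ∀ u : Lp ℝ 2 μ, inner ℝ (hone.toLp _) u = ∫ x, u x ∂μ := by
      intro u
      rw [L2.inner_def]
      refine integral_congr_ae ?_
      filter_upwards [hone.coeFn_toLp] with x hx
      rw [hx]; simp
    rw [← hin]
    refine tendsto_nhds_unique (tendsto_const_nhds.inner hwv) ?_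
    refine tendsto_const_nhds.congr fun n => ?_
    rw [hin]
    exact ((integral_congr_ae (hJm (w n)).coeFn_toLp).trans (w n).2.2).symm
  refine ⟨t, htpos, htl, v, F, hvm, hFm, ?_, ?_, ?_⟩
  · exact hasWeakGradient_of_tendsto ho hfin hfΩ hm hfm (fun n => hVC (w n)) (fun n => hJm (w n))
      (fun n => hGm (w n)) hwv hwF hvm hFm
  · intro h
    have h6 : v =ᵐ[μ] 0 := hac.ae_le h
    rw [(Lp.eq_zero_iff_ae_eq_zero).2 h6] at hv1
    simp at hv1
  · intro z hz
    set c := ∫ x, z x ∂μ with hcdef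
    have hzC := hC1 z hz
    have hz0 : (fun x => z x - c) ∈ V := by
      refine ⟨hz.sub contDiffOn_const, ?_⟩
      rw [integral_sub (hzC.integrable ho hac) (integrable_const _)]
      simp [hcdef]
    have h7 := hEL ⟨_, hz0⟩
    rw [L2.inner_def, L2.inner_def] at h7
    have e1 : ∫ x, inner ℝ (F x) (G ⟨_, hz0⟩ x) ∂μ = ∫ x, inner ℝ (F x) (gradient z x) ∂μ := by
      refine integral_congr_ae ?_
      filter_upwards [(hGm ⟨_, hz0⟩).coeFn_toLp] with x hx
      change inner ℝ (F x) ((hGm ⟨_, hz0⟩).toLp _ x) = _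
      rw [hx]
      simp only [gradient, fderiv_sub_const]
    have e2 : ∫ x, inner ℝ (v x) (J ⟨_, hz0⟩ x) ∂μ = ∫ x, v x * z x ∂μ := by
      have hi : Integrable (fun x => v x * z x) μ := by
        have := (Lp.memLp v).integrable_mul (hzC.memLp ho hac)
        exact this
      have hi' : Integrable (fun x => v x * c) μ :=
        ((Lp.memLp v).integrable (by norm_num)).mul_const c
      calc ∫ x, inner ℝ (v x) (J ⟨_, hz0⟩ x) ∂μ = ∫ x, (v x * z x - v x * c) ∂μ := by
            refine integral_congr_ae ?_
            filter_upwards [(hJm ⟨_, hz0⟩).coeFn_toLp] with x hx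
            change inner ℝ (v x) ((hJm ⟨_, hz0⟩).toLp _ x) = _
            rw [hx]
            change (z x - c) * v x = _
            ring
        _ = _ := by
            rw [integral_sub hi hi', integral_mul_const, hvmean, zero_mul, sub_zero]
    rw [e1, e2] at h7
    exact h7

/-- Poincaré's inequality with the constant given by the first positive Neumann eigenvalue. -/
theorem IsLambdaOne.mul_integral_sq_le (ho : IsOpen Ω) (hn : Ω.Nonempty) (hc : Convex ℝ Ω)
    (hb : Bornology.IsBounded Ω) (hf : ContinuousOn f (closure Ω))
    (hpos : ∀ x ∈ closure Ω, 0 < f x) [IsProbabilityMeasure (densityMeasure Ω f)]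
    {lam : ℝ} (hlam : IsLambdaOne Ω f lam) {w : E N → ℝ} (hw : ContDiffOn ℝ 1 w (closure Ω))
    (hmean : ∫ x, w x ∂(densityMeasure Ω f) = 0) :
    lam * ∫ x, w x ^ 2 ∂(densityMeasure Ω f)
      ≤ ∫ x, ‖gradient w x‖ ^ 2 ∂(densityMeasure Ω f) := by
  by_contra h
  obtain ⟨t, ht0, htl, ht⟩ := exists_isNeumannEigenvalue ho hn hc hb hf hpos hw hmean (not_le.1 h)
  exact absurd (hlam.2 ⟨ht0, ht⟩) (not_le.2 htl)

end W2Lin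

/-! ### Consequences of the spectral gap: bounds for the dual norm, the variance and `W2` -/

namespace W2Lin

variable {N : ℕ} {Ω : Set (E N)} {f u : E N → ℝ} {M ε lam : ℝ}

theorem integral_perturbed (ho : IsOpen Ω) (hf : ContinuousOn f Ω) (hu : ContinuousOn u Ω)
    (hf0 : ∀ x ∈ Ω, 0 ≤ f x) (hg0 : ∀ x ∈ Ω, 0 ≤ perturbed ε f u x) (h : E N → ℝ) :
    ∫ x, h x ∂(densityMeasure Ω (perturbed ε f u))
      = ∫ x, (1 + ε * u x) * h x ∂(densityMeasure Ω f) := by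
  rw [integral_densityMeasure ho _ hg0, integral_densityMeasure ho hf hf0]
  · refine integral_congr_ae (.of_forall fun x => ?_)
    simp only [perturbed, smul_eq_mul]; ring
  · exact (continuousOn_const.add (continuousOn_const.mul hu)).mul hf

/-- The measures μ and ν have the same mass, and their difference has density `ε u` with respect to
μ. -/
theorem integral_eq_zero_of_isProbabilityMeasure (ho : IsOpen Ω) (hf : ContinuousOn f Ω)
    (hu : IsBoundedC1 Ω u) (hε : 0 < ε)
    (hf0 : ∀ x ∈ Ω, 0 ≤ f x) (hg0 : ∀ x ∈ Ω, 0 ≤ perturbed ε f u x)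
    [IsProbabilityMeasure (densityMeasure Ω f)]
    [IsProbabilityMeasure (densityMeasure Ω (perturbed ε f u))] :
    ∫ x, u x ∂(densityMeasure Ω f) = 0 := by
  have h := integral_perturbed ho hf hu.continuousOn hf0 hg0 (fun _ => 1)
  have hi := hu.integrable ho (densityMeasure_absolutelyContinuous Ω f)
  simp only [mul_one] at h
  rw [integral_add (integrable_const _) (hi.const_mul ε), integral_const_mul] at h
  simp only [integral_const, probReal_univ, smul_eq_mul, mul_one] at h
  have : ε * ∫ x, u x ∂(densityMeasure Ω f) = 0 := by linarith
  exact (mul_eq_zero.1 this).resolve_left hε.ne'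

theorem integral_gradient_sq_of_hOneNorm_eq_one {μ : Measure (E N)} {φ : E N → ℝ}
    (h : hOneNorm μ φ = 1) : ∫ x, ‖gradient φ x‖ ^ 2 ∂μ = 1 := by
  rw [hOneNorm, Real.sqrt_eq_one] at h; exact h

/-- The set of pairings is symmetric under `φ ↦ -φ`; if it is empty, `sSup` is zero by convention.
-/
theorem hMinusOneNorm_nonneg (Ω : Set (E N)) (f u : E N → ℝ)
    (hb : BddAbove (hMinusOnePairings Ω f u)) : 0 ≤ hMinusOneNorm Ω f u := by
  rcases (hMinusOnePairings Ω f u).eq_empty_or_nonempty with h | ⟨r, φ, hφ, h1, hr⟩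
  · rw [hMinusOneNorm, h, Real.sSup_empty]
  · have h2 : -r ∈ hMinusOnePairings Ω f u := by
      refine ⟨fun x => -φ x, hφ.neg, ?_, ?_⟩
      · rw [← h1, hOneNorm, hOneNorm]
        congr 2; ext x
        simp only [norm_gradient, fderiv_fun_neg, norm_neg]
      · simp only [mul_neg, integral_neg, hr]
    have h3 := le_csSup hb h2
    have h4 := le_csSup hb ⟨φ, hφ, h1, hr⟩
    rw [hMinusOneNorm]; linarith

/-- A test function of norm one, normalized to have mean zero: its pairing with `u` is unchanged,
and its `L²` norm is controlled. -/
theorem meanZero_normalization (ho : IsOpen Ω) (hn : Ω.Nonempty) (hc : Convex ℝ Ω)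
    (hb : Bornology.IsBounded Ω) (hf : ContinuousOn f (closure Ω))
    (hpos : ∀ x ∈ closure Ω, 0 < f x) [IsProbabilityMeasure (densityMeasure Ω f)]
    (hlam : IsLambdaOne Ω f lam) (hlM : lam⁻¹ ≤ M) (hu : IsBoundedC1 Ω u)
    (hu0 : ∫ x, u x ∂(densityMeasure Ω f) = 0) {φ : E N → ℝ} (hφ : ContDiffOn ℝ 1 φ (closure Ω))
    (hφ1 : ∫ x, ‖gradient φ x‖ ^ 2 ∂(densityMeasure Ω f) = 1) :
    ∃ w : E N → ℝ, ContDiffOn ℝ 1 w (closure Ω) ∧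
      ∫ x, ‖gradient w x‖ ^ 2 ∂(densityMeasure Ω f) = 1 ∧
      ∫ x, w x ^ 2 ∂(densityMeasure Ω f) ≤ M ∧
      ∫ x, u x * φ x ∂(densityMeasure Ω f) = ∫ x, u x * w x ∂(densityMeasure Ω f) := by
  set μ := densityMeasure Ω f
  have hac : μ ≪ volume.restrict Ω := densityMeasure_absolutelyContinuous Ω f
  have hφb := isBoundedC1_of_contDiffOn ho hn hc hb hφ
  set c := ∫ x, φ x ∂μ with hcdef
  have hw : ContDiffOn ℝ 1 (fun x => φ x - c) (closure Ω) := hφ.sub contDiffOn_const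
  have hw1 : ∫ x, ‖gradient (fun x => φ x - c) x‖ ^ 2 ∂μ = 1 := by
    simpa only [gradient, fderiv_sub_const] using hφ1
  have hw0 : ∫ x, (φ x - c) ∂μ = 0 := by
    rw [integral_sub (hφb.integrable ho hac) (integrable_const _)]
    simp [hcdef]
  refine ⟨fun x => φ x - c, hw, hw1, ?_, ?_⟩
  · have h := hlam.mul_integral_sq_le ho hn hc hb hf hpos hw hw0
    rw [hw1] at h
    have hl : 0 < lam := hlam.1.1
    refine le_trans ?_ hlM
    rw [← one_div, le_div_iff₀ hl, mul_comm]
    exact h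
  · have hi1 : Integrable (fun x => u x * φ x) μ :=
      (hu.memLp ho hac).integrable_mul (hφb.memLp ho hac)
    have hi2 : Integrable (fun x => u x * c) μ := (hu.integrable ho hac).mul_const c
    simp only [mul_sub]
    rw [integral_sub hi1 hi2, integral_mul_const, hu0, zero_mul, sub_zero]

/-- After normalization `∫ w² dμ ≤ M`, and `|w| ≤ w² + 1` is enough. This gives finiteness of the
dual norm, and the bound needed when `ε` is not small. -/
theorem pairing_le (ho : IsOpen Ω) (hn : Ω.Nonempty) (hc : Convex ℝ Ω)
    (hb : Bornology.IsBounded Ω) (hf : ContinuousOn f (closure Ω))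
    (hpos : ∀ x ∈ closure Ω, 0 < f x) [IsProbabilityMeasure (densityMeasure Ω f)]
    (hlam : IsLambdaOne Ω f lam) (hlM : lam⁻¹ ≤ M) (hu : IsBoundedC1 Ω u)
    (huM : ∀ x ∈ Ω, |u x| ≤ M)
    (hu0 : ∫ x, u x ∂(densityMeasure Ω f) = 0) {r : ℝ} (hr : r ∈ hMinusOnePairings Ω f u) :
    r ≤ M * (M + 1) := by
  have hM : 0 < M := (inv_pos.2 hlam.1.1).trans_le hlM
  have hac := densityMeasure_absolutelyContinuous Ω f
  obtain ⟨φ, hφ, hφ1, rfl⟩ := hr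
  obtain ⟨w, hw, -, hwM, hpair⟩ := meanZero_normalization ho hn hc hb hf hpos hlam hlM hu hu0 hφ
    (integral_gradient_sq_of_hOneNorm_eq_one hφ1)
  have hwb := isBoundedC1_of_contDiffOn ho hn hc hb hw
  rw [hpair]
  calc ∫ x, u x * w x ∂(densityMeasure Ω f)
      ≤ ∫ x, M * (w x ^ 2 + 1) ∂(densityMeasure Ω f) := by
        refine integral_mono_ae ((hu.memLp ho hac).integrable_mul (hwb.memLp ho hac))
          (((hwb.integrable_sq ho hac).add (integrable_const _)).const_mul M) ?_
        filter_upwards [ae_densityMeasure_mem ho f] with x hx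
        have h1 := huM x hx
        calc u x * w x ≤ |u x * w x| := le_abs_self _
          _ = |u x| * |w x| := abs_mul _ _
          _ ≤ M * (w x ^ 2 + 1) := by
              refine mul_le_mul h1 ?_ (abs_nonneg _) hM.le
              rw [← sq_abs]; nlinarith [sq_nonneg (|w x| - 1), abs_nonneg (w x)]
    _ ≤ M * (M + 1) := by
        rw [integral_const_mul, integral_add (hwb.integrable_sq ho hac) (integrable_const _)]
        simp only [integral_const, probReal_univ, smul_eq_mul, mul_one]
        gcongr

/-- The total variance of the density is controlled by the first eigenvalue. -/
theorem exists_integral_norm_sub_sq_le (ho : IsOpen Ω) (hn : Ω.Nonempty) (hc : Convex ℝ Ω)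
    (hb : Bornology.IsBounded Ω) (hf : ContinuousOn f (closure Ω))
    (hpos : ∀ x ∈ closure Ω, 0 < f x) [IsProbabilityMeasure (densityMeasure Ω f)]
    (hlam : IsLambdaOne Ω f lam) (hlM : lam⁻¹ ≤ M) :
    ∃ c : E N, ∫ x, ‖x - c‖ ^ 2 ∂(densityMeasure Ω f) ≤ N * M := by
  set μ := densityMeasure Ω f
  have hac : μ ≪ volume.restrict Ω := densityMeasure_absolutelyContinuous Ω f
  -- The barycenter. Each centered coordinate is a mean-zero test function with gradient of norm at
  -- most one, and so has variance at most `lam⁻¹`.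
  set c : E N := WithLp.toLp 2 fun i => ∫ x : E N, x i ∂μ with hcdef
  have hproj : ∀ i : Fin N, ContDiff ℝ 1 (fun x : E N => x i - c i) := fun i =>
    (EuclideanSpace.proj i : E N →L[ℝ] ℝ).contDiff.sub contDiff_const
  have hprojb : ∀ i : Fin N, IsBoundedC1 Ω (fun x : E N => x i - c i) := fun i =>
    isBoundedC1_of_contDiffOn ho hn hc hb (hproj i).contDiffOn
  have hprojb' : ∀ i : Fin N, IsBoundedC1 Ω (fun x : E N => x i) := fun i =>
    isBoundedC1_of_contDiffOn ho hn hc hb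
      (EuclideanSpace.proj i : E N →L[ℝ] ℝ).contDiff.contDiffOn
  refine ⟨c, ?_⟩
  simp only [EuclideanSpace.norm_sq_eq, PiLp.sub_apply, Real.norm_eq_abs, sq_abs]
  rw [integral_finsetSum _ fun i _ => (hprojb i).integrable_sq ho hac]
  have hl : 0 < lam := hlam.1.1
  refine (Finset.sum_le_sum (g := fun _ => M) fun i _ => ?_).trans (by simp)
  have h0 : ∫ x : E N, (x i - c i) ∂μ = 0 := by
    rw [integral_sub ((hprojb' i).integrable ho hac) (integrable_const _)]
    simp [hcdef]
  have h := hlam.mul_integral_sq_le ho hn hc hb hf hpos (hproj i).contDiffOn h0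
  have h1 : ∫ x, ‖gradient (fun x : E N => x i - c i) x‖ ^ 2 ∂μ ≤ 1 := by
    have h2 : ∀ x, ‖gradient (fun x : E N => x i - c i) x‖ ^ 2 ≤ 1 := by
      intro x
      rw [norm_gradient, fderiv_sub_const]
      have : fderiv ℝ (fun x : E N => x i) x = EuclideanSpace.proj i :=
        (EuclideanSpace.proj i : E N →L[ℝ] ℝ).fderiv
      rw [this]
      refine pow_le_one₀ (norm_nonneg _) ?_
      refine ContinuousLinearMap.opNorm_le_bound _ zero_le_one fun y => ?_
      rw [one_mul]; exact PiLp.norm_apply_le y i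
    calc _ ≤ ∫ _x, (1 : ℝ) ∂μ :=
          integral_mono ((hprojb i).integrable_gradient_sq ho hac) (integrable_const _) h2
      _ = 1 := by simp
  refine le_trans ?_ hlM
  rw [← one_div, le_div_iff₀ hl, mul_comm]
  exact h.trans h1

theorem W2_le_sqrt_of_mem {μ ν : Measure (E N)} {π : Measure (E N × E N)}
    (hπ : π ∈ transferencePlans μ ν) {R : ℝ} (hR : 0 ≤ R)
    (h : transportCost π ≤ ENNReal.ofReal R) : W2 μ ν ≤ √R := by
  refine Real.sqrt_le_sqrt ?_
  refine ENNReal.toReal_le_of_le_ofReal hR (le_trans (iInf₂_le π hπ) h)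

/-- Cost of the product plan, with `|x - y|² ≤ 2|x - c|² + 2|y - c|²` and `ν ≤ (1 + ε M) μ`. The
diameter of `Ω` is not among the admissible quantities; the variance bound from `lam` replaces it.
-/
theorem W2_le_of_isLambdaOne (ho : IsOpen Ω) (hn : Ω.Nonempty) (hc : Convex ℝ Ω)
    (hb : Bornology.IsBounded Ω) (hf : ContinuousOn f (closure Ω))
    (hpos : ∀ x ∈ closure Ω, 0 < f x) (hu : ContinuousOn u Ω) (huM : ∀ x ∈ Ω, |u x| ≤ M)
    (hε : 0 < ε) (hg0 : ∀ x ∈ Ω, 0 ≤ perturbed ε f u x)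
    [IsProbabilityMeasure (densityMeasure Ω f)]
    [IsProbabilityMeasure (densityMeasure Ω (perturbed ε f u))]
    (hlam : IsLambdaOne Ω f lam) (hlM : lam⁻¹ ≤ M) :
    W2 (densityMeasure Ω f) (densityMeasure Ω (perturbed ε f u)) ≤
      √(2 * (N * M) * (2 + ε * M)) := by
  set μ := densityMeasure Ω f
  set ν := densityMeasure Ω (perturbed ε f u)
  have hM : 0 < M := (inv_pos.2 hlam.1.1).trans_le hlM
  have hac : μ ≪ volume.restrict Ω := densityMeasure_absolutelyContinuous Ω f
  have hac' : ν ≪ volume.restrict Ω := densityMeasure_absolutelyContinuous Ω _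
  obtain ⟨c, hcN⟩ := exists_integral_norm_sub_sq_le ho hn hc hb hf hpos hlam hlM
  have hπ : μ.prod ν ∈ transferencePlans μ ν := by simp [transferencePlans]
  refine W2_le_sqrt_of_mem hπ (by positivity) ?_
  obtain ⟨R, hR⟩ := hb.exists_norm_le
  have hcont : Continuous fun x : E N => ‖x - c‖ ^ 2 := by fun_prop
  have hbd : ∀ x ∈ Ω, ‖‖x - c‖ ^ 2‖ ≤ (R + ‖c‖) ^ 2 := by
    intro x hx
    rw [norm_pow, norm_norm]
    exact pow_le_pow_left₀ (norm_nonneg _) ((norm_sub_le _ _).trans (by linarith [hR x hx])) 2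
  have hi : Integrable (fun x => ‖x - c‖ ^ 2) μ :=
    integrable_of_continuousOn ho hac hcont.continuousOn hbd
  have hi' : Integrable (fun x => ‖x - c‖ ^ 2) ν :=
    integrable_of_continuousOn ho hac' hcont.continuousOn hbd
  have hν : ∫ x, ‖x - c‖ ^ 2 ∂ν ≤ (1 + ε * M) * (N * M) := by
    have h1 : ∫ x, ‖x - c‖ ^ 2 ∂ν ≤ ∫ x, (1 + ε * M) * ‖x - c‖ ^ 2 ∂μ := by
      rw [integral_perturbed ho (hf.mono subset_closure) hu
        (fun x hx => (hpos x (subset_closure hx)).le) hg0]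
      refine integral_mono_of_nonneg ?_ (hi.const_mul _) ?_ <;>
        filter_upwards [ae_densityMeasure_mem ho f] with x hx
      · have h2 := hpos x (subset_closure hx)
        have h3 : 0 ≤ 1 + ε * u x := nonneg_of_mul_nonneg_left (hg0 x hx) h2
        exact mul_nonneg h3 (sq_nonneg _)
      · have := (abs_le.1 (huM x hx)).2
        gcongr
    rw [integral_const_mul] at h1
    refine h1.trans ?_
    gcongr
  calc transportCost (μ.prod ν)
      ≤ ∫⁻ p, (ENNReal.ofReal (2 * ‖p.1 - c‖ ^ 2) + ENNReal.ofReal (2 * ‖p.2 - c‖ ^ 2))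
          ∂(μ.prod ν) := by
        refine lintegral_mono fun p => ?_
        rw [← ENNReal.ofReal_add (by positivity) (by positivity)]
        refine ENNReal.ofReal_le_ofReal ?_
        have h1 : ‖p.1 - p.2‖ ≤ ‖p.1 - c‖ + ‖p.2 - c‖ := by
          have := norm_sub_le (p.1 - c) (p.2 - c)
          rwa [sub_sub_sub_cancel_right] at this
        nlinarith [norm_nonneg (p.1 - p.2), sq_nonneg (‖p.1 - c‖ - ‖p.2 - c‖)]
    _ = ∫⁻ x, ENNReal.ofReal (2 * ‖x - c‖ ^ 2) ∂μ + ∫⁻ x, ENNReal.ofReal (2 * ‖x - c‖ ^ 2) ∂ν := by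
        rw [lintegral_add_left (by fun_prop), lintegral_prod _ (by fun_prop),
          lintegral_prod _ (by fun_prop)]
        simp
    _ = ENNReal.ofReal (2 * ∫ x, ‖x - c‖ ^ 2 ∂μ + 2 * ∫ x, ‖x - c‖ ^ 2 ∂ν) := by
        rw [← ofReal_integral_eq_lintegral_ofReal (hi.const_mul 2) (.of_forall fun x => by positivity),
          ← ofReal_integral_eq_lintegral_ofReal (hi'.const_mul 2)
            (.of_forall fun x => by positivity), integral_const_mul, integral_const_mul,
          ENNReal.ofReal_add]
        · exact mul_nonneg two_pos.le (integral_nonneg fun x => sq_nonneg _)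
        · exact mul_nonneg two_pos.le (integral_nonneg fun x => sq_nonneg _)
    _ ≤ _ := by
        refine ENNReal.ofReal_le_ofReal ?_
        linarith

end W2Lin

/-! ### The displacement maps: Taylor estimates, Jacobians and the change of variables -/

namespace W2Lin

variable {N : ℕ} {Ω : Set (E N)} {f ψ u h : E N → ℝ} {M L ε : ℝ}

theorem norm_gradient_sub_le (hc : Convex ℝ Ω)
    (hd : ∀ x ∈ Ω, DifferentiableAt ℝ (gradient h) x) (hM : ∀ x ∈ Ω, ‖hess h x‖ ≤ M)
    {x y : E N} (hx : x ∈ Ω) (hy : y ∈ Ω) : ‖gradient h y - gradient h x‖ ≤ M * ‖y - x‖ :=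
  hc.norm_image_sub_le_of_norm_hasFDerivWithin_le
    (fun z hz => (hd z hz).hasFDerivAt.hasFDerivWithinAt) hM hx hy

/-- Taylor's formula of order two. -/
theorem abs_sub_sub_inner_gradient_le (hc : Convex ℝ Ω)
    (hd₁ : ∀ x ∈ Ω, DifferentiableAt ℝ h x)
    (hd : ∀ x ∈ Ω, DifferentiableAt ℝ (gradient h) x) (hM : ∀ x ∈ Ω, ‖hess h x‖ ≤ M)
    {x y : E N} (hx : x ∈ Ω) (hy : y ∈ Ω) :
    |h y - h x - inner ℝ (gradient h x) (y - x)| ≤ M * ‖y - x‖ ^ 2 := by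
  have hM0 : 0 ≤ M := (norm_nonneg _).trans (hM x hx)
  have hseg : segment ℝ x y ⊆ Ω := hc.segment_subset hx hy
  have := (convex_segment x y).norm_image_sub_le_of_norm_hasFDerivWithin_le'
    (f := h) (f' := fderiv ℝ h) (φ := fderiv ℝ h x) (C := M * ‖y - x‖)
    (fun z hz => (hd₁ z (hseg hz)).hasFDerivAt.hasFDerivWithinAt) (fun z hz => by
      have h1 : ‖fderiv ℝ h z - fderiv ℝ h x‖ = ‖gradient h z - gradient h x‖ := by
        rw [gradient, gradient, ← map_sub, LinearIsometryEquiv.norm_map]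
      rw [h1]
      refine (norm_gradient_sub_le hc hd hM hx (hseg hz)).trans ?_
      gcongr
      obtain ⟨t, ht, rfl⟩ := (segment_eq_image' ℝ x y) ▸ hz
      rw [add_sub_cancel_left, norm_smul, Real.norm_eq_abs, abs_of_nonneg ht.1]
      exact mul_le_of_le_one_left (norm_nonneg _) ht.2)
    (left_mem_segment ℝ x y) (right_mem_segment ℝ x y)
  rw [inner_gradient_left]
  rw [Real.norm_eq_abs] at this
  refine this.trans (le_of_eq (by ring))

/-- On a segment, a function with bounded Hessian is not much smaller than at the ends. -/
theorem lower_bound_on_segment (hc : Convex ℝ Ω)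
    (hd₁ : ∀ x ∈ Ω, DifferentiableAt ℝ h x)
    (hd : ∀ x ∈ Ω, DifferentiableAt ℝ (gradient h) x) (hM : ∀ x ∈ Ω, ‖hess h x‖ ≤ M)
    {x p : E N} (hx : x ∈ Ω) (hy : x + p ∈ Ω) {t : ℝ} (ht : t ∈ Set.Icc (0 : ℝ) 1) :
    (1 - t) * h x + t * h (x + p) - 2 * M * ‖p‖ ^ 2 ≤ h (x + t • p) := by
  have hM0 : 0 ≤ M := (norm_nonneg _).trans (hM x hx)
  have hz : x + t • p ∈ Ω := by
    have := hc.add_smul_sub_mem hx hy ht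
    rwa [add_sub_cancel_left] at this
  have h1 := abs_sub_sub_inner_gradient_le hc hd₁ hd hM hx hz
  have h2 := abs_sub_sub_inner_gradient_le hc hd₁ hd hM hx hy
  rw [add_sub_cancel_left] at h1 h2
  rw [inner_smul_right, norm_smul, mul_pow, Real.norm_eq_abs, sq_abs] at h1
  have h3 := (abs_le.1 h1).1
  have h4 := (abs_le.1 h2).2
  obtain ⟨ht0, ht1⟩ := ht
  have h5 : t ^ 2 ≤ 1 := by nlinarith
  have h6 : 0 ≤ M * ‖p‖ ^ 2 := by positivity
  have h7 := mul_le_mul_of_nonneg_left h4 ht0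
  nlinarith [mul_le_mul_of_nonneg_right h5 h6, mul_le_mul_of_nonneg_right ht1 h6]

/-- The displacement by `s` along the gradient of `ψ`. -/
noncomputable def shift (ψ : E N → ℝ) (s : ℝ) (x : E N) : E N := x + s • gradient ψ x

theorem measurable_shift (ψ : E N → ℝ) (s : ℝ) : Measurable (shift ψ s) :=
  measurable_id.add ((measurable_gradient ψ).const_smul s)

theorem hasGradientAt_potential {x : E N} (hd : DifferentiableAt ℝ ψ x) :
    HasGradientAt (potential ε ψ) (shift ψ ε x) x := by
  rw [hasGradientAt_iff_hasFDerivAt]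
  have h1 : HasFDerivAt (fun x : E N => ‖x‖ ^ 2) (2 • innerSL ℝ x) x :=
    (hasStrictFDerivAt_norm_sq x).hasFDerivAt
  have h2 := (h1.mul_const (1 / 2 : ℝ)).add (hd.hasFDerivAt.const_mul ε)
  have h3 : potential ε ψ = (fun x => ‖x‖ ^ 2 * (1 / 2)) + fun x => ε * ψ x := by
    ext y; simp [potential]; ring
  rw [h3]
  refine h2.congr_fderiv (ContinuousLinearMap.ext fun y => ?_)
  simp only [InnerProductSpace.toDual_apply_apply, shift, inner_add_left, real_inner_smul_left,
    inner_gradient_left]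
  simp

theorem gradient_potential {x : E N} (hd : DifferentiableAt ℝ ψ x) :
    gradient (potential ε ψ) x = shift ψ ε x :=
  (hasGradientAt_potential hd).gradient

theorem hasFDerivAt_shift {x : E N} (hd : DifferentiableAt ℝ (gradient ψ) x) (s : ℝ) :
    HasFDerivAt (shift ψ s) (ContinuousLinearMap.id ℝ (E N) + s • hess ψ x) x :=
  (hasFDerivAt_id x).add (hd.hasFDerivAt.const_smul s)

theorem hess_potential (ho : IsOpen Ω) (hd₁ : ∀ x ∈ Ω, DifferentiableAt ℝ ψ x)
    (hd : ∀ x ∈ Ω, DifferentiableAt ℝ (gradient ψ) x) {x : E N} (hx : x ∈ Ω) :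
    hess (potential ε ψ) x = ContinuousLinearMap.id ℝ (E N) + ε • hess ψ x := by
  have h1 : gradient (potential ε ψ) =ᶠ[nhds x] shift ψ ε := by
    filter_upwards [ho.mem_nhds hx] with y hy using gradient_potential (hd₁ y hy)
  rw [hess, h1.fderiv_eq]
  exact (hasFDerivAt_shift (hd x hx) ε).fderiv

/-- The determinant is a polynomial in the matrix entries, hence differentiable at the identity. The
numbers `K` and `r` depend on `N` only. -/
theorem exists_abs_det_id_add_sub_one_le (N : ℕ) :
    ∃ K r : ℝ, 0 ≤ K ∧ 0 < r ∧ ∀ B : E N →L[ℝ] E N, ‖B‖ ≤ r →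
      |(ContinuousLinearMap.id ℝ (E N) + B).det - 1| ≤ K * ‖B‖ := by
  have hdet : ∀ A : E N →L[ℝ] E N, A.det = ∑ σ : Equiv.Perm (Fin N), Equiv.Perm.sign σ •
      ∏ i, A (EuclideanSpace.single i 1) (σ i) := by
    intro A
    rw [ContinuousLinearMap.det,
      ← LinearMap.det_toMatrix (EuclideanSpace.basisFun (Fin N) ℝ).toBasis, Matrix.det_apply]
    simp [LinearMap.toMatrix_apply]
  have hdiff : Differentiable ℝ fun B : E N →L[ℝ] E N =>
      (ContinuousLinearMap.id ℝ (E N) + B).det := by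
    simp only [hdet]
    fun_prop
  have hO := (hdiff 0).isBigO_sub
  obtain ⟨K, hK⟩ := hO.bound
  obtain ⟨r, hr, hball⟩ := Metric.eventually_nhds_iff.1 hK
  refine ⟨max K 0, r / 2, le_max_right _ _, half_pos hr, fun B hB => ?_⟩
  have h1 := hball (y := B) (by rw [dist_zero_right]; linarith)
  simp only [add_zero, sub_zero, Real.norm_eq_abs] at h1
  have h2 : (ContinuousLinearMap.id ℝ (E N)).det = 1 := by
    simp [ContinuousLinearMap.det]
  rw [h2] at h1
  exact h1.trans (mul_le_mul_of_nonneg_right (le_max_left _ _) (norm_nonneg _))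

/-- The data of a smooth solution of the Monge-Ampère equation, close to the identity. The number
`L` bounds the relative size of the perturbation. -/
structure SmallTransport (Ω : Set (E N)) (f ψ u : E N → ℝ) (ε M L : ℝ) : Prop where
  isOpen : IsOpen Ω
  convex : Convex ℝ Ω
  bounded : Bornology.IsBounded Ω
  c1_f : IsBoundedC1 Ω f
  c1_ψ : IsBoundedC1 Ω ψ
  c1_u : IsBoundedC1 Ω u
  diff_f : ∀ x ∈ Ω, DifferentiableAt ℝ (gradient f) x
  diff_ψ : ∀ x ∈ Ω, DifferentiableAt ℝ (gradient ψ) x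
  f_pos : ∀ x ∈ Ω, 0 < f x
  g_nonneg : ∀ x ∈ Ω, 0 ≤ perturbed ε f u x
  hess_f : ∀ x ∈ Ω, ‖hess f x‖ ≤ M
  grad_ψ : ∀ x ∈ Ω, ‖gradient ψ x‖ ≤ M
  hess_ψ : ∀ x ∈ Ω, ‖hess ψ x‖ ≤ M
  abs_u : ∀ x ∈ Ω, |u x| ≤ M
  volume_le : volume Ω ≤ ENNReal.ofReal M
  M_pos : 0 < M
  ε_pos : 0 < ε
  M_le : M ≤ L
  small : L * ε ≤ 1 / 32
  mapsTo : ∀ x ∈ Ω, shift ψ ε x ∈ Ω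
  det : ∀ x ∈ Ω, ∀ s ∈ Set.Icc 0 ε,
    |(ContinuousLinearMap.id ℝ (E N) + s • hess ψ x).det - 1| ≤ L * ε
  monge : ∀ x ∈ Ω, f x = (1 + ε * u (shift ψ ε x)) * f (shift ψ ε x) *
    (ContinuousLinearMap.id ℝ (E N) + ε • hess ψ x).det

namespace SmallTransport

theorem small' (S : SmallTransport Ω f ψ u ε M L) : M * ε ≤ 1 / 32 :=
  (mul_le_mul_of_nonneg_right S.M_le S.ε_pos.le).trans S.small

theorem L_pos (S : SmallTransport Ω f ψ u ε M L) : 0 < L := S.M_pos.trans_le S.M_le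

/-- By convexity: the intermediate point lies on the segment from `x` to its image. -/
theorem mapsTo_shift (S : SmallTransport Ω f ψ u ε M L) {t : ℝ} (ht : t ∈ Set.Icc (0 : ℝ) 1)
    {x : E N} (hx : x ∈ Ω) : shift ψ (t * ε) x ∈ Ω := by
  have := S.convex.add_smul_sub_mem hx (S.mapsTo x hx) ht
  rwa [shift, add_sub_cancel_left, smul_smul] at this

theorem mem_Icc (S : SmallTransport Ω f ψ u ε M L) {t : ℝ} (ht : t ∈ Set.Icc (0 : ℝ) 1) :
    t * ε ∈ Set.Icc 0 ε :=
  ⟨mul_nonneg ht.1 S.ε_pos.le, mul_le_of_le_one_left S.ε_pos.le ht.2⟩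

theorem det_ge (S : SmallTransport Ω f ψ u ε M L) {x : E N} (hx : x ∈ Ω) {s : ℝ}
    (hs : s ∈ Set.Icc 0 ε) :
    1 - L * ε ≤ (ContinuousLinearMap.id ℝ (E N) + s • hess ψ x).det := by
  linarith [(abs_le.1 (S.det x hx s hs)).1]

/-- The displacement `s • gradient ψ` is a contraction, with Lipschitz constant at most 1/32. -/
theorem injOn_shift (S : SmallTransport Ω f ψ u ε M L) {s : ℝ} (hs : s ∈ Set.Icc 0 ε) :
    Set.InjOn (shift ψ s) Ω := by
  intro x hx y hy hxy
  have h1 : y - x = -(s • (gradient ψ y - gradient ψ x)) := by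
    simp only [shift] at hxy
    have h2 : x = y + s • gradient ψ y - s • gradient ψ x := eq_sub_of_add_eq hxy
    rw [smul_sub, neg_sub]
    nth_rewrite 1 [h2]
    abel
  have h2 : ‖y - x‖ ≤ s * (M * ‖y - x‖) := by
    nth_rewrite 1 [h1]
    rw [norm_neg, norm_smul, Real.norm_eq_abs, abs_of_nonneg hs.1]
    exact mul_le_mul_of_nonneg_left
      (norm_gradient_sub_le S.convex S.diff_ψ S.hess_ψ hx hy) hs.1
  have h3 : s * M ≤ 1 / 32 :=
    (mul_le_mul_of_nonneg_right hs.2 S.M_pos.le).trans (by linarith [S.small'])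
  have h4 : ‖y - x‖ = 0 := by nlinarith [norm_nonneg (y - x)]
  exact (sub_eq_zero.1 (norm_eq_zero.1 h4)).symm

/-- The change of variables inequality for the displacements. -/
theorem lintegral_det_mul_comp_shift_le (S : SmallTransport Ω f ψ u ε M L) {s : ℝ}
    (hs : s ∈ Set.Icc 0 ε) (hmaps : ∀ x ∈ Ω, shift ψ s x ∈ Ω) (h : E N → ENNReal) :
    ∫⁻ x in Ω, ENNReal.ofReal (ContinuousLinearMap.id ℝ (E N) + s • hess ψ x).det *
      h (shift ψ s x) ≤ ∫⁻ x in Ω, h x := by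
  refine le_trans (le_of_eq ?_) (lintegral_mono_set (Set.image_subset_iff.2 hmaps))
  rw [lintegral_image_eq_lintegral_abs_det_fderiv_mul volume S.isOpen.measurableSet
    (fun x hx => (hasFDerivAt_shift (S.diff_ψ x hx) s).hasFDerivWithinAt) (S.injOn_shift hs)]
  refine setLIntegral_congr_fun S.isOpen.measurableSet fun x hx => ?_
  rw [abs_of_nonneg]
  linarith [S.det_ge hx hs, S.small]

theorem right_mem (S : SmallTransport Ω f ψ u ε M L) : ε ∈ Set.Icc 0 ε :=
  Set.right_mem_Icc.2 S.ε_pos.le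

/-- Injectivity and the Monge-Ampère equation show that the image measure is at most ν. Both have
mass one, so they agree, and no surjectivity of the map onto `Ω` has to be proved. -/
theorem map_shift (S : SmallTransport Ω f ψ u ε M L) [IsProbabilityMeasure (densityMeasure Ω f)]
    [IsProbabilityMeasure (densityMeasure Ω (perturbed ε f u))] :
    (densityMeasure Ω f).map (shift ψ ε) = densityMeasure Ω (perturbed ε f u) := by
  have hT := measurable_shift ψ ε
  have : IsProbabilityMeasure ((densityMeasure Ω f).map (shift ψ ε)) :=
    Measure.isProbabilityMeasure_map hT.aemeasurable
  refine Measure.eq_of_le_of_isProbabilityMeasure (Measure.le_iff.2 fun A hA => ?_)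
  rw [Measure.map_apply hT hA, densityMeasure, densityMeasure, withDensity_apply _ (hT hA),
    withDensity_apply _ hA, ← lintegral_indicator (hT hA), ← lintegral_indicator hA]
  refine le_trans (le_of_eq ?_) (S.lintegral_det_mul_comp_shift_le S.right_mem S.mapsTo _)
  refine setLIntegral_congr_fun S.isOpen.measurableSet fun x hx => ?_
  by_cases hxA : shift ψ ε x ∈ A
  · rw [Set.indicator_of_mem hxA, Set.indicator_of_mem (show x ∈ shift ψ ε ⁻¹' A from hxA),
      ← ENNReal.ofReal_mul (by linarith [S.det_ge hx S.right_mem, S.small]), perturbed,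
      mul_comm (ContinuousLinearMap.det _), ← S.monge x hx]
  · rw [Set.indicator_of_notMem hxA,
      Set.indicator_of_notMem (show x ∉ shift ψ ε ⁻¹' A from hxA), mul_zero]

theorem integral_comp_shift (S : SmallTransport Ω f ψ u ε M L)
    [IsProbabilityMeasure (densityMeasure Ω f)]
    [IsProbabilityMeasure (densityMeasure Ω (perturbed ε f u))] {h : E N → ℝ}
    (hh : AEStronglyMeasurable h (densityMeasure Ω (perturbed ε f u))) :
    ∫ x, h (shift ψ ε x) ∂(densityMeasure Ω f)
      = ∫ x, h x ∂(densityMeasure Ω (perturbed ε f u)) := by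
  rw [← S.map_shift] at hh ⊢
  exact (integral_map (measurable_shift ψ ε).aemeasurable hh).symm

/-- The density varies by a relative error of order `ε` along the transport. -/
theorem abs_comp_shift_sub_le (S : SmallTransport Ω f ψ u ε M L) {x : E N} (hx : x ∈ Ω) :
    |f (shift ψ ε x) - f x| ≤ 6 * (L * ε) * f x := by
  have hm := S.monge x hx
  set y := shift ψ ε x
  have hy : y ∈ Ω := S.mapsTo x hx
  set D := (ContinuousLinearMap.id ℝ (E N) + ε • hess ψ x).det
  have hD := abs_le.1 (S.det x hx ε S.right_mem)
  have hu := abs_le.1 (S.abs_u y hy)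
  have hfy := S.f_pos y hy
  have hfx := S.f_pos x hx
  have hs := S.small
  have hε := S.ε_pos
  set δ := L * ε with hδ
  have hδ0 : 0 < δ := mul_pos S.L_pos hε
  have hu1 : |ε * u y| ≤ δ := by
    rw [abs_mul, abs_of_pos hε, hδ, mul_comm]
    exact mul_le_mul_of_nonneg_right ((S.abs_u y hy).trans S.M_le) hε.le
  obtain ⟨ha, hb⟩ := abs_le.1 hu1
  set b := ε * u y
  -- By the Monge-Ampère equation `(1 + b) * D` is exactly the ratio of `f x` to `f y`. The estimate
  -- is therefore relative, without a lower bound for `f`.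
  have h1 : |(1 + b) * D - 1| ≤ 3 * δ := by
    have : (1 + b) * D - 1 = b * (D - 1) + b + (D - 1) := by ring
    rw [this]
    have h2 : |b * (D - 1)| ≤ δ * δ := by
      rw [abs_mul]
      exact mul_le_mul hu1 (S.det x hx ε S.right_mem) (abs_nonneg _) hδ0.le
    calc _ ≤ |b * (D - 1)| + |b| + |D - 1| := abs_add_three _ _ _
      _ ≤ δ * δ + δ + δ := by
          gcongr; exact S.det x hx ε S.right_mem
      _ ≤ _ := by nlinarith
  set a := (1 + b) * D with ha'
  have h3 : f x = a * f y := by rw [hm]; ring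
  obtain ⟨h4, h5⟩ := abs_le.1 h1
  have h6 : f y ≤ 2 * f x := by rw [h3]; nlinarith
  have h7 : f y - f x = -((a - 1) * f y) := by rw [h3]; ring
  rw [h7, abs_neg, abs_mul, abs_of_pos hfy]
  calc |a - 1| * f y ≤ 3 * δ * (2 * f x) := by gcongr
    _ = _ := by ring

/-- The Monge-Ampère equation controls `f` at the far end of the segment only. In between, the
Hessian bound costs `2 * M` times the squared length, and the length is at most `M * ε`. This
absolute error is the reason for the cutoff later. -/
theorem comp_shift_ge (S : SmallTransport Ω f ψ u ε M L) {t : ℝ} (ht : t ∈ Set.Icc (0 : ℝ) 1)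
    {x : E N} (hx : x ∈ Ω) :
    (1 - 6 * (L * ε)) * f x - 2 * M ^ 3 * ε ^ 2 ≤ f (shift ψ (t * ε) x) := by
  have h1 := lower_bound_on_segment S.convex S.c1_f.diff S.diff_f S.hess_f hx
    (S.mapsTo x hx) ht
  rw [smul_smul] at h1
  have h2 : ‖ε • gradient ψ x‖ ^ 2 ≤ M ^ 2 * ε ^ 2 := by
    rw [norm_smul, mul_pow, Real.norm_eq_abs, sq_abs, mul_comm]
    gcongr
    exact S.grad_ψ x hx
  have h3 := (abs_le.1 (S.abs_comp_shift_sub_le hx)).1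
  have h4 : 0 ≤ 6 * (L * ε) * f x := by
    have := S.L_pos; have := S.ε_pos; have := S.f_pos x hx
    positivity
  have h5 := mul_le_mul_of_nonneg_left h2 (show 0 ≤ 2 * M by linarith [S.M_pos])
  change _ ≤ f (shift ψ (t * ε) x) at h1
  change (1 - t) * f x + t * f (shift ψ ε x) - _ ≤ _ at h1
  nlinarith [mul_le_mul_of_nonneg_left h3 ht.1, mul_le_mul_of_nonneg_right ht.2 h4]

end SmallTransport

end W2Lin

/-! ### Kantorovich duality, the exact value of `W2`, and the lower bound for the dual norm -/

namespace W2Lin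

variable {N : ℕ} {Ω : Set (E N)} {f ψ u : E N → ℝ} {M L ε : ℝ}

theorem ofReal_integral_le_lintegral_ofReal {α : Type*} [MeasurableSpace α] {μ : Measure α}
    {h : α → ℝ} (hi : Integrable h μ) :
    ENNReal.ofReal (∫ x, h x ∂μ) ≤ ∫⁻ x, ENNReal.ofReal (h x) ∂μ := by
  rw [integral_eq_lintegral_pos_part_sub_lintegral_neg_part hi]
  refine le_trans (ENNReal.ofReal_le_ofReal (sub_le_self _ ENNReal.toReal_nonneg)) ?_
  exact ENNReal.ofReal_toReal_le

/-- Kantorovich duality, easy half: a pair of potentials bounds the transport cost from below. -/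
theorem ofReal_integral_add_le_transportCost {μ ν : Measure (E N)} {π : Measure (E N × E N)}
    (hπ : π ∈ transferencePlans μ ν) {a b : E N → ℝ} (ha : Integrable a μ) (hb : Integrable b ν)
    {s : Set (E N)} (hs : ∀ᵐ x ∂μ, x ∈ s)
    (hab : ∀ x ∈ s, ∀ y, a x + b y ≤ ‖x - y‖ ^ 2) :
    ENNReal.ofReal (∫ x, a x ∂μ + ∫ y, b y ∂ν) ≤ transportCost π := by
  obtain ⟨h1, h2⟩ := hπ
  have p1 : MeasurePreserving Prod.fst π μ := ⟨measurable_fst, h1⟩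
  have p2 : MeasurePreserving Prod.snd π ν := ⟨measurable_snd, h2⟩
  have ha' : Integrable (fun p : E N × E N => a p.1) π := p1.integrable_comp_of_integrable ha
  have hb' : Integrable (fun p : E N × E N => b p.2) π := p2.integrable_comp_of_integrable hb
  have e1 : ∫ x, a x ∂μ = ∫ p, a p.1 ∂π := by
    rw [← h1] at ha ⊢
    exact integral_map measurable_fst.aemeasurable ha.aestronglyMeasurable
  have e2 : ∫ x, b x ∂ν = ∫ p, b p.2 ∂π := by
    rw [← h2] at hb ⊢
    exact integral_map measurable_snd.aemeasurable hb.aestronglyMeasurable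
  rw [e1, e2, ← integral_add ha' hb']
  refine (ofReal_integral_le_lintegral_ofReal (ha'.add hb')).trans (lintegral_mono_ae ?_)
  filter_upwards [p1.quasiMeasurePreserving.ae hs] with p hp
  exact ENNReal.ofReal_le_ofReal (hab _ hp _)

namespace SmallTransport

theorem integrable_comp_shift (S : SmallTransport Ω f ψ u ε M L)
    [IsProbabilityMeasure (densityMeasure Ω f)]
    [IsProbabilityMeasure (densityMeasure Ω (perturbed ε f u))] {h : E N → ℝ}
    (hh : Integrable h (densityMeasure Ω (perturbed ε f u))) :
    Integrable (fun x => h (shift ψ ε x)) (densityMeasure Ω f) :=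
  have hmp : MeasurePreserving (shift ψ ε) (densityMeasure Ω f)
      (densityMeasure Ω (perturbed ε f u)) := ⟨measurable_shift ψ ε, S.map_shift⟩
  hmp.integrable_comp_of_integrable hh

theorem integrable_gradient_sq (S : SmallTransport Ω f ψ u ε M L)
    [IsProbabilityMeasure (densityMeasure Ω f)] :
    Integrable (fun x => ‖gradient ψ x‖ ^ 2) (densityMeasure Ω f) :=
  S.c1_ψ.integrable_gradient_sq S.isOpen (densityMeasure_absolutelyContinuous Ω f)

theorem transportCost_map (S : SmallTransport Ω f ψ u ε M L)
    [IsProbabilityMeasure (densityMeasure Ω f)] :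
    transportCost ((densityMeasure Ω f).map fun x => (x, shift ψ ε x))
      = ENNReal.ofReal (ε ^ 2 * ∫ x, ‖gradient ψ x‖ ^ 2 ∂(densityMeasure Ω f)) := by
  rw [transportCost, lintegral_map (by fun_prop)
      (show Measurable fun x => (x, shift ψ ε x) from
        measurable_id.prodMk (measurable_shift ψ ε)), ← integral_const_mul, ofReal_integral_eq_lintegral_ofReal
      (S.integrable_gradient_sq.const_mul _) (.of_forall fun x => by positivity)]
  refine lintegral_congr fun x => ?_
  simp only [shift, sub_add_cancel_left, norm_neg, norm_smul, mul_pow, Real.norm_eq_abs, sq_abs]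

theorem map_mem_transferencePlans (S : SmallTransport Ω f ψ u ε M L)
    [IsProbabilityMeasure (densityMeasure Ω f)]
    [IsProbabilityMeasure (densityMeasure Ω (perturbed ε f u))] :
    (densityMeasure Ω f).map (fun x => (x, shift ψ ε x)) ∈
      transferencePlans (densityMeasure Ω f) (densityMeasure Ω (perturbed ε f u)) := by
  have hm : Measurable fun x => (x, shift ψ ε x) := measurable_id.prodMk (measurable_shift ψ ε)
  constructor
  · rw [Measure.map_map measurable_fst hm]
    exact Measure.map_id
  · rw [Measure.map_map measurable_snd hm]
    exact S.map_shift

/-- The displacement is optimal, since it is the gradient of a convex function. -/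
theorem norm_sub_shift_sq_le (S : SmallTransport Ω f ψ u ε M L) {x z : E N} (hx : x ∈ Ω)
    (hz : z ∈ Ω) :
    ‖x - shift ψ ε x‖ ^ 2 + 2 * ε * ψ x ≤ ‖z - shift ψ ε x‖ ^ 2 + 2 * ε * ψ z := by
  have h1 := abs_sub_sub_inner_gradient_le S.convex S.c1_ψ.diff S.diff_ψ S.hess_ψ hx hz
  have h2 := (abs_le.1 h1).1
  have h3 : z - shift ψ ε x = (z - x) - ε • gradient ψ x := by simp only [shift]; abel
  have h4 : x - shift ψ ε x = -(ε • gradient ψ x) := by simp only [shift]; abel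
  rw [h3, h4, norm_neg, norm_sub_sq_real, inner_smul_right, real_inner_comm]
  have h5 := mul_le_mul_of_nonneg_left h2 S.ε_pos.le
  have h6 := mul_le_mul_of_nonneg_right S.small' (sq_nonneg ‖z - x‖)
  nlinarith [sq_nonneg ‖z - x‖]

/-- The plan carried by the graph of the displacement costs `ε² P²`, and a pair of dual potentials
attains the same value. -/
theorem W2_eq (S : SmallTransport Ω f ψ u ε M L) (hn : Ω.Nonempty)
    [IsProbabilityMeasure (densityMeasure Ω f)]
    [IsProbabilityMeasure (densityMeasure Ω (perturbed ε f u))] :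
    W2 (densityMeasure Ω f) (densityMeasure Ω (perturbed ε f u))
      = ε * hOneNorm (densityMeasure Ω f) ψ := by
  set μ := densityMeasure Ω f
  set ν := densityMeasure Ω (perturbed ε f u)
  have hacμ : μ ≪ volume.restrict Ω := densityMeasure_absolutelyContinuous Ω f
  set P2 := ∫ x, ‖gradient ψ x‖ ^ 2 ∂μ with hP2
  obtain ⟨Bψ, hBψ⟩ := S.c1_ψ.bdd
  obtain ⟨R, hR⟩ := S.bounded.exists_norm_le
  have hε := S.ε_pos
  obtain ⟨x₀, hx₀⟩ := hn
  have : Nonempty Ω := ⟨⟨x₀, hx₀⟩⟩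
  have hBψ0 : 0 ≤ Bψ := (abs_nonneg _).trans (hBψ x₀ hx₀).1
  have hlow : ∀ (z : Ω) (y : E N), -(2 * ε * Bψ) ≤ ‖(z : E N) - y‖ ^ 2 + 2 * ε * ψ z := by
    intro z y
    have h1 := (abs_le.1 (hBψ z z.2).1).1
    nlinarith [sq_nonneg ‖(z : E N) - y‖]
  -- The potential conjugate to `-2 ε ψ`: the largest `b` admissible in the duality inequality on
  -- `Ω`. An infimum of continuous functions is upper semicontinuous, hence measurable.
  set b : E N → ℝ := fun y => ⨅ z : Ω, (‖(z : E N) - y‖ ^ 2 + 2 * ε * ψ z) with hbdef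
  have hbb : ∀ y, BddBelow (Set.range fun z : Ω => ‖(z : E N) - y‖ ^ 2 + 2 * ε * ψ z) :=
    fun y => ⟨-(2 * ε * Bψ), by rintro _ ⟨z, rfl⟩; exact hlow z y⟩
  have hbm : Measurable b := by
    refine UpperSemicontinuous.measurable (upperSemicontinuous_ciInf hbb fun z => ?_)
    exact Continuous.upperSemicontinuous (by fun_prop)
  have hbint : Integrable b ν := by
    refine Integrable.of_bound hbm.aestronglyMeasurable ((2 * R) ^ 2 + 2 * ε * Bψ) ?_
    filter_upwards [ae_densityMeasure_mem S.isOpen (perturbed ε f u)] with y hy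
    rw [Real.norm_eq_abs, abs_le]
    constructor
    · refine le_trans ?_ (le_ciInf fun z => hlow z y)
      nlinarith [sq_nonneg (2 * R)]
    · refine (ciInf_le (hbb y) ⟨x₀, hx₀⟩).trans ?_
      have h1 : ‖x₀ - y‖ ≤ 2 * R := (norm_sub_le _ _).trans (by linarith [hR x₀ hx₀, hR y hy])
      have h2 := (abs_le.1 (hBψ x₀ hx₀).1).2
      have h3 : ‖x₀ - y‖ ^ 2 ≤ (2 * R) ^ 2 := pow_le_pow_left₀ (norm_nonneg _) h1 2
      simp only
      nlinarith
  have haint : Integrable (fun x => -(2 * ε * ψ x)) μ :=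
    ((S.c1_ψ.integrable S.isOpen hacμ).const_mul (2 * ε)).neg
  have hdual : ∫ x, -(2 * ε * ψ x) ∂μ + ∫ y, b y ∂ν = ε ^ 2 * P2 := by
    have hbT : Integrable (fun x => b (shift ψ ε x)) μ := S.integrable_comp_shift hbint
    rw [← S.integral_comp_shift hbint.aestronglyMeasurable, ← integral_add haint hbT, hP2,
      ← integral_const_mul]
    refine integral_congr_ae ?_
    filter_upwards [ae_densityMeasure_mem S.isOpen f] with x hx
    -- Convexity of `φ` makes `x` itself a minimizer at the image of `x`, so that the duality
    -- inequality is an equality along the graph.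
    have h1 : b (shift ψ ε x) = ‖x - shift ψ ε x‖ ^ 2 + 2 * ε * ψ x :=
      le_antisymm (ciInf_le (hbb _) ⟨x, hx⟩)
        (le_ciInf fun z => S.norm_sub_shift_sq_le hx z.2)
    rw [h1]
    simp only [shift, sub_add_cancel_left, norm_neg, norm_smul, mul_pow, Real.norm_eq_abs, sq_abs]
    ring
  have hinf : ⨅ π ∈ transferencePlans μ ν, transportCost π = ENNReal.ofReal (ε ^ 2 * P2) := by
    refine le_antisymm ?_ (le_iInf₂ fun π hπ => ?_)
    · exact (iInf₂_le _ S.map_mem_transferencePlans).trans S.transportCost_map.le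
    · rw [← hdual]
      refine ofReal_integral_add_le_transportCost hπ haint hbint
        (ae_densityMeasure_mem S.isOpen f) fun x hx y => ?_
      linarith [ciInf_le (hbb y) ⟨x, hx⟩]
  have hP20 : 0 ≤ P2 := integral_nonneg fun x => sq_nonneg _
  rw [W2, hinf, ENNReal.toReal_ofReal (by positivity), Real.sqrt_mul (by positivity),
    Real.sqrt_sq hε.le, hOneNorm]

/-- The perturbation of the density, expressed by the displacement. -/
theorem mul_integral_mul_eq (S : SmallTransport Ω f ψ u ε M L)
    [IsProbabilityMeasure (densityMeasure Ω f)]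
    [IsProbabilityMeasure (densityMeasure Ω (perturbed ε f u))] {h : E N → ℝ}
    (hc : ContinuousOn h Ω) {B : ℝ} (hB : ∀ x ∈ Ω, |h x| ≤ B) :
    ε * ∫ x, u x * h x ∂(densityMeasure Ω f)
      = ∫ x, (h (shift ψ ε x) - h x) ∂(densityMeasure Ω f) := by
  have hac := densityMeasure_absolutelyContinuous Ω f
  have hac' := densityMeasure_absolutelyContinuous Ω (perturbed ε f u)
  have hi := integrable_of_continuousOn S.isOpen hac hc hB
  have hi' := integrable_of_continuousOn S.isOpen hac' hc hB
  have hiT := S.integrable_comp_shift hi'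
  have hiu : Integrable (fun x => u x * h x) (densityMeasure Ω f) := by
    refine integrable_of_continuousOn S.isOpen hac (S.c1_u.continuousOn.mul hc) (B := M * B)
      fun x hx => ?_
    rw [norm_mul]
    exact mul_le_mul (S.abs_u x hx) (hB x hx) (norm_nonneg _) S.M_pos.le
  rw [integral_sub hiT hi, S.integral_comp_shift hi'.aestronglyMeasurable,
    integral_perturbed S.isOpen S.c1_f.continuousOn S.c1_u.continuousOn
      (fun x hx => (S.f_pos x hx).le) S.g_nonneg]
  have : ∀ x, (1 + ε * u x) * h x = h x + ε * (u x * h x) := fun x => by ring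
  simp only [this]
  rw [integral_add hi (hiu.const_mul ε), integral_const_mul]
  ring

theorem hOneNorm_le (S : SmallTransport Ω f ψ u ε M L)
    [IsProbabilityMeasure (densityMeasure Ω f)] :
    hOneNorm (densityMeasure Ω f) ψ ≤ M := by
  rw [hOneNorm, Real.sqrt_le_left S.M_pos.le]
  calc ∫ x, ‖gradient ψ x‖ ^ 2 ∂(densityMeasure Ω f)
      ≤ ∫ _x, M ^ 2 ∂(densityMeasure Ω f) := by
        refine integral_mono_ae S.integrable_gradient_sq (integrable_const _) ?_
        filter_upwards [ae_densityMeasure_mem S.isOpen f] with x hx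
        exact pow_le_pow_left₀ (norm_nonneg _) (S.grad_ψ x hx) 2
    _ = M ^ 2 := by simp

/-- The competitor is `ψ / P`: by Taylor's formula `ψ` grows along its own gradient by at least `(ε
- M ε²) ‖∇ψ‖²`. -/
theorem hOneNorm_le_hMinusOneNorm (S : SmallTransport Ω f ψ u ε M L)
    [IsProbabilityMeasure (densityMeasure Ω f)]
    [IsProbabilityMeasure (densityMeasure Ω (perturbed ε f u))]
    (hψ : ContDiffOn ℝ 1 ψ (closure Ω)) (hb : BddAbove (hMinusOnePairings Ω f u)) :
    hOneNorm (densityMeasure Ω f) ψ - M ^ 2 * ε ≤ hMinusOneNorm Ω f u := by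
  set μ := densityMeasure Ω f
  set P := hOneNorm μ ψ with hP
  have hε := S.ε_pos
  have hM := S.M_pos
  have hP0 : 0 ≤ P := Real.sqrt_nonneg _
  have hPM : P ≤ M := S.hOneNorm_le
  have hac : μ ≪ volume.restrict Ω := densityMeasure_absolutelyContinuous Ω f
  have hP2 : ∫ x, ‖gradient ψ x‖ ^ 2 ∂μ = P ^ 2 := by
    rw [hP, hOneNorm, Real.sq_sqrt (integral_nonneg fun x => sq_nonneg _)]
  -- If `P = 0` there is nothing to normalize, and nonnegativity of the dual norm suffices.
  rcases hP0.eq_or_lt with h0 | h0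
  · rw [← h0]
    have := hMinusOneNorm_nonneg Ω f u hb
    nlinarith [mul_pos (pow_pos hM 2) hε]
  have hkey : P ^ 2 * (1 - M * ε) ≤ ∫ x, u x * ψ x ∂μ := by
    obtain ⟨B, hB⟩ := S.c1_ψ.bdd
    have h1 := S.mul_integral_mul_eq S.c1_ψ.continuousOn fun x hx => (hB x hx).1
    have h2 : ∫ x, (ε - M * ε ^ 2) * ‖gradient ψ x‖ ^ 2 ∂μ
        ≤ ∫ x, (ψ (shift ψ ε x) - ψ x) ∂μ := by
      refine integral_mono_ae (S.integrable_gradient_sq.const_mul _) ?_ ?_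
      · refine Integrable.sub ?_ (S.c1_ψ.integrable S.isOpen hac)
        exact S.integrable_comp_shift
          (S.c1_ψ.integrable S.isOpen (densityMeasure_absolutelyContinuous Ω _))
      · filter_upwards [ae_densityMeasure_mem S.isOpen f] with x hx
        have h3 := (abs_le.1 (abs_sub_sub_inner_gradient_le S.convex S.c1_ψ.diff S.diff_ψ S.hess_ψ
          hx (S.mapsTo x hx))).1
        simp only [shift] at h3 ⊢
        rw [add_sub_cancel_left, inner_smul_right, real_inner_self_eq_norm_sq, norm_smul,
          mul_pow, Real.norm_eq_abs, sq_abs] at h3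
        linarith
    rw [integral_const_mul, hP2, ← h1] at h2
    have h4 : ε * (P ^ 2 * (1 - M * ε)) ≤ ε * ∫ x, u x * ψ x ∂μ := by
      refine le_trans (le_of_eq ?_) h2; ring
    exact le_of_mul_le_mul_left h4 hε
  have hmem : P⁻¹ * ∫ x, u x * ψ x ∂μ ∈ hMinusOnePairings Ω f u := by
    refine ⟨fun x => P⁻¹ * ψ x, contDiffOn_const.mul hψ, ?_, ?_⟩
    · rw [hOneNorm, Real.sqrt_eq_one]
      calc ∫ x, ‖gradient (fun y => P⁻¹ * ψ y) x‖ ^ 2 ∂μ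
          = ∫ x, (P ^ 2)⁻¹ * ‖gradient ψ x‖ ^ 2 ∂μ := by
            refine integral_congr_ae ?_
            filter_upwards [ae_densityMeasure_mem S.isOpen f] with x hx
            rw [norm_gradient, norm_gradient, fderiv_const_mul (S.c1_ψ.diff x hx), norm_smul,
              mul_pow, Real.norm_eq_abs, sq_abs, inv_pow]
        _ = 1 := by
            rw [integral_const_mul, hP2]; field_simp
    · rw [← integral_const_mul]
      congr 1; ext x; ring
  refine le_trans ?_ (le_csSup hb hmem)
  calc P - M ^ 2 * ε ≤ P - M * P * ε := by
        have : M * P * ε ≤ M * M * ε := by gcongr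
        nlinarith
    _ = P⁻¹ * (P ^ 2 * (1 - M * ε)) := by field_simp
    _ ≤ _ := by gcongr

end SmallTransport

end W2Lin

/-! ### The cutoff in the density, and the upper bound for the dual norm -/

namespace W2Lin

variable {N : ℕ} {Ω : Set (E N)} {f ψ u w : E N → ℝ} {M L ε κ : ℝ}

/-- A Lipschitz function which vanishes up to `κ` and is one from `2 κ` on. -/
noncomputable def cutoff (κ s : ℝ) : ℝ := max 0 (min 1 (s / κ - 1))

theorem cutoff_nonneg (κ s : ℝ) : 0 ≤ cutoff κ s := le_max_left _ _

theorem cutoff_le_one (κ s : ℝ) : cutoff κ s ≤ 1 := max_le zero_le_one (min_le_left _ _)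

theorem abs_cutoff_le_one (κ s : ℝ) : |cutoff κ s| ≤ 1 := by
  rw [abs_of_nonneg (cutoff_nonneg κ s)]; exact cutoff_le_one κ s

theorem cutoff_eq_zero (hκ : 0 < κ) {s : ℝ} (hs : s ≤ κ) : cutoff κ s = 0 := by
  refine max_eq_left ((min_le_right _ _).trans ?_)
  rw [sub_nonpos, div_le_one hκ]; exact hs

theorem cutoff_eq_one (hκ : 0 < κ) {s : ℝ} (hs : 2 * κ ≤ s) : cutoff κ s = 1 := by
  have : 1 ≤ s / κ - 1 := by rw [le_sub_iff_add_le, le_div_iff₀ hκ]; linarith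
  rw [cutoff, min_eq_left this, max_eq_right zero_le_one]

theorem continuous_cutoff (κ : ℝ) : Continuous (cutoff κ) := by
  unfold cutoff; fun_prop

theorem abs_cutoff_sub_le (hκ : 0 < κ) (s s' : ℝ) :
    |cutoff κ s - cutoff κ s'| ≤ |s - s'| / κ := by
  have h1 : |cutoff κ s - cutoff κ s'| ≤ |min 1 (s / κ - 1) - min 1 (s' / κ - 1)| := by
    have := abs_max_sub_max_le_max 0 (min 1 (s / κ - 1)) 0 (min 1 (s' / κ - 1))
    rwa [sub_self, abs_zero,
      max_eq_right (abs_nonneg (min 1 (s / κ - 1) - min 1 (s' / κ - 1)))] at this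
  have h2 := abs_min_sub_min_le_max 1 (s / κ - 1) 1 (s' / κ - 1)
  rw [sub_self, abs_zero, max_eq_right (abs_nonneg (s / κ - 1 - (s' / κ - 1)))] at h2
  refine h1.trans (h2.trans (le_of_eq ?_))
  rw [sub_sub_sub_cancel_right, ← sub_div, abs_div, abs_of_pos hκ]

namespace SmallTransport

theorem isFiniteMeasure (S : SmallTransport Ω f ψ u ε M L) :
    IsFiniteMeasure (volume.restrict Ω) :=
  ⟨by simpa using volume_lt_top_of_isBounded S.bounded⟩

theorem real_volume_le (S : SmallTransport Ω f ψ u ε M L) : volume.real Ω ≤ M :=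
  ENNReal.toReal_le_of_le_ofReal S.M_pos.le S.volume_le

theorem integral_eq (S : SmallTransport Ω f ψ u ε M L) (h : E N → ℝ) :
    ∫ x, h x ∂(densityMeasure Ω f) = ∫ x in Ω, f x * h x :=
  integral_densityMeasure S.isOpen S.c1_f.continuousOn (fun x hx => (S.f_pos x hx).le) h

/-- Integrals of functions which are bounded relative to the density. -/
theorem integral_le_of_mul_le (S : SmallTransport Ω f ψ u ε M L) {h : E N → ℝ} {c : ℝ}
    (hc : 0 ≤ c) (h0 : ∀ x, 0 ≤ h x) (hh : ∀ x ∈ Ω, f x * h x ≤ c) :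
    ∫ x, h x ∂(densityMeasure Ω f) ≤ c * M := by
  have := S.isFiniteMeasure
  rw [S.integral_eq]
  calc ∫ x in Ω, f x * h x ≤ ∫ _x in Ω, c := by
        refine integral_mono_of_nonneg ?_ (integrable_const _) ?_ <;>
          refine (ae_restrict_iff' S.isOpen.measurableSet).2 (.of_forall fun x hx => ?_)
        · exact mul_nonneg (S.f_pos x hx).le (h0 x)
        · exact hh x hx
    _ = volume.real Ω * c := by simp
    _ ≤ c * M := by rw [mul_comm]; exact mul_le_mul_of_nonneg_left S.real_volume_le hc

/-- The pointwise Young inequality for the flux through the displaced density. -/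
theorem cutoff_mul_inner_le (S : SmallTransport Ω f ψ u ε M L) {t : ℝ}
    (ht : t ∈ Set.Icc (0 : ℝ) 1) {x : E N} (hx : x ∈ Ω) (W : E N) {a : ℝ} (ha : 0 < a) :
    f x * (cutoff (8 * M ^ 3 * ε ^ 2) (f x) * inner ℝ W (gradient ψ x)) ≤
      1 / (2 * a) * (‖W‖ ^ 2 * f (shift ψ (t * ε) x) *
        (ContinuousLinearMap.id ℝ (E N) + (t * ε) • hess ψ x).det)
      + a / 2 * (‖gradient ψ x‖ ^ 2 * ((1 + 14 * (L * ε)) * f x + 4 * M ^ 3 * ε ^ 2)) := by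
  have hy := S.mapsTo_shift ht hx
  have hfy := S.f_pos _ hy
  have hfx := S.f_pos x hx
  have hge := S.comp_shift_ge ht hx
  have hD := S.det_ge hx (S.mem_Icc ht)
  have hM := S.M_pos
  have hε := S.ε_pos
  have hL := S.L_pos
  have hs := S.small
  set y := shift ψ (t * ε) x
  set D := (ContinuousLinearMap.id ℝ (E N) + (t * ε) • hess ψ x).det
  set δ := L * ε with hδ
  have hδ0 : 0 < δ := mul_pos hL hε
  set m := M ^ 3 * ε ^ 2 with hm
  have hm0 : 0 < m := by positivity
  have hD0 : 0 < D := by linarith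
  rw [show 8 * M ^ 3 * ε ^ 2 = 8 * m by rw [hm]; ring,
    show 4 * M ^ 3 * ε ^ 2 = 4 * m by rw [hm]; ring]
  rw [show 2 * M ^ 3 * ε ^ 2 = 2 * m by rw [hm]; ring] at hge
  rcases le_or_gt (f x) (8 * m) with hle | hlt
  · rw [cutoff_eq_zero (by positivity) hle, zero_mul, mul_zero]
    positivity
  set q := f y * D with hq
  -- The possible loss in `q ≥ f x - e`: `6 δ` from the density, `δ` from the Jacobian, `2 m` from
  -- the Hessian error.
  set e := 7 * δ * f x + 2 * m with he
  have he0 : 0 < e := by positivity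
  have hqe : f x - e ≤ q := by
    have h1 : (1 - 6 * δ) * f x - 2 * m ≥ 0 := by nlinarith
    have h2 : ((1 - 6 * δ) * f x - 2 * m) * (1 - δ) ≤ f y * D :=
      mul_le_mul hge hD (by linarith) hfy.le
    nlinarith [mul_pos hδ0 (mul_pos hδ0 hfx), mul_pos hδ0 hm0]
  -- Here the threshold enters: `f x > 8 * m` and `δ ≤ 1 / 32` give `2 * e ≤ f x`. This yields `f² /
  -- q ≤ f + 2 e`, the source of the constants 14 and 4.
  have hq2 : f x / 2 ≤ q := by nlinarith
  have hq0 : 0 < q := by linarith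
  have hfq : f x ^ 2 / q ≤ f x + 2 * e := by
    rw [div_le_iff₀ hq0]
    nlinarith
  have hin : inner ℝ W (gradient ψ x) ≤ ‖W‖ * ‖gradient ψ x‖ := real_inner_le_norm _ _
  have h3 : cutoff (8 * m) (f x) * inner ℝ W (gradient ψ x) ≤ ‖W‖ * ‖gradient ψ x‖ := by
    have h4 := abs_real_inner_le_norm W (gradient ψ x)
    refine (le_abs_self _).trans ?_
    rw [abs_mul]
    exact (mul_le_of_le_one_left (abs_nonneg _) (abs_cutoff_le_one _ _)).trans h4
  calc f x * (cutoff (8 * m) (f x) * inner ℝ W (gradient ψ x))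
      ≤ f x * (‖W‖ * ‖gradient ψ x‖) := by gcongr
    _ ≤ 1 / (2 * a) * (‖W‖ ^ 2 * q) + a / 2 * (‖gradient ψ x‖ ^ 2 * (f x ^ 2 / q)) := by
        rw [← sub_nonneg]
        have : 1 / (2 * a) * (‖W‖ ^ 2 * q) + a / 2 * (‖gradient ψ x‖ ^ 2 * (f x ^ 2 / q))
            - f x * (‖W‖ * ‖gradient ψ x‖)
            = (q * ‖W‖ - a * f x * ‖gradient ψ x‖) ^ 2 / (2 * a * q) := by
          field_simp; ring
        rw [this]; positivity
    _ ≤ 1 / (2 * a) * (‖W‖ ^ 2 * q) + a / 2 * (‖gradient ψ x‖ ^ 2 * (f x + 2 * e)) := by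
        gcongr
    _ = _ := by rw [hq, he]; ring

theorem integrable_sq_mul_det (S : SmallTransport Ω f ψ u ε M L) (hw : IsBoundedC1 Ω w) {t : ℝ}
    (ht : t ∈ Set.Icc (0 : ℝ) 1) :
    Integrable (fun x => ‖gradient w (shift ψ (t * ε) x)‖ ^ 2 * f (shift ψ (t * ε) x) *
        (ContinuousLinearMap.id ℝ (E N) + (t * ε) • hess ψ x).det) (volume.restrict Ω) := by
  have := S.isFiniteMeasure
  obtain ⟨B, hB⟩ := hw.bdd
  obtain ⟨B', hB'⟩ := S.c1_f.bdd
  have hΩ := S.isOpen.measurableSet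
  have hcs : ContinuousOn (shift ψ (t * ε)) Ω := fun x hx =>
    (hasFDerivAt_shift (S.diff_ψ x hx) _).continuousAt.continuousWithinAt
  have m1 : AEStronglyMeasurable (fun x => f (shift ψ (t * ε) x)) (volume.restrict Ω) :=
    (S.c1_f.continuousOn.comp hcs fun x hx => S.mapsTo_shift ht hx).aestronglyMeasurable hΩ
  have m2 : Measurable fun x => ‖gradient w (shift ψ (t * ε) x)‖ ^ 2 :=
    ((measurable_gradient w).comp (measurable_shift ψ _)).norm.pow_const 2
  have m3 : Measurable fun x =>
      (ContinuousLinearMap.id ℝ (E N) + (t * ε) • hess ψ x).det := by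
    have h1 : Measurable (hess ψ) := measurable_fderiv ℝ (gradient ψ)
    exact ContinuousLinearMap.continuous_det.measurable.comp
      (measurable_const.add (h1.const_smul (t * ε)))
  refine Integrable.of_bound ((m2.aestronglyMeasurable.mul m1).mul m3.aestronglyMeasurable)
    (B ^ 2 * B' * 2) ((ae_restrict_iff' hΩ).2 (.of_forall fun x hx => ?_))
  have hy := S.mapsTo_shift ht hx
  have hB'0 : 0 ≤ B' := (abs_nonneg _).trans (hB' x hx).1
  rw [norm_mul, norm_mul, norm_pow, norm_norm]
  gcongr
  · exact (hB _ hy).2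
  · exact (hB' _ hy).1
  · have h1 := abs_le.1 (S.det x hx _ (S.mem_Icc ht))
    have := S.small
    rw [Real.norm_eq_abs, abs_le]
    constructor <;> linarith [h1.1, h1.2]

/-- Change of variables: the left side is the energy of `w` on the image of `Ω`, which lies in `Ω`.
-/
theorem integral_sq_mul_det_le (S : SmallTransport Ω f ψ u ε M L)
    [IsProbabilityMeasure (densityMeasure Ω f)] (hw : IsBoundedC1 Ω w)
    {t : ℝ} (ht : t ∈ Set.Icc (0 : ℝ) 1) :
    ∫ x in Ω, ‖gradient w (shift ψ (t * ε) x)‖ ^ 2 * f (shift ψ (t * ε) x) *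
        (ContinuousLinearMap.id ℝ (E N) + (t * ε) • hess ψ x).det
      ≤ ∫ x, ‖gradient w x‖ ^ 2 ∂(densityMeasure Ω f) := by
  have := S.isFiniteMeasure
  have hΩ := S.isOpen.measurableSet
  have hi := S.integrable_sq_mul_det hw ht
  have hi0 : Integrable (fun x => ‖gradient w x‖ ^ 2 * f x) (volume.restrict Ω) := by
    have := S.integrable_sq_mul_det hw (t := 0) (by simp)
    refine this.congr (.of_forall fun x => ?_)
    simp [shift, ContinuousLinearMap.det]
  rw [S.integral_eq, ← ENNReal.ofReal_le_ofReal_iff, ofReal_integral_eq_lintegral_ofReal hi,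
    ofReal_integral_eq_lintegral_ofReal (by simpa only [mul_comm] using hi0)]
  · refine le_trans (le_of_eq ?_) (S.lintegral_det_mul_comp_shift_le (S.mem_Icc ht)
      (fun x hx => S.mapsTo_shift ht hx) fun y => ENNReal.ofReal (f y * ‖gradient w y‖ ^ 2))
    refine setLIntegral_congr_fun hΩ fun x hx => ?_
    rw [← ENNReal.ofReal_mul (by linarith [S.det_ge hx (S.mem_Icc ht), S.small])]
    congr 1; ring
  · exact (ae_restrict_iff' hΩ).2 (.of_forall fun x hx =>
      mul_nonneg (S.f_pos x hx).le (sq_nonneg _))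
  · refine (ae_restrict_iff' hΩ).2 (.of_forall fun x hx => ?_)
    exact mul_nonneg (mul_nonneg (sq_nonneg _) (S.f_pos _ (S.mapsTo_shift ht hx)).le)
      (by linarith [S.det_ge hx (S.mem_Icc ht), S.small])
  · exact integral_nonneg_of_ae ((ae_restrict_iff' hΩ).2 (.of_forall fun x hx =>
      mul_nonneg (S.f_pos x hx).le (sq_nonneg _)))

theorem aestronglyMeasurable_cutoff (S : SmallTransport Ω f ψ u ε M L) (κ : ℝ) :
    AEStronglyMeasurable (fun x => cutoff κ (f x)) (densityMeasure Ω f) :=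
  (((continuous_cutoff κ).comp_continuousOn S.c1_f.continuousOn).aestronglyMeasurable
    S.isOpen.measurableSet).mono_ac (densityMeasure_absolutelyContinuous Ω f)

/-- The pointwise Young inequality, integrated with `a = R⁻¹`, where `R` is the right side. The
first integral is at most 1 and the second at most `R ^ 2`, which balances to `R`. Completing the
square keeps the coefficient of `P` equal to one. -/
theorem integral_cutoff_mul_inner_le (S : SmallTransport Ω f ψ u ε M L)
    [IsProbabilityMeasure (densityMeasure Ω f)] (hw : IsBoundedC1 Ω w)
    (hw1 : ∫ x, ‖gradient w x‖ ^ 2 ∂(densityMeasure Ω f) = 1)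
    {t : ℝ} (ht : t ∈ Set.Icc (0 : ℝ) 1) :
    ∫ x, cutoff (8 * M ^ 3 * ε ^ 2) (f x) *
        inner ℝ (gradient w (shift ψ (t * ε) x)) (gradient ψ x) ∂(densityMeasure Ω f)
      ≤ hOneNorm (densityMeasure Ω f) ψ + (7 * L * M + 2 * M ^ 3) * ε := by
  have := S.isFiniteMeasure
  have hΩ := S.isOpen.measurableSet
  have hM := S.M_pos
  have hε := S.ε_pos
  have hL := S.L_pos
  set P := hOneNorm (densityMeasure Ω f) ψ with hP
  have hP0 : 0 ≤ P := Real.sqrt_nonneg _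
  have hPM : P ≤ M := S.hOneNorm_le
  have hP2 : ∫ x in Ω, f x * ‖gradient ψ x‖ ^ 2 = P ^ 2 := by
    rw [← S.integral_eq, hP, hOneNorm, Real.sq_sqrt (integral_nonneg fun x => sq_nonneg _)]
  obtain ⟨Bw, hBw⟩ := hw.bdd
  obtain ⟨Bf, hBf⟩ := S.c1_f.bdd
  have i1 := S.integrable_sq_mul_det hw ht
  have i2 : Integrable (fun x => ‖gradient ψ x‖ ^ 2) (volume.restrict Ω) :=
    S.c1_ψ.integrable_gradient_sq S.isOpen .rfl
  have i3 : Integrable (fun x => f x * ‖gradient ψ x‖ ^ 2) (volume.restrict Ω) := by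
    refine i2.bdd_mul (c := Bf) (S.c1_f.continuousOn.aestronglyMeasurable hΩ)
      ((ae_restrict_iff' hΩ).2 (.of_forall fun x hx => (hBf x hx).1))
  have i4 : Integrable (fun x => ‖gradient ψ x‖ ^ 2 *
      ((1 + 14 * (L * ε)) * f x + 4 * M ^ 3 * ε ^ 2)) (volume.restrict Ω) := by
    refine ((i3.const_mul (1 + 14 * (L * ε))).add (i2.const_mul (4 * M ^ 3 * ε ^ 2))).congr
      (.of_forall fun x => ?_)
    simp only [Pi.add_apply]; ring
  have e4 : ∫ x in Ω, ‖gradient ψ x‖ ^ 2 * ((1 + 14 * (L * ε)) * f x + 4 * M ^ 3 * ε ^ 2)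
      ≤ (P + (7 * L * M + 2 * M ^ 3) * ε) ^ 2 := by
    have h1 : ∀ x, ‖gradient ψ x‖ ^ 2 * ((1 + 14 * (L * ε)) * f x + 4 * M ^ 3 * ε ^ 2)
        = (1 + 14 * (L * ε)) * (f x * ‖gradient ψ x‖ ^ 2)
          + (4 * M ^ 3 * ε ^ 2) * ‖gradient ψ x‖ ^ 2 := fun x => by ring
    simp only [h1]
    rw [integral_add (i3.const_mul _) (i2.const_mul _), integral_const_mul, integral_const_mul,
      hP2]
    have h2 : ∫ x in Ω, ‖gradient ψ x‖ ^ 2 ≤ M ^ 2 * M := by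
      calc ∫ x in Ω, ‖gradient ψ x‖ ^ 2 ≤ ∫ _x in Ω, M ^ 2 :=
            setIntegral_mono_on i2 (integrable_const _) hΩ fun x hx =>
              pow_le_pow_left₀ (norm_nonneg _) (S.grad_ψ x hx) 2
        _ = volume.real Ω * M ^ 2 := by simp
        _ ≤ M ^ 2 * M := by
            rw [mul_comm]; exact mul_le_mul_of_nonneg_left S.real_volume_le (by positivity)
    have h3 : 4 * M ^ 3 * ε ^ 2 * ∫ x in Ω, ‖gradient ψ x‖ ^ 2
        ≤ 4 * M ^ 3 * ε ^ 2 * (M ^ 2 * M) := by gcongr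
    have h4 : 14 * (L * ε) * (P * P) ≤ 14 * (L * ε) * (M * P) := by gcongr
    have h5 : 0 ≤ L * M * M ^ 3 * ε ^ 2 := by positivity
    have h6 : 0 ≤ P * M ^ 3 * ε := by positivity
    have h7 : 0 ≤ (L * M * ε) ^ 2 := by positivity
    nlinarith
  set R := P + (7 * L * M + 2 * M ^ 3) * ε with hR
  have hR0 : 0 < R := by positivity
  have e1 := S.integral_sq_mul_det_le hw ht
  rw [hw1] at e1
  have hml : AEStronglyMeasurable (fun x => f x * (cutoff (8 * M ^ 3 * ε ^ 2) (f x) *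
      inner ℝ (gradient w (shift ψ (t * ε) x)) (gradient ψ x))) (volume.restrict Ω) := by
    refine (S.c1_f.continuousOn.aestronglyMeasurable hΩ).mul
      ((((continuous_cutoff _).comp_continuousOn S.c1_f.continuousOn).aestronglyMeasurable hΩ).mul
      (Measurable.aestronglyMeasurable ?_))
    exact ((measurable_gradient w).comp (measurable_shift ψ _)).inner (measurable_gradient ψ)
  have hil : Integrable (fun x => f x * (cutoff (8 * M ^ 3 * ε ^ 2) (f x) *
      inner ℝ (gradient w (shift ψ (t * ε) x)) (gradient ψ x))) (volume.restrict Ω) := by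
    refine Integrable.of_bound hml (Bf * (1 * (Bw * M)))
      ((ae_restrict_iff' hΩ).2 (.of_forall fun x hx => ?_))
    have hy := S.mapsTo_shift ht hx
    have hBf0 : 0 ≤ Bf := (abs_nonneg _).trans (hBf x hx).1
    rw [norm_mul, norm_mul]
    gcongr
    · exact (hBf x hx).1
    · exact abs_cutoff_le_one _ _
    · refine (norm_inner_le_norm _ _).trans ?_
      have hBw0 : 0 ≤ Bw := (norm_nonneg _).trans (hBw x hx).2
      gcongr
      · exact (hBw _ hy).2
      · exact S.grad_ψ x hx
  have i5 : Integrable (fun x => 1 / (2 * R⁻¹) * (‖gradient w (shift ψ (t * ε) x)‖ ^ 2 *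
      f (shift ψ (t * ε) x) * (ContinuousLinearMap.id ℝ (E N) + (t * ε) • hess ψ x).det)
      + R⁻¹ / 2 * (‖gradient ψ x‖ ^ 2 * ((1 + 14 * (L * ε)) * f x + 4 * M ^ 3 * ε ^ 2)))
      (volume.restrict Ω) := (i1.const_mul _).add (i4.const_mul _)
  rw [S.integral_eq]
  calc ∫ x in Ω, f x * (cutoff (8 * M ^ 3 * ε ^ 2) (f x) *
        inner ℝ (gradient w (shift ψ (t * ε) x)) (gradient ψ x))
      ≤ ∫ x in Ω, (1 / (2 * R⁻¹) * (‖gradient w (shift ψ (t * ε) x)‖ ^ 2 *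
          f (shift ψ (t * ε) x) * (ContinuousLinearMap.id ℝ (E N) + (t * ε) • hess ψ x).det)
        + R⁻¹ / 2 * (‖gradient ψ x‖ ^ 2 *
          ((1 + 14 * (L * ε)) * f x + 4 * M ^ 3 * ε ^ 2))) :=
        setIntegral_mono_on hil i5 hΩ fun x hx =>
          S.cutoff_mul_inner_le ht hx _ (inv_pos.2 hR0)
    _ ≤ 1 / (2 * R⁻¹) * 1 + R⁻¹ / 2 * R ^ 2 := by
        rw [integral_add (i1.const_mul _) (i4.const_mul _), integral_const_mul, integral_const_mul]
        gcongr
    _ = R := by field_simp; ring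

/-- The flux of the cut-off density along the displacement. -/
theorem integral_cutoff_mul_sub_le (S : SmallTransport Ω f ψ u ε M L)
    [IsProbabilityMeasure (densityMeasure Ω f)] (hw : IsBoundedC1 Ω w)
    (hw1 : ∫ x, ‖gradient w x‖ ^ 2 ∂(densityMeasure Ω f) = 1) :
    ∫ x, cutoff (8 * M ^ 3 * ε ^ 2) (f x) * (w (shift ψ ε x) - w x) ∂(densityMeasure Ω f)
      ≤ ε * (hOneNorm (densityMeasure Ω f) ψ + (7 * L * M + 2 * M ^ 3) * ε) := by
  set μ := densityMeasure Ω f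
  set χ : E N → ℝ := fun x => cutoff (8 * M ^ 3 * ε ^ 2) (f x) with hχ
  set R := hOneNorm μ ψ + (7 * L * M + 2 * M ^ 3) * ε
  have hε := S.ε_pos
  -- `ε * I x t` is the cutoff at `x` times the derivative of `w` along the displacement. The cutoff
  -- stays frozen at the starting point, and Fubini reduces the estimate to fixed `t`.
  set I : E N → ℝ → ℝ := fun x t =>
    χ x * inner ℝ (gradient w (shift ψ (t * ε) x)) (gradient ψ x) with hI
  have hmem : ∀ᵐ x ∂μ, x ∈ Ω := ae_densityMeasure_mem S.isOpen f
  have hincr : ∀ x ∈ Ω, χ x * (w (shift ψ ε x) - w x) = ε * ∫ t in Set.Ioc (0 : ℝ) 1, I x t := by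
    intro x hx
    have hseg : ∀ t ∈ Set.Icc (0 : ℝ) 1, x + t • (ε • gradient ψ x) ∈ Ω := fun t ht => by
      rw [smul_smul]; exact S.mapsTo_shift ht hx
    have h1 := hw.sub_eq_integral hseg
    rw [intervalIntegral.integral_of_le zero_le_one] at h1
    have h2 : shift ψ ε x = x + ε • gradient ψ x := rfl
    rw [h2, h1, ← integral_const_mul, ← integral_const_mul]
    refine integral_congr_ae (.of_forall fun t => ?_)
    simp only [hI, shift, inner_smul_right, smul_smul]
    ring
  obtain ⟨Bw, hBw⟩ := hw.bdd
  have hIint : Integrable (Function.uncurry I) (μ.prod (volume.restrict (Set.Ioc (0 : ℝ) 1))) := by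
    have hm : Measurable fun p : E N × ℝ => shift ψ (p.2 * ε) p.1 := by
      have := (measurable_gradient ψ)
      unfold shift
      fun_prop
    refine Integrable.of_bound ((S.aestronglyMeasurable_cutoff _).comp_fst.mul
      (Measurable.aestronglyMeasurable
        (((measurable_gradient w).comp hm).inner ((measurable_gradient ψ).comp measurable_fst))))
      (1 * (Bw * M)) ?_
    filter_upwards [Measure.quasiMeasurePreserving_fst.ae hmem,
      Measure.quasiMeasurePreserving_snd.ae (ae_restrict_mem measurableSet_Ioc)] with p hp1 hp2
    have hy := S.mapsTo_shift (Set.Ioc_subset_Icc_self hp2) hp1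
    have hBw0 : 0 ≤ Bw := (norm_nonneg _).trans (hBw _ hy).2
    change ‖χ p.1 * inner ℝ (gradient w (shift ψ (p.2 * ε) p.1)) (gradient ψ p.1)‖ ≤ _
    rw [norm_mul]
    refine mul_le_mul (abs_cutoff_le_one _ _) ?_ (norm_nonneg _) zero_le_one
    refine (norm_inner_le_norm _ _).trans ?_
    gcongr
    · exact (hBw _ hy).2
    · exact S.grad_ψ _ hp1
  calc ∫ x, χ x * (w (shift ψ ε x) - w x) ∂μ
      = ∫ x, (ε * ∫ t in Set.Ioc (0 : ℝ) 1, I x t) ∂μ := by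
        refine integral_congr_ae ?_
        filter_upwards [hmem] with x hx using hincr x hx
    _ = ε * ∫ t in Set.Ioc (0 : ℝ) 1, (∫ x, I x t ∂μ) := by
        rw [integral_const_mul, integral_integral_swap hIint]
    _ ≤ ε * ∫ _t in Set.Ioc (0 : ℝ) 1, R := by
        gcongr ε * ?_
        refine setIntegral_mono_on hIint.integral_prod_right (integrable_const _)
          measurableSet_Ioc fun t ht => ?_
        exact S.integral_cutoff_mul_inner_le hw hw1 (Set.Ioc_subset_Icc_self ht)
    _ = ε * R := by simp

/-- The left side is the integral of `w²` against ν, whose density `1 + ε u` with respect to μ is at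
most 2. -/
theorem integral_sq_comp_shift_le (S : SmallTransport Ω f ψ u ε M L)
    [IsProbabilityMeasure (densityMeasure Ω f)]
    [IsProbabilityMeasure (densityMeasure Ω (perturbed ε f u))] (hw : IsBoundedC1 Ω w) :
    ∫ x, w (shift ψ ε x) ^ 2 ∂(densityMeasure Ω f) ≤ 2 * ∫ x, w x ^ 2 ∂(densityMeasure Ω f) := by
  have hi := hw.integrable_sq S.isOpen (densityMeasure_absolutelyContinuous Ω (perturbed ε f u))
  have hi' := hw.integrable_sq S.isOpen (densityMeasure_absolutelyContinuous Ω f)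
  rw [S.integral_comp_shift (h := fun x => w x ^ 2) hi.aestronglyMeasurable,
    integral_perturbed S.isOpen S.c1_f.continuousOn S.c1_u.continuousOn
      (fun x hx => (S.f_pos x hx).le) S.g_nonneg, ← integral_const_mul]
  refine integral_mono_of_nonneg ?_ (hi'.const_mul 2) ?_ <;>
    filter_upwards [ae_densityMeasure_mem S.isOpen f] with x hx
  · exact mul_nonneg (nonneg_of_mul_nonneg_left (S.g_nonneg x hx) (S.f_pos x hx)) (sq_nonneg _)
  · have h1 := (abs_le.1 (S.abs_u x hx)).2
    have h2 := S.small'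
    have := mul_le_mul_of_nonneg_left h1 S.ε_pos.le
    exact mul_le_mul_of_nonneg_right (by linarith) (sq_nonneg _)

/-- The error from moving the cutoff. Where `f ≥ 4 κ` both cutoffs are one; elsewhere the relative
variation of `f` bounds their difference by `24 L ε`. As `κ` is of order `ε²`, its square has
integral `O(ε⁴)`. -/
theorem integral_comp_mul_cutoff_sub_le (S : SmallTransport Ω f ψ u ε M L)
    [IsProbabilityMeasure (densityMeasure Ω f)]
    [IsProbabilityMeasure (densityMeasure Ω (perturbed ε f u))] (hw : IsBoundedC1 Ω w)
    (hw2 : ∫ x, w x ^ 2 ∂(densityMeasure Ω f) ≤ M) :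
    ∫ x, w (shift ψ ε x) * (cutoff (8 * M ^ 3 * ε ^ 2) (f (shift ψ ε x))
        - cutoff (8 * M ^ 3 * ε ^ 2) (f x)) ∂(densityMeasure Ω f)
      ≤ ε * ((M + 9216 * L ^ 2 * M ^ 4) * ε) := by
  set μ := densityMeasure Ω f
  have hM := S.M_pos
  have hε := S.ε_pos
  have hL := S.L_pos
  have hs := S.small
  set κ := 8 * M ^ 3 * ε ^ 2 with hκ
  have hκ0 : 0 < κ := by positivity
  have hmem : ∀ᵐ x ∂μ, x ∈ Ω := ae_densityMeasure_mem S.isOpen f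
  have hac := densityMeasure_absolutelyContinuous Ω f
  have hac' := densityMeasure_absolutelyContinuous Ω (perturbed ε f u)
  set d : E N → ℝ := fun x => cutoff κ (f (shift ψ ε x)) - cutoff κ (f x) with hd
  have hcν : Integrable (fun x => cutoff κ (f x)) (densityMeasure Ω (perturbed ε f u)) :=
    integrable_of_continuousOn S.isOpen hac'
      ((continuous_cutoff κ).comp_continuousOn S.c1_f.continuousOn)
      fun x _ => abs_cutoff_le_one κ (f x)
  have hdm : AEStronglyMeasurable d μ :=
    (S.integrable_comp_shift hcν).aestronglyMeasurable.sub (S.aestronglyMeasurable_cutoff κ)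
  have hdb : ∀ x, |d x| ≤ 1 := by
    intro x
    have := cutoff_nonneg κ (f x); have := cutoff_le_one κ (f x)
    have := cutoff_nonneg κ (f (shift ψ ε x)); have := cutoff_le_one κ (f (shift ψ ε x))
    rw [abs_le]; constructor <;> simp only [hd] <;> linarith
  have hd2 : ∀ x ∈ Ω, f x * d x ^ 2 ≤ 2304 * (L * ε) ^ 2 * κ := by
    intro x hx
    have hfx := S.f_pos x hx
    have h1 := S.abs_comp_shift_sub_le hx
    have hδ : 0 < L * ε := mul_pos hL hε
    rcases le_or_gt (4 * κ) (f x) with h | h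
    · have h2 := (abs_le.1 h1).1
      have h3 : 2 * κ ≤ f (shift ψ ε x) := by nlinarith
      have h4 : d x = 0 := by
        simp only [hd]
        rw [cutoff_eq_one hκ0 h3, cutoff_eq_one hκ0 (by linarith), sub_self]
      rw [h4]; simp only [ne_eq, OfNat.ofNat_ne_zero, not_false_eq_true, zero_pow, mul_zero]
      positivity
    · have h2 : |d x| ≤ 24 * (L * ε) := by
        refine (abs_cutoff_sub_le hκ0 _ _).trans ?_
        rw [div_le_iff₀ hκ0]
        refine h1.trans ?_
        nlinarith
      have h3 : d x ^ 2 ≤ (24 * (L * ε)) ^ 2 := by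
        rw [← sq_abs]; exact pow_le_pow_left₀ (abs_nonneg _) h2 2
      calc f x * d x ^ 2 ≤ (4 * κ) * (24 * (L * ε)) ^ 2 := by gcongr
        _ = _ := by ring
  have hd3 : ∫ x, d x ^ 2 ∂μ ≤ 2304 * (L * ε) ^ 2 * κ * M :=
    S.integral_le_of_mul_le (by positivity) (fun x => sq_nonneg _) hd2
  have hid : Integrable (fun x => d x ^ 2) μ := by
    refine Integrable.of_bound (hdm.pow 2) 1 (.of_forall fun x => ?_)
    rw [norm_pow]; exact pow_le_one₀ (norm_nonneg _) (hdb x)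
  have hiw1 : Integrable (fun x => w (shift ψ ε x)) μ :=
    S.integrable_comp_shift (hw.integrable S.isOpen hac')
  have hiw : Integrable (fun x => w (shift ψ ε x) ^ 2) μ :=
    S.integrable_comp_shift (h := fun x => w x ^ 2) (hw.integrable_sq S.isOpen hac')
  have hiwd : Integrable (fun x => w (shift ψ ε x) * d x) μ :=
    hiw1.mul_bdd (c := 1) hdm (.of_forall hdb)
  calc ∫ x, w (shift ψ ε x) * d x ∂μ
      -- The weight `ε²` balances the bounded norm of `w` against the `O(ε⁴)` integral of `d²`.
      ≤ ∫ x, (ε ^ 2 / 2 * w (shift ψ ε x) ^ 2 + 1 / (2 * ε ^ 2) * d x ^ 2) ∂μ := by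
        refine integral_mono hiwd ((hiw.const_mul _).add (hid.const_mul _)) fun x => ?_
        rw [← sub_nonneg]
        have : ε ^ 2 / 2 * w (shift ψ ε x) ^ 2 + 1 / (2 * ε ^ 2) * d x ^ 2
            - w (shift ψ ε x) * d x = (ε ^ 2 * w (shift ψ ε x) - d x) ^ 2 / (2 * ε ^ 2) := by
          field_simp; ring
        simp only
        rw [this]; positivity
    _ ≤ ε ^ 2 / 2 * (2 * M) + 1 / (2 * ε ^ 2) * (2304 * (L * ε) ^ 2 * κ * M) := by
        rw [integral_add (hiw.const_mul _) (hid.const_mul _), integral_const_mul,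
          integral_const_mul]
        have := S.integral_sq_comp_shift_le hw
        gcongr
        linarith
    _ = _ := by rw [hκ]; field_simp; ring

/-- The discarded part lives where `f < 2 κ`. There the μ-mass is at most `2 κ M = O(ε²)`, so
Young's inequality with weight `ε` suffices. -/
theorem integral_mul_one_sub_cutoff_le (S : SmallTransport Ω f ψ u ε M L)
    [IsProbabilityMeasure (densityMeasure Ω f)] (hw : IsBoundedC1 Ω w)
    (hw2 : ∫ x, w x ^ 2 ∂(densityMeasure Ω f) ≤ M) :
    ∫ x, u x * ((1 - cutoff (8 * M ^ 3 * ε ^ 2) (f x)) * w x) ∂(densityMeasure Ω f)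
      ≤ (M ^ 2 / 2 + 8 * M ^ 5) * ε := by
  set μ := densityMeasure Ω f
  have hM := S.M_pos
  have hε := S.ε_pos
  set κ := 8 * M ^ 3 * ε ^ 2 with hκ
  have hκ0 : 0 < κ := by positivity
  have hac := densityMeasure_absolutelyContinuous Ω f
  set c : E N → ℝ := fun x => 1 - cutoff κ (f x) with hc
  have hcm : AEStronglyMeasurable c μ :=
    aestronglyMeasurable_const.sub (S.aestronglyMeasurable_cutoff κ)
  have hcb : ∀ x, |c x| ≤ 1 := by
    intro x
    have := cutoff_nonneg κ (f x); have := cutoff_le_one κ (f x)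
    rw [abs_le]; constructor <;> simp only [hc] <;> linarith
  have hc2 : ∀ x ∈ Ω, f x * c x ^ 2 ≤ 2 * κ := by
    intro x hx
    have hfx := S.f_pos x hx
    rcases le_or_gt (2 * κ) (f x) with h | h
    · have : c x = 0 := by simp only [hc]; rw [cutoff_eq_one hκ0 h, sub_self]
      rw [this]; simp only [ne_eq, OfNat.ofNat_ne_zero, not_false_eq_true, zero_pow, mul_zero]
      positivity
    · have : c x ^ 2 ≤ 1 := by rw [← sq_abs]; exact pow_le_one₀ (abs_nonneg _) (hcb x)
      nlinarith
  have hc3 : ∫ x, c x ^ 2 ∂μ ≤ 2 * κ * M :=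
    S.integral_le_of_mul_le (by positivity) (fun x => sq_nonneg _) hc2
  have hic : Integrable (fun x => c x ^ 2) μ := by
    refine Integrable.of_bound (hcm.pow 2) 1 (.of_forall fun x => ?_)
    rw [norm_pow]; exact pow_le_one₀ (norm_nonneg _) (hcb x)
  have hiw := hw.integrable_sq S.isOpen hac
  have hil : Integrable (fun x => u x * (c x * w x)) μ := by
    have h1 : Integrable (fun x => c x * w x) μ :=
      (hw.integrable S.isOpen hac).bdd_mul (c := 1) hcm (.of_forall hcb)
    refine h1.bdd_mul (c := M) (S.c1_u.integrable S.isOpen hac).aestronglyMeasurable ?_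
    filter_upwards [ae_densityMeasure_mem S.isOpen f] with x hx using S.abs_u x hx
  calc ∫ x, u x * (c x * w x) ∂μ
      ≤ ∫ x, (M * ε / 2 * w x ^ 2 + M / (2 * ε) * c x ^ 2) ∂μ := by
        refine integral_mono_ae hil ((hiw.const_mul _).add (hic.const_mul _)) ?_
        filter_upwards [ae_densityMeasure_mem S.isOpen f] with x hx
        calc u x * (c x * w x) ≤ |u x| * |c x * w x| := by
              rw [← abs_mul]; exact le_abs_self _
          _ ≤ M * |c x * w x| := by gcongr; exact S.abs_u x hx
          _ ≤ M * (ε / 2 * w x ^ 2 + 1 / (2 * ε) * c x ^ 2) := by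
              gcongr
              rw [abs_mul, ← sq_abs (w x), ← sq_abs (c x), ← sub_nonneg]
              have : ε / 2 * |w x| ^ 2 + 1 / (2 * ε) * |c x| ^ 2 - |c x| * |w x|
                  = (ε * |w x| - |c x|) ^ 2 / (2 * ε) := by
                field_simp; ring
              rw [this]; positivity
          _ = _ := by ring
    _ ≤ M * ε / 2 * M + M / (2 * ε) * (2 * κ * M) := by
        rw [integral_add (hiw.const_mul _) (hic.const_mul _), integral_const_mul,
          integral_const_mul]
        gcongr
    _ = _ := by rw [hκ]; field_simp

/-- The dual estimate of the perturbation by the displacement. -/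
theorem integral_mul_le (S : SmallTransport Ω f ψ u ε M L)
    [IsProbabilityMeasure (densityMeasure Ω f)]
    [IsProbabilityMeasure (densityMeasure Ω (perturbed ε f u))] (hw : IsBoundedC1 Ω w)
    (hw1 : ∫ x, ‖gradient w x‖ ^ 2 ∂(densityMeasure Ω f) = 1)
    (hw2 : ∫ x, w x ^ 2 ∂(densityMeasure Ω f) ≤ M) :
    ∫ x, u x * w x ∂(densityMeasure Ω f) ≤ hOneNorm (densityMeasure Ω f) ψ
      + ((7 * L * M + 2 * M ^ 3) + (M + 9216 * L ^ 2 * M ^ 4) + (M ^ 2 / 2 + 8 * M ^ 5)) * ε := by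
  set μ := densityMeasure Ω f
  have hε := S.ε_pos
  set κ := 8 * M ^ 3 * ε ^ 2 with hκ
  have hac := densityMeasure_absolutelyContinuous Ω f
  have hac' := densityMeasure_absolutelyContinuous Ω (perturbed ε f u)
  obtain ⟨B, hB⟩ := hw.bdd
  have hcc : ContinuousOn (fun x => cutoff κ (f x)) Ω :=
    (continuous_cutoff κ).comp_continuousOn S.c1_f.continuousOn
  have hcw : ContinuousOn (fun x => cutoff κ (f x) * w x) Ω := hcc.mul hw.continuousOn
  have hcwb : ∀ x ∈ Ω, |cutoff κ (f x) * w x| ≤ 1 * B := fun x hx => by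
    rw [abs_mul]
    exact mul_le_mul (abs_cutoff_le_one _ _) (hB x hx).1 (abs_nonneg _) zero_le_one
  have h1 := S.mul_integral_mul_eq hcw hcwb
  have hum := (S.c1_u.integrable S.isOpen hac).aestronglyMeasurable
  have hub : ∀ᵐ x ∂μ, ‖u x‖ ≤ M := by
    filter_upwards [ae_densityMeasure_mem S.isOpen f] with x hx using S.abs_u x hx
  have hiw : Integrable w μ := hw.integrable S.isOpen hac
  have hicw : Integrable (fun x => cutoff κ (f x) * w x) μ :=
    integrable_of_continuousOn S.isOpen hac hcw hcwb
  have i1 : Integrable (fun x => u x * (cutoff κ (f x) * w x)) μ := hicw.bdd_mul hum hub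
  have i2 : Integrable (fun x => u x * ((1 - cutoff κ (f x)) * w x)) μ := by
    refine ((hiw.bdd_mul hum hub).sub i1).congr (.of_forall fun x => ?_)
    simp only [Pi.sub_apply]; ring
  have hsplit : ∫ x, u x * w x ∂μ = ∫ x, u x * (cutoff κ (f x) * w x) ∂μ
      + ∫ x, u x * ((1 - cutoff κ (f x)) * w x) ∂μ := by
    rw [← integral_add i1 i2]
    congr 1; ext x; ring
  have hiwT : Integrable (fun x => w (shift ψ ε x)) μ :=
    S.integrable_comp_shift (hw.integrable S.isOpen hac')
  have hiwd : Integrable (fun x => w (shift ψ ε x) - w x) μ := hiwT.sub hiw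
  have i3 : Integrable (fun x => cutoff κ (f x) * (w (shift ψ ε x) - w x)) μ :=
    hiwd.bdd_mul (c := 1) (S.aestronglyMeasurable_cutoff κ)
      (.of_forall fun x => abs_cutoff_le_one _ _)
  have hicwT : Integrable (fun x => cutoff κ (f (shift ψ ε x)) * w (shift ψ ε x)) μ :=
    S.integrable_comp_shift (h := fun x => cutoff κ (f x) * w x)
      (integrable_of_continuousOn S.isOpen hac' hcw hcwb)
  have i4 : Integrable (fun x => w (shift ψ ε x) *
      (cutoff κ (f (shift ψ ε x)) - cutoff κ (f x))) μ := by
    refine ((hicwT.sub hicw).sub i3).congr (.of_forall fun x => ?_)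
    simp only [Pi.sub_apply]; ring
  -- Discrete product rule: the first term is the flux, the second the variation of the cutoff.
  have hsplit' : ∫ x, (cutoff κ (f (shift ψ ε x)) * w (shift ψ ε x) - cutoff κ (f x) * w x) ∂μ
      = ∫ x, cutoff κ (f x) * (w (shift ψ ε x) - w x) ∂μ
        + ∫ x, w (shift ψ ε x) * (cutoff κ (f (shift ψ ε x)) - cutoff κ (f x)) ∂μ := by
    rw [← integral_add i3 i4]
    congr 1; ext x; ring
  rw [hsplit'] at h1
  have h2 := S.integral_cutoff_mul_sub_le hw hw1
  have h3 := S.integral_comp_mul_cutoff_sub_le hw hw2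
  have h4 := S.integral_mul_one_sub_cutoff_le hw hw2
  have h5 : ∫ x, u x * (cutoff κ (f x) * w x) ∂μ ≤
      hOneNorm μ ψ + (7 * L * M + 2 * M ^ 3) * ε + (M + 9216 * L ^ 2 * M ^ 4) * ε := by
    refine le_of_mul_le_mul_left ?_ hε
    rw [h1]
    linarith
  rw [hsplit]
  linarith

end SmallTransport

end W2Lin

/-! ### Assembly: small `ε`, then all `ε` -/

namespace W2Lin

variable {N : ℕ} {Ω : Set (E N)} {f ψ u h : E N → ℝ} {M ε lam : ℝ}

theorem differentiableAt_gradient (ho : IsOpen Ω) (hh : ContDiffOn ℝ ∞ h (closure Ω)) {x : E N}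
    (hx : x ∈ Ω) : DifferentiableAt ℝ (gradient h) x := by
  have h1 : ContDiffAt ℝ ∞ h x := hh.contDiffAt (mem_nhds_closure ho hx)
  have h2 : DifferentiableAt ℝ (fderiv ℝ h) x :=
    (h1.fderiv_right (m := ∞) (by simp)).differentiableAt (by simp)
  exact (InnerProductSpace.toDual ℝ (E N)).symm.toContinuousLinearEquiv.differentiableAt.comp x h2

/-- The choice `L = M + K * M` dominates both `M` and the determinant constant. The factor in front
of `ε ^ 2` adds the errors of the lower and the upper bound for the dual norm. -/
theorem abs_W2_sub_le_of_small {K r : ℝ} (hK : 0 ≤ K)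
    (hdet : ∀ B : E N →L[ℝ] E N, ‖B‖ ≤ r →
      |(ContinuousLinearMap.id ℝ (E N) + B).det - 1| ≤ K * ‖B‖)
    (ho : IsOpen Ω) (hn : Ω.Nonempty) (hc : Convex ℝ Ω) (hb : Bornology.IsBounded Ω)
    (hf : ContDiffOn ℝ ∞ f (closure Ω)) (hψ : ContDiffOn ℝ ∞ ψ (closure Ω))
    (hu : ContDiffOn ℝ ∞ u (closure Ω)) (hε : 0 < ε) (hpos : ∀ x ∈ closure Ω, 0 < f x)
    (hg0 : ∀ x ∈ Ω, 0 ≤ perturbed ε f u x)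
    [IsProbabilityMeasure (densityMeasure Ω f)]
    [IsProbabilityMeasure (densityMeasure Ω (perturbed ε f u))]
    (hMA : SolvesMongeAmpere Ω f (perturbed ε f u) (potential ε ψ))
    (hlam : IsLambdaOne Ω f lam)
    (hbd : ∀ x ∈ Ω, ‖gradient f x‖ ≤ M ∧ ‖hess f x‖ ≤ M ∧
        ‖gradient ψ x‖ ≤ M ∧ ‖hess ψ x‖ ≤ M ∧ |u x| ≤ M ∧ ‖gradient u x‖ ≤ M)
    (hvol : volume Ω ≤ ENNReal.ofReal M) (hlM : lam⁻¹ ≤ M)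
    (hr : M * ε ≤ r) (hsmall : (M + K * M) * ε ≤ 1 / 32)
    (hba : BddAbove (hMinusOnePairings Ω f u)) :
    |W2 (densityMeasure Ω f) (densityMeasure Ω (perturbed ε f u)) - ε * hMinusOneNorm Ω f u|
      ≤ (M ^ 2 + ((7 * (M + K * M) * M + 2 * M ^ 3) + (M + 9216 * (M + K * M) ^ 2 * M ^ 4)
        + (M ^ 2 / 2 + 8 * M ^ 5))) * ε ^ 2 := by
  have hM : 0 < M := (inv_pos.2 hlam.1.1).trans_le hlM
  have h1inf : (1 : WithTop ℕ∞) ≤ ∞ := by exact_mod_cast le_top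
  have hfb := isBoundedC1_of_contDiffOn ho hn hc hb (hf.of_le h1inf)
  have hψb := isBoundedC1_of_contDiffOn ho hn hc hb (hψ.of_le h1inf)
  have hub := isBoundedC1_of_contDiffOn ho hn hc hb (hu.of_le h1inf)
  have hdψ := fun x (hx : x ∈ Ω) => differentiableAt_gradient ho hψ hx
  have S : SmallTransport Ω f ψ u ε M (M + K * M) :=
    { isOpen := ho
      convex := hc
      bounded := hb
      c1_f := hfb
      c1_ψ := hψb
      c1_u := hub
      diff_f := fun x hx => differentiableAt_gradient ho hf hx
      diff_ψ := hdψ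
      f_pos := fun x hx => hpos x (subset_closure hx)
      g_nonneg := hg0
      hess_f := fun x hx => (hbd x hx).2.1
      grad_ψ := fun x hx => (hbd x hx).2.2.1
      hess_ψ := fun x hx => (hbd x hx).2.2.2.1
      abs_u := fun x hx => (hbd x hx).2.2.2.2.1
      volume_le := hvol
      M_pos := hM
      ε_pos := hε
      M_le := le_add_of_nonneg_right (by positivity)
      small := hsmall
      mapsTo := fun x hx => by
        rw [← gradient_potential (hψb.diff x hx)]; exact (hMA x hx).1
      det := fun x hx s hs => by
        have h1 : ‖s • hess ψ x‖ ≤ M * ε := by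
          rw [norm_smul, Real.norm_eq_abs, abs_of_nonneg hs.1, mul_comm]
          exact mul_le_mul (hbd x hx).2.2.2.1 hs.2 hs.1 hM.le
        refine (hdet _ (h1.trans hr)).trans ?_
        calc K * ‖s • hess ψ x‖ ≤ K * (M * ε) := by gcongr
          _ ≤ (M + K * M) * ε := by nlinarith [mul_pos hM hε]
      monge := fun x hx => by
        have := (hMA x hx).2
        rwa [gradient_potential (hψb.diff x hx), hess_potential ho hψb.diff hdψ hx,
          perturbed] at this }
  have hu0 := integral_eq_zero_of_isProbabilityMeasure ho hfb.continuousOn hub hε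
    (fun x hx => (S.f_pos x hx).le) hg0
  have hlow := S.hOneNorm_le_hMinusOneNorm (hψ.of_le h1inf) hba
  set P := hOneNorm (densityMeasure Ω f) ψ
  set C := (7 * (M + K * M) * M + 2 * M ^ 3) + (M + 9216 * (M + K * M) ^ 2 * M ^ 4)
        + (M ^ 2 / 2 + 8 * M ^ 5) with hC
  have hC0 : 0 ≤ C := by positivity
  have hup : hMinusOneNorm Ω f u ≤ P + C * ε := by
    refine Real.sSup_le ?_ (add_nonneg (Real.sqrt_nonneg _) (by positivity))
    rintro _ ⟨φ, hφ, hφ1, rfl⟩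
    obtain ⟨w, hw, hw1, hw2, hpair⟩ := meanZero_normalization ho hn hc hb hf.continuousOn hpos
      hlam hlM hub hu0 hφ (integral_gradient_sq_of_hOneNorm_eq_one hφ1)
    rw [hpair]
    exact S.integral_mul_le (isBoundedC1_of_contDiffOn ho hn hc hb hw) hw1 hw2
  rw [S.W2_eq hn, ← mul_sub, abs_mul, abs_of_pos hε]
  have h2 : |P - hMinusOneNorm Ω f u| ≤ (M ^ 2 + C) * ε := by
    rw [abs_le]
    constructor <;> nlinarith [mul_nonneg hC0 hε.le, mul_pos (pow_pos hM 2) hε]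
  calc ε * |P - hMinusOneNorm Ω f u| ≤ ε * ((M ^ 2 + C) * ε) := by gcongr
    _ = _ := by ring

end W2Lin

theorem proposition3p5 (N : ℕ) (M : ℝ) :
    ∃ C : ℝ, ∀ (Ω : Set (W2Lin.E N)) (f ψ u : W2Lin.E N → ℝ) (ε lam : ℝ),
      -- a bounded convex domain
      IsOpen Ω → Ω.Nonempty → Convex ℝ Ω → Bornology.IsBounded Ω →
      -- data that are smooth up to the boundary
      ContDiffOn ℝ ∞ f (closure Ω) → ContDiffOn ℝ ∞ ψ (closure Ω) →
      ContDiffOn ℝ ∞ u (closure Ω) →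
      0 < ε → (∀ x ∈ closure Ω, 0 < f x) → (∀ x ∈ Ω, 0 ≤ W2Lin.perturbed ε f u x) →
      IsProbabilityMeasure (W2Lin.densityMeasure Ω f) →
      IsProbabilityMeasure (W2Lin.densityMeasure Ω (W2Lin.perturbed ε f u)) →
      W2Lin.NeumannBoundary Ω ψ →
      W2Lin.SolvesMongeAmpere Ω f (W2Lin.perturbed ε f u) (W2Lin.potential ε ψ) →
      W2Lin.IsLambdaOne Ω f lam →
      -- the quantities on which the constant may depend are bounded by `M`
      (∀ x ∈ Ω, ‖gradient f x‖ ≤ M ∧ ‖W2Lin.hess f x‖ ≤ M ∧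
        ‖gradient ψ x‖ ≤ M ∧ ‖W2Lin.hess ψ x‖ ≤ M ∧ |u x| ≤ M ∧ ‖gradient u x‖ ≤ M) →
      volume Ω ≤ ENNReal.ofReal M → lam⁻¹ ≤ M →
      BddAbove (W2Lin.hMinusOnePairings Ω f u) ∧
      |W2Lin.W2 (W2Lin.densityMeasure Ω f)
          (W2Lin.densityMeasure Ω (W2Lin.perturbed ε f u))
        - ε * W2Lin.hMinusOneNorm Ω f u| ≤ C * ε ^ 2 := by
  obtain ⟨K, r, hK, hr, hdet⟩ := W2Lin.exists_abs_det_id_add_sub_one_le N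
  -- These constants are fixed before `M > 0` is known. Positivity follows from `lam⁻¹ ≤ M` once
  -- data are given; for `M ≤ 0` no data satisfy the hypotheses.
  set ε₀ := min (r / M) (1 / (32 * (M + K * M))) with hε₀
  set C₁ := M ^ 2 + ((7 * (M + K * M) * M + 2 * M ^ 3) + (M + 9216 * (M + K * M) ^ 2 * M ^ 4)
        + (M ^ 2 / 2 + 8 * M ^ 5)) with hC₁
  -- For `ε > ε₀` the terms of order 1 are multiplied by `(ε / ε₀) ^ 2`, and those of order `ε` by
  -- `ε / ε₀`.
  set C₂ := (1 + 4 * (N * M)) / ε₀ ^ 2 + 2 * (N * M) * M / ε₀ + M * (M + 1) / ε₀ with hC₂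
  refine ⟨C₁ + C₂, fun Ω f ψ u ε lam ho hn hc hb hf hψ hu hε hpos hg0 hμ hν _ hMA hlam hbd hvol
    hlM => ?_⟩
  have hM : 0 < M := (inv_pos.2 hlam.1.1).trans_le hlM
  have hMK : 0 < M + K * M := by positivity
  have hε₀0 : 0 < ε₀ := lt_min (by positivity) (by positivity)
  have h1inf : (1 : WithTop ℕ∞) ≤ ∞ := by exact_mod_cast le_top
  have hub := W2Lin.isBoundedC1_of_contDiffOn ho hn hc hb (hu.of_le h1inf)
  have huM : ∀ x ∈ Ω, |u x| ≤ M := fun x hx => (hbd x hx).2.2.2.2.1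
  have hu0 := W2Lin.integral_eq_zero_of_isProbabilityMeasure ho (hf.continuousOn.mono subset_closure)
    hub hε (fun x hx => (hpos x (subset_closure hx)).le) hg0
  have hpair : ∀ s ∈ W2Lin.hMinusOnePairings Ω f u, s ≤ M * (M + 1) := fun s hs =>
    W2Lin.pairing_le ho hn hc hb hf.continuousOn hpos hlam hlM hub huM hu0 hs
  have hba : BddAbove (W2Lin.hMinusOnePairings Ω f u) := ⟨_, hpair⟩
  have hC₁0 : 0 ≤ C₁ := by positivity
  have hC₂0 : 0 ≤ C₂ := by positivity
  refine ⟨hba, ?_⟩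
  rcases le_or_gt ε ε₀ with h | h
  · have h1 : M * ε ≤ r := by
      have := h.trans (min_le_left _ _)
      rw [le_div_iff₀ hM] at this
      linarith
    have h2 : (M + K * M) * ε ≤ 1 / 32 := by
      have := h.trans (min_le_right _ _)
      rw [le_div_iff₀ (by positivity)] at this
      linarith
    refine (W2Lin.abs_W2_sub_le_of_small hK hdet ho hn hc hb hf hψ hu hε hpos hg0 hMA hlam hbd
      hvol hlM h1 h2 hba).trans ?_
    exact mul_le_mul_of_nonneg_right (le_add_of_nonneg_right hC₂0) (sq_nonneg ε)
  · have hnorm0 := W2Lin.hMinusOneNorm_nonneg Ω f u hba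
    have hnorm1 : W2Lin.hMinusOneNorm Ω f u ≤ M * (M + 1) := Real.sSup_le hpair (by positivity)
    have hW0 : 0 ≤ W2Lin.W2 (W2Lin.densityMeasure Ω f)
        (W2Lin.densityMeasure Ω (W2Lin.perturbed ε f u)) := Real.sqrt_nonneg _
    have hW := W2Lin.W2_le_of_isLambdaOne ho hn hc hb hf.continuousOn hpos hub.continuousOn huM hε
      hg0 hlam hlM
    -- The bound `√a ≤ 1 + a` makes the estimate affine in `ε`.
    have hsqrt : √(2 * (N * M) * (2 + ε * M)) ≤ 1 + 2 * (N * M) * (2 + ε * M) := by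
      rw [Real.sqrt_le_left (by positivity)]
      have : 0 ≤ 2 * (N * M) * (2 + ε * M) := by positivity
      nlinarith
    have hq : 1 ≤ ε / ε₀ := (one_le_div hε₀0).2 h.le
    have hq2 : 1 ≤ (ε / ε₀) ^ 2 := one_le_pow₀ hq
    have b1 : 1 + 4 * (N * M) ≤ (1 + 4 * (N * M)) / ε₀ ^ 2 * ε ^ 2 := by
      rw [div_mul_eq_mul_div, mul_div_assoc, ← div_pow]
      exact le_mul_of_one_le_right (by positivity) hq2
    have b2 : 2 * (N * M) * M * ε ≤ 2 * (N * M) * M / ε₀ * ε ^ 2 := by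
      have : 2 * (N * M) * M / ε₀ * ε ^ 2 = 2 * (N * M) * M * ε * (ε / ε₀) := by ring
      rw [this]
      exact le_mul_of_one_le_right (by positivity) hq
    have b3 : M * (M + 1) * ε ≤ M * (M + 1) / ε₀ * ε ^ 2 := by
      have : M * (M + 1) / ε₀ * ε ^ 2 = M * (M + 1) * ε * (ε / ε₀) := by ring
      rw [this]
      exact le_mul_of_one_le_right (by positivity) hq
    have b4 : ε * W2Lin.hMinusOneNorm Ω f u ≤ M * (M + 1) * ε := by
      rw [mul_comm]; gcongr
    have b5 : 0 ≤ ε * W2Lin.hMinusOneNorm Ω f u := by positivity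
    have b6 : C₂ * ε ^ 2 = (1 + 4 * (N * M)) / ε₀ ^ 2 * ε ^ 2 + 2 * (N * M) * M / ε₀ * ε ^ 2
        + M * (M + 1) / ε₀ * ε ^ 2 := by rw [hC₂]; ring
    have b7 : 0 ≤ C₁ * ε ^ 2 := by positivity
    rw [abs_le]
    constructor <;> nlinarith
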